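/- For a group $G$ let $K(G)$ denote the Eilenberg–MacLane space of type $(G,1)$ (constructed functorially, as the geometric realization of the nerve of $G$ regarded as a category with one object). For a normal subgroup $N\trianglelefteq G$, let $X(G,N)$ be the homotopy pushout (double mapping cylinder) of the diagram $$K(G/N)\longleftarrow K(G)\longrightarrow \{*\},$$ in which the left map is induced by the projection $G\to G/N$. The Schur multiplier of the pair $(G,N)$ is the singular homology group $M(G,N)=H_3(X(G,N);\mathbb{Z})$. Theorem. Let $G_1,G_2$ be groups and let $N_i\trianglelefteq G_i$ $(i=1,2)$ be normal subgroups. Let $G_1*G_2$ be the free product, regard $N_1*N_2$ as a subgroup of $G_1*G_2$, and let $\langle N_1*N_2\rangle^{G_1*G_2}$ be its normal closure in $G_1*G_2$. Then there is an isomorphism of abelian groups $$M\bigl(G_1*G_2,\ \langle N_1*N_2\rangle^{G_1*G_2}\bigr)\;\cong\; M(G_1,N_1)\oplus M(G_2,N_2).$$ -/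

import Mathlib

open CategoryTheory
open scoped Monoid.Coprod

universe u

/-- The Eilenberg-MacLane space `K(G)`: the geometric realization of the nerve of the
one-object category with automorphism group `G`. -/
noncomputable def eilenbergMacLane (G : Type u) [Group G] : TopCat.{u} :=
  SSet.toTop.obj (nerve (SingleObj G))

/-- The continuous map `K(G) → K(H)` induced by a group homomorphism `G → H`. -/
noncomputable def eilenbergMacLaneMap {G H : Type u} [Group G] [Group H] (φ : G →* H) :
    eilenbergMacLane G ⟶ eilenbergMacLane H :=
  SSet.toTop.map (nerveMap φ.toFunctor)

/-- The gluing relation of the double mapping cylinder of `B ←f- A -g→ C`. -/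
inductive DoubleCylinderRel {A B C : Type u} (f : A → B) (g : A → C) :
    ((A × unitInterval) ⊕ (B ⊕ C)) → ((A × unitInterval) ⊕ (B ⊕ C)) → Prop
  | left (a : A) : DoubleCylinderRel f g (Sum.inl (a, 0)) (Sum.inr (Sum.inl (f a)))
  | right (a : A) : DoubleCylinderRel f g (Sum.inl (a, 1)) (Sum.inr (Sum.inr (g a)))

/-- The homotopy pushout of `B ←f- A -g→ C`: the double mapping cylinder, i.e. the quotient
space of `(A × [0,1]) ⊔ B ⊔ C` by `(a, 0) ∼ f a` and `(a, 1) ∼ g a`. -/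
def homotopyPushout {A B C : TopCat.{u}} (f : A ⟶ B) (g : A ⟶ C) : TopCat.{u} :=
  TopCat.of (Quot (DoubleCylinderRel (f : A → B) (g : A → C)))

/-- The homotopy pushout of `K(G/N) ← K(G) → 1`. -/
noncomputable def pairSpace (G : Type u) [Group G] (N : Subgroup G) [N.Normal] : TopCat.{u} :=
  homotopyPushout (eilenbergMacLaneMap (QuotientGroup.mk' N))
    (TopCat.ofHom (ContinuousMap.const _ PUnit.unit) :
      eilenbergMacLane G ⟶ TopCat.of PUnit.{u + 1})

/-- The `n`-th singular homology group of `X` with integer coefficients. -/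
noncomputable abbrev integralHomology (n : ℕ) (X : TopCat.{u}) : ModuleCat.{u} ℤ :=
  ((AlgebraicTopology.singularHomologyFunctor (ModuleCat.{u} ℤ) n).obj
    (ModuleCat.of ℤ (ULift.{u} ℤ))).obj X

/-- The Schur multiplier `M(G, N)` of the pair `(G, N)`. -/
noncomputable abbrev pairSchurMultiplier (G : Type u) [Group G] (N : Subgroup G) [N.Normal] :
    ModuleCat.{u} ℤ :=
  integralHomology 3 (pairSpace G N)

/-!
Write `X(G, N)` for the double mapping cylinder of `K(G/N) ← K(G) → *`. The inclusions of the
factors induce maps `X(Gᵢ, Nᵢ) → X(G₁ ∗ G₂, ⟨N₁ ∗ N₂⟩)`, and these give an isomorphism from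
the direct sum of the homology groups in degree three. This is a comparison of Mayer–Vietoris
sequences (`DoubleCylinder.homologyIso_map`): it is enough that the maps from the corners of the two
diagrams to the corners of the third are jointly isomorphisms in degrees two and three. For the
points this is clear. As the quotient of `G₁ ∗ G₂` by the normal closure of `N₁ ∗ N₂` is the free
product of the groups `Gᵢ/Nᵢ` (`coprodQuotientEquiv`), the two other corners are both instances of
`homologyIso_eilenbergMacLane_coprod`: in degrees at least two, `K(G₁) ⊔ K(G₂) → K(G₁ ∗ G₂)` is an
isomorphism in homology. All homology groups are computed with the complex of free chains on the
singular simplicial set, and `HomologyIso n f` says that `f` is an isomorphism in degree `n`.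

The theorem about free products is proved with coverings. Let `G = G₁ ∗ G₂`. The realization `E` of
the simplicial set `tuples G` is contractible and carries a free action of `G`. Its quotient by `G`
is `K(G)`, and its quotients by the factors are models of `K(G₁)` and `K(G₂)`. The quotient maps
are covering maps (`IsOrbitMap.isQuotientCoveringMap`), so that the singular simplices of the
quotients are the orbits of the singular simplices of `E`. For a free `G`-set `S` the graph with
vertex set `S/G₁ ⊔ S/G₂` and edge set `S` is a forest with components `S/G`, each tree being the
Bass–Serre tree of the free product (`isForestPresentation_of_coprod`). Thus there is a short exact
sequence of complexes from the chains of `E`, through those of `E/G₁ ⊔ E/G₂`, to those of `E/G`,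
and `E` is acyclic in positive degrees.

Mayer–Vietoris sequences arise from the same kind of presentation: an open cover by two sets gives
a forest on the small singular simplices, and the small simplices theorem
(`homologyIso_smallSimplices`) is proved by barycentric subdivision. The covering property follows
from a description of the points of `E` as step functions on the unit interval with values in `G`:
the length of the part of an interval `[0, a]` on which the step function has a given value is
continuous. Equivariant maps induce homotopic maps of orbit spaces by the straight homotopy in the
join of two simplices.
-/

open Limits Simplicial HomologicalComplex Topology

/-! ### Free chains on a simplicial set -/


/-- The free abelian group functor, with integer coefficients in the lowest universe. -/
noncomputable def freeAbelian : Type u ⥤ ModuleCat.{u} ℤ where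
  obj S := ModuleCat.of ℤ (S →₀ ℤ)
  map f := ModuleCat.ofHom (Finsupp.lmapDomain ℤ ℤ f)
  map_id S := by
    ext x
    simp
  map_comp f g := by
    ext x
    simp

/-- The class of the integer `1` in the summand `x` of a coproduct of copies of `ℤ`. -/
noncomputable def sigmaConstGenerator (S : Type u) (x : S) :
    (sigmaConst.obj (ModuleCat.of ℤ (ULift.{u} ℤ))).obj S :=
  (Sigma.ι (fun _ : S => ModuleCat.of ℤ (ULift.{u} ℤ)) x).hom ⟨1⟩

lemma sigmaConst_hom_ext {S : Type u} {M : ModuleCat.{u} ℤ}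
    {f g : (sigmaConst.obj (ModuleCat.of ℤ (ULift.{u} ℤ))).obj S ⟶ M}
    (h : ∀ x, f.hom (sigmaConstGenerator S x) = g.hom (sigmaConstGenerator S x)) : f = g := by
  refine Sigma.hom_ext _ _ fun x => ?_
  refine ModuleCat.hom_ext (LinearMap.ext fun a => ?_)
  have ha : a = a.down • (⟨1⟩ : ULift.{u} ℤ) := by
    ext
    simp
  have := h x
  rw [ha, map_zsmul, map_zsmul]
  exact congrArg (a.down • ·) this

/-- The comparison from a coproduct of copies of `ℤ` to finitely supported functions. -/
noncomputable def sigmaConstToFreeAbelian (S : Type u) :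
    (sigmaConst.obj (ModuleCat.of ℤ (ULift.{u} ℤ))).obj S ⟶ freeAbelian.obj S :=
  Sigma.desc fun x => (ModuleCat.ofHom (Finsupp.lsingle (M := ℤ) (R := ℤ) x ∘ₗ
    (ULift.moduleEquiv (R := ℤ) (M := ℤ)).toLinearMap) :
      ModuleCat.of ℤ (ULift.{u} ℤ) ⟶ freeAbelian.obj S)

/-- The comparison from finitely supported functions to a coproduct of copies of `ℤ`. -/
noncomputable def freeAbelianToSigmaConst (S : Type u) :
    freeAbelian.obj S ⟶ (sigmaConst.obj (ModuleCat.of ℤ (ULift.{u} ℤ))).obj S :=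
  ModuleCat.ofHom (Finsupp.linearCombination ℤ (sigmaConstGenerator S))

/-- The basis vector `x` of the free abelian group on `S`. -/
noncomputable def freeAbelianGenerator (S : Type u) (x : S) : freeAbelian.obj S :=
  (Finsupp.single x (1 : ℤ) : S →₀ ℤ)

lemma freeAbelian_hom_ext {S : Type u} {M : ModuleCat.{u} ℤ} {f g : freeAbelian.obj S ⟶ M}
    (h : ∀ x, f.hom (freeAbelianGenerator S x) = g.hom (freeAbelianGenerator S x)) : f = g :=
  ModuleCat.hom_ext (Finsupp.lhom_ext' fun x => LinearMap.ext_ring (h x))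

lemma sigmaConstToFreeAbelian_generator (S : Type u) (x : S) :
    (sigmaConstToFreeAbelian S).hom (sigmaConstGenerator S x) = freeAbelianGenerator S x := by
  unfold sigmaConstGenerator sigmaConstToFreeAbelian
  rw [← ModuleCat.comp_apply, colimit.ι_desc]
  rfl

lemma linearCombination_single_one {S : Type*} {M : ModuleCat.{u} ℤ} (v : S → M) (x : S) :
    Finsupp.linearCombination ℤ v (Finsupp.single x 1) = v x :=
  (Finsupp.linearCombination_single ℤ 1 x).trans
    (M.isModule.toMulAction.one_smul (v x))

lemma freeAbelianToSigmaConst_generator (S : Type u) (x : S) :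
    (freeAbelianToSigmaConst S).hom (freeAbelianGenerator S x) = sigmaConstGenerator S x := by
  exact linearCombination_single_one _ x

lemma freeAbelian_map_generator {S S' : Type u} (f : S ⟶ S') (x : S) :
    (freeAbelian.map f).hom (freeAbelianGenerator S x) = freeAbelianGenerator S' (f x) :=
  Finsupp.mapDomain_single

lemma sigmaConst_map_generator {S S' : Type u} (f : S ⟶ S') (x : S) :
    ((sigmaConst.obj (ModuleCat.of ℤ (ULift.{u} ℤ))).map f).hom (sigmaConstGenerator S x) =
      sigmaConstGenerator S' (f x) := by
  unfold sigmaConstGenerator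
  rw [← ModuleCat.comp_apply]
  simp

/-- A coproduct of copies of `ℤ` is a free abelian group. -/
noncomputable def sigmaConstIsoFreeAbelian :
    sigmaConst.obj (ModuleCat.of ℤ (ULift.{u} ℤ)) ≅ freeAbelian.{u} :=
  NatIso.ofComponents
    (fun S =>
      { hom := sigmaConstToFreeAbelian S
        inv := freeAbelianToSigmaConst S
        hom_inv_id := sigmaConst_hom_ext fun x => by
          rw [ModuleCat.comp_apply, sigmaConstToFreeAbelian_generator,
            freeAbelianToSigmaConst_generator]
          rfl
        inv_hom_id := freeAbelian_hom_ext fun x => by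
          rw [ModuleCat.comp_apply, freeAbelianToSigmaConst_generator,
            sigmaConstToFreeAbelian_generator]
          rfl })
    (fun {S S'} f => sigmaConst_hom_ext fun x => by
      rw [ModuleCat.comp_apply, ModuleCat.comp_apply, sigmaConst_map_generator,
        sigmaConstToFreeAbelian_generator, sigmaConstToFreeAbelian_generator,
        freeAbelian_map_generator])

/-- The alternating chain complex of finitely supported integral chains of a simplicial set. -/
noncomputable def freeChain : SSet.{u} ⥤ ChainComplex (ModuleCat.{u} ℤ) ℕ :=
  (SimplicialObject.whiskering _ _).obj freeAbelian ⋙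
    AlgebraicTopology.alternatingFaceMapComplex (ModuleCat.{u} ℤ)

/-- The chain complex of Mathlib with integral coefficients is the complex of free chains. -/
noncomputable def chainComplexIsoFreeChain :
    (SSet.chainComplexFunctor (ModuleCat.{u} ℤ)).obj (ModuleCat.of ℤ (ULift.{u} ℤ)) ≅
      freeChain.{u} :=
  Functor.isoWhiskerRight ((SimplicialObject.whiskering _ _).mapIso sigmaConstIsoFreeAbelian)
    (AlgebraicTopology.alternatingFaceMapComplex (ModuleCat.{u} ℤ))

/-- The integral `n`-chains of a simplicial set. -/
abbrev chains (S : SSet.{u}) (n : ℕ) : Type u := S _⦋n⦌ →₀ ℤ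

/-- The boundary of an integral chain. -/
noncomputable def boundary (S : SSet.{u}) (n : ℕ) : chains S (n + 1) →ₗ[ℤ] chains S n :=
  ∑ i : Fin (n + 2), (-1 : ℤ) ^ (i : ℕ) • Finsupp.lmapDomain ℤ ℤ (S.δ i)

/-- The map on chains induced by a map of simplicial sets. -/
noncomputable def chainsMap {S T : SSet.{u}} (f : S ⟶ T) (n : ℕ) :
    chains S n →ₗ[ℤ] chains T n :=
  Finsupp.lmapDomain ℤ ℤ (f.app _)

lemma boundary_single (S : SSet.{u}) (n : ℕ) (x : S _⦋n + 1⦌) :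
    boundary S n (Finsupp.single x 1) =
      ∑ i : Fin (n + 2), (-1 : ℤ) ^ (i : ℕ) • Finsupp.single (S.δ i x) (1 : ℤ) := by
  simp only [boundary, LinearMap.sum_apply, LinearMap.smul_apply, Finsupp.lmapDomain_apply,
    Finsupp.mapDomain_single]

lemma chainsMap_single {S T : SSet.{u}} (f : S ⟶ T) (n : ℕ) (x : S _⦋n⦌) (a : ℤ) :
    chainsMap f n (Finsupp.single x a) = Finsupp.single (f.app _ x) a :=
  Finsupp.mapDomain_single

lemma freeChain_d (S : SSet.{u}) (n : ℕ) :
    (freeChain.obj S).d (n + 1) n = ModuleCat.ofHom (boundary S n) := by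
  refine ModuleCat.hom_ext ?_
  simp only [freeChain, Functor.comp_obj, AlgebraicTopology.alternatingFaceMapComplex_obj_d,
    AlgebraicTopology.AlternatingFaceMapComplex.objD, ModuleCat.hom_sum, ModuleCat.hom_zsmul]
  rfl

lemma boundary_boundary (S : SSet.{u}) (n : ℕ) (c : chains S (n + 2)) :
    boundary S n (boundary S (n + 1) c) = 0 := by
  have h := (freeChain.obj S).d_comp_d (n + 2) (n + 1) n
  rw [freeChain_d, freeChain_d] at h
  exact congrArg (fun k => k.hom c) h

lemma chainsMap_boundary {S T : SSet.{u}} (f : S ⟶ T) (n : ℕ) (c : chains S (n + 1)) :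
    chainsMap f n (boundary S n c) = boundary T n (chainsMap f (n + 1) c) := by
  have h := (freeChain.map f).comm (n + 1) n
  rw [freeChain_d, freeChain_d] at h
  exact congrArg (fun k => k.hom c) h.symm

/-- The chain map given by linear maps compatible with the boundaries of simplices. -/
noncomputable def freeChainHom {S T : SSet.{u}} (φ : ∀ n, chains S n →ₗ[ℤ] chains T n)
    (h : ∀ n x, φ n (boundary S n (Finsupp.single x 1)) =
      boundary T n (φ (n + 1) (Finsupp.single x 1))) : freeChain.obj S ⟶ freeChain.obj T where
  f n := ModuleCat.ofHom (φ n)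
  comm' i j hij := by
    obtain rfl : j + 1 = i := hij
    rw [freeChain_d, freeChain_d]
    exact ModuleCat.hom_ext (Finsupp.lhom_ext' fun x => LinearMap.ext_ring (h j x).symm)

/-! ### Maps of simplicial sets inducing isomorphisms in homology -/

/-- The map of simplicial sets `f` induces an isomorphism in integral homology in degree `n`. -/
def HomologyIso (n : ℕ) {S T : SSet.{u}} (f : S ⟶ T) : Prop :=
  IsIso (homologyMap (freeChain.map f) n)

namespace HomologyIso

variable {n : ℕ} {S T U : SSet.{u}}

lemma comp {f : S ⟶ T} {g : T ⟶ U} (hf : HomologyIso n f) (hg : HomologyIso n g) :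
    HomologyIso n (f ≫ g) := by
  unfold HomologyIso at *
  rw [Functor.map_comp, homologyMap_comp]
  infer_instance

lemma of_comp_left {f : S ⟶ T} {g : T ⟶ U} (hf : HomologyIso n f)
    (h : HomologyIso n (f ≫ g)) : HomologyIso n g := by
  unfold HomologyIso at *
  rw [Functor.map_comp, homologyMap_comp] at h
  exact IsIso.of_isIso_comp_left (homologyMap (freeChain.map f) n) _

lemma of_isIso (f : S ⟶ T) [IsIso f] : HomologyIso n f := by
  unfold HomologyIso
  infer_instance

lemma of_isZero {f : S ⟶ T} (hS : IsZero ((freeChain.obj S).homology n))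
    (hT : IsZero ((freeChain.obj T).homology n)) : HomologyIso n f :=
  ⟨0, hS.eq_of_src _ _, hT.eq_of_src _ _⟩

/-- In a commutative square whose vertical maps are homology isomorphisms, the bottom map is a
homology isomorphism as soon as the top one is. -/
lemma of_square' {S' T' : SSet.{u}} {f : S ⟶ T} {f' : S' ⟶ T'} {a : S ⟶ S'} {b : T ⟶ T'}
    (w : f ≫ b = a ≫ f') (ha : HomologyIso n a) (hb : HomologyIso n b)
    (hf : HomologyIso n f) : HomologyIso n f' :=
  of_comp_left ha (w ▸ hf.comp hb)

lemma isZero {f : S ⟶ T} (h : HomologyIso n f) (hT : IsZero ((freeChain.obj T).homology n)) :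
    IsZero ((freeChain.obj S).homology n) := by
  unfold HomologyIso at h
  exact hT.of_iso (asIso (homologyMap (freeChain.map f) n))

end HomologyIso

/-- The free chain complex of the singular simplicial set computes singular homology. -/
noncomputable def integralHomologyIso (n : ℕ) (X : TopCat.{u}) :
    integralHomology n X ≅ (freeChain.obj (TopCat.toSSet.obj X)).homology n :=
  (homologyFunctor _ _ n).mapIso (chainComplexIsoFreeChain.app (TopCat.toSSet.obj X))

lemma homologyMap_freeChain_eq_of_homotopy {X Y : TopCat.{u}} {f g : X ⟶ Y}
    (H : TopCat.Homotopy f g) (n : ℕ) :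
    homologyMap (freeChain.map (TopCat.toSSet.map f)) n =
      homologyMap (freeChain.map (TopCat.toSSet.map g)) n := by
  have h : homologyMap (SSet.chainComplexMap (TopCat.toSSet.map f)
      (ModuleCat.of ℤ (ULift.{u} ℤ))) n = homologyMap (SSet.chainComplexMap (TopCat.toSSet.map g)
        (ModuleCat.of ℤ (ULift.{u} ℤ))) n :=
    H.toSSet.congr_homologyMap (ModuleCat.of ℤ (ULift.{u} ℤ)) n
  have nat : ∀ k : X ⟶ Y, freeChain.map (TopCat.toSSet.map k) =
      chainComplexIsoFreeChain.inv.app _ ≫ SSet.chainComplexMap (TopCat.toSSet.map k)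
        (ModuleCat.of ℤ (ULift.{u} ℤ)) ≫ chainComplexIsoFreeChain.hom.app _ := fun k =>
    (NatIso.naturality_1 chainComplexIsoFreeChain (TopCat.toSSet.map k)).symm
  rw [nat, nat, homologyMap_comp, homologyMap_comp, homologyMap_comp, homologyMap_comp, h]

/-- A homotopy equivalence induces isomorphisms in homology. -/
lemma homologyIso_toSSet_map {X Y : TopCat.{u}} (f : X ⟶ Y) (g : Y ⟶ X)
    (h₁ : (f ≫ g).hom.Homotopic (𝟙 X : X ⟶ X).hom) (h₂ : (g ≫ f).hom.Homotopic (𝟙 Y : Y ⟶ Y).hom)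
    (n : ℕ) : HomologyIso n (TopCat.toSSet.map f) := by
  refine ⟨homologyMap (freeChain.map (TopCat.toSSet.map g)) n, ?_, ?_⟩
  · rw [← homologyMap_comp, ← Functor.map_comp, ← Functor.map_comp,
      homologyMap_freeChain_eq_of_homotopy (f := f ≫ g) (g := 𝟙 X) h₁.some]
    simp
  · rw [← homologyMap_comp, ← Functor.map_comp, ← Functor.map_comp,
      homologyMap_freeChain_eq_of_homotopy (f := g ≫ f) (g := 𝟙 Y) h₂.some]
    simp

lemma isZero_homology_of_subsingleton (X : TopCat.{u}) [Subsingleton X] {n : ℕ} (hn : n ≠ 0) :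
    IsZero ((freeChain.obj (TopCat.toSSet.obj X)).homology n) :=
  (AlgebraicTopology.isZero_singularHomologyFunctor_of_totallyDisconnectedSpace
    (ModuleCat.{u} ℤ) n (ModuleCat.of ℤ (ULift.{u} ℤ)) X hn).of_iso (integralHomologyIso n X).symm

/-! ### Disjoint unions of simplicial sets -/

/-- The disjoint union of two simplicial sets. -/
def sumSSet (S T : SSet.{u}) : SSet.{u} where
  obj k := S.obj k ⊕ T.obj k
  map θ := ↾(Sum.map (S.map θ) (T.map θ))
  map_id k := by
    ext (x | x) <;> simp
  map_comp θ η := by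
    ext (x | x) <;> simp

/-- The inclusion of the first summand. -/
def sumInl (S T : SSet.{u}) : S ⟶ sumSSet S T where
  app k := ↾Sum.inl

/-- The inclusion of the second summand. -/
def sumInr (S T : SSet.{u}) : T ⟶ sumSSet S T where
  app k := ↾Sum.inr

/-- The map out of a disjoint union with the given restrictions to the summands. -/
def sumDesc {S T U : SSet.{u}} (f : S ⟶ U) (g : T ⟶ U) : sumSSet S T ⟶ U where
  app k := ↾(Sum.elim (f.app k) (g.app k))
  naturality k l θ := by
    ext (x | x)
    · exact congrArg (fun h => h x) (f.naturality θ)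
    · exact congrArg (fun h => h x) (g.naturality θ)

/-- The disjoint union of two maps of simplicial sets. -/
def sumMap {S T S' T' : SSet.{u}} (f : S ⟶ S') (g : T ⟶ T') : sumSSet S T ⟶ sumSSet S' T' :=
  sumDesc (f ≫ sumInl S' T') (g ≫ sumInr S' T')

lemma sumInl_desc {S T U : SSet.{u}} (f : S ⟶ U) (g : T ⟶ U) :
    sumInl S T ≫ sumDesc f g = f := rfl

lemma sumInr_desc {S T U : SSet.{u}} (f : S ⟶ U) (g : T ⟶ U) :
    sumInr S T ≫ sumDesc f g = g := rfl

lemma sum_hom_ext {S T U : SSet.{u}} {f g : sumSSet S T ⟶ U}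
    (h₁ : sumInl S T ≫ f = sumInl S T ≫ g) (h₂ : sumInr S T ≫ f = sumInr S T ≫ g) : f = g := by
  ext k (x | x)
  · exact congrArg (fun h => h.app k x) h₁
  · exact congrArg (fun h => h.app k x) h₂

lemma sumMap_desc {S T S' T' U : SSet.{u}} (f : S ⟶ S') (g : T ⟶ T') (f' : S' ⟶ U)
    (g' : T' ⟶ U) : sumMap f g ≫ sumDesc f' g' = sumDesc (f ≫ f') (g ≫ g') :=
  sum_hom_ext rfl rfl

lemma sumSSet_cases {S T : SSet.{u}} {k : SimplexCategoryᵒᵖ} (x : (sumSSet S T).obj k) :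
    (∃ y, x = (sumInl S T).app k y) ∨ ∃ y, x = (sumInr S T).app k y := by
  rcases x with x | x
  · exact Or.inl ⟨x, rfl⟩
  · exact Or.inr ⟨x, rfl⟩

/-- The projection of the `n`-chains on a disjoint union onto those on the first summand. -/
noncomputable def sumFstChains (S T : SSet.{u}) (n : ℕ) :
    chains (sumSSet S T) n →ₗ[ℤ] chains S n :=
  Finsupp.linearCombination ℤ
    (fun x : S _⦋n⦌ ⊕ T _⦋n⦌ => Sum.elim (fun x => Finsupp.single x 1) (fun _ => 0) x)

/-- The projection of the `n`-chains on a disjoint union onto those on the second summand. -/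
noncomputable def sumSndChains (S T : SSet.{u}) (n : ℕ) :
    chains (sumSSet S T) n →ₗ[ℤ] chains T n :=
  Finsupp.linearCombination ℤ
    (fun x : S _⦋n⦌ ⊕ T _⦋n⦌ => Sum.elim (fun _ => 0) (fun x => Finsupp.single x 1) x)

lemma sumFstChains_inl (S T : SSet.{u}) (n : ℕ) (c : chains S n) :
    sumFstChains S T n (chainsMap (sumInl S T) n c) = c := by
  induction c using Finsupp.induction_linear with
  | zero => simp
  | add c d hc hd => rw [map_add, map_add, hc, hd]
  | single x a =>
    rw [chainsMap_single]
    refine (Finsupp.linearCombination_single ℤ a _).trans ?_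
    exact Finsupp.smul_single_one x a

lemma sumFstChains_inr (S T : SSet.{u}) (n : ℕ) (c : chains T n) :
    sumFstChains S T n (chainsMap (sumInr S T) n c) = 0 := by
  induction c using Finsupp.induction_linear with
  | zero => simp
  | add c d hc hd => rw [map_add, map_add, hc, hd, add_zero]
  | single x a =>
    rw [chainsMap_single]
    refine (Finsupp.linearCombination_single ℤ a _).trans ?_
    exact smul_zero a

lemma sumSndChains_inl (S T : SSet.{u}) (n : ℕ) (c : chains S n) :
    sumSndChains S T n (chainsMap (sumInl S T) n c) = 0 := by
  induction c using Finsupp.induction_linear with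
  | zero => simp
  | add c d hc hd => rw [map_add, map_add, hc, hd, add_zero]
  | single x a =>
    rw [chainsMap_single]
    refine (Finsupp.linearCombination_single ℤ a _).trans ?_
    exact smul_zero a

lemma sumSndChains_inr (S T : SSet.{u}) (n : ℕ) (c : chains T n) :
    sumSndChains S T n (chainsMap (sumInr S T) n c) = c := by
  induction c using Finsupp.induction_linear with
  | zero => simp
  | add c d hc hd => rw [map_add, map_add, hc, hd]
  | single x a =>
    rw [chainsMap_single]
    refine (Finsupp.linearCombination_single ℤ a _).trans ?_
    exact Finsupp.smul_single_one x a

/-- The projection of the chains on a disjoint union onto the chains on the first summand. -/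
noncomputable def sumFst (S T : SSet.{u}) : freeChain.obj (sumSSet S T) ⟶ freeChain.obj S :=
  freeChainHom (sumFstChains S T) (by
    intro n x
    obtain ⟨y, rfl⟩ | ⟨y, rfl⟩ := sumSSet_cases x
    · rw [← chainsMap_single, ← chainsMap_boundary, sumFstChains_inl, sumFstChains_inl]
    · rw [← chainsMap_single, ← chainsMap_boundary, sumFstChains_inr, sumFstChains_inr, map_zero])

/-- The projection of the chains on a disjoint union onto the chains on the second summand. -/
noncomputable def sumSnd (S T : SSet.{u}) : freeChain.obj (sumSSet S T) ⟶ freeChain.obj T :=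
  freeChainHom (sumSndChains S T) (by
    intro n x
    obtain ⟨y, rfl⟩ | ⟨y, rfl⟩ := sumSSet_cases x
    · rw [← chainsMap_single, ← chainsMap_boundary, sumSndChains_inl, sumSndChains_inl, map_zero]
    · rw [← chainsMap_single, ← chainsMap_boundary, sumSndChains_inr, sumSndChains_inr])

lemma freeChain_hom_ext {S : SSet.{u}} {K : ChainComplex (ModuleCat.{u} ℤ) ℕ}
    {f g : freeChain.obj S ⟶ K}
    (h : ∀ n (x : S _⦋n⦌), (f.f n).hom (Finsupp.single x 1 : chains S n) =
      (g.f n).hom (Finsupp.single x 1 : chains S n)) : f = g := by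
  ext n : 1
  exact ModuleCat.hom_ext (Finsupp.lhom_ext' fun x => LinearMap.ext_ring (h n x))

lemma sumInl_sumFst (S T : SSet.{u}) : freeChain.map (sumInl S T) ≫ sumFst S T = 𝟙 _ :=
  freeChain_hom_ext fun n _ => sumFstChains_inl S T n _

lemma sumInl_sumSnd (S T : SSet.{u}) : freeChain.map (sumInl S T) ≫ sumSnd S T = 0 :=
  freeChain_hom_ext fun n _ => sumSndChains_inl S T n _

lemma sumInr_sumFst (S T : SSet.{u}) : freeChain.map (sumInr S T) ≫ sumFst S T = 0 :=
  freeChain_hom_ext fun n _ => sumFstChains_inr S T n _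

lemma sumInr_sumSnd (S T : SSet.{u}) : freeChain.map (sumInr S T) ≫ sumSnd S T = 𝟙 _ :=
  freeChain_hom_ext fun n _ => sumSndChains_inr S T n _

lemma freeChain_sum_hom_ext {S T : SSet.{u}} {K : ChainComplex (ModuleCat.{u} ℤ) ℕ}
    {f g : freeChain.obj (sumSSet S T) ⟶ K}
    (h₁ : freeChain.map (sumInl S T) ≫ f = freeChain.map (sumInl S T) ≫ g)
    (h₂ : freeChain.map (sumInr S T) ≫ f = freeChain.map (sumInr S T) ≫ g) : f = g := by
  refine freeChain_hom_ext fun n x => ?_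
  rcases x with x | x
  · have := congrArg (fun k => (k.f n).hom (Finsupp.single x 1 : chains S n)) h₁
    change (f.f n).hom (chainsMap (sumInl S T) n (Finsupp.single x 1)) =
      (g.f n).hom (chainsMap (sumInl S T) n (Finsupp.single x 1)) at this
    rwa [chainsMap_single] at this
  · have := congrArg (fun k => (k.f n).hom (Finsupp.single x 1 : chains T n)) h₂
    change (f.f n).hom (chainsMap (sumInr S T) n (Finsupp.single x 1)) =
      (g.f n).hom (chainsMap (sumInr S T) n (Finsupp.single x 1)) at this
    rwa [chainsMap_single] at this

lemma sum_total (S T : SSet.{u}) :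
    sumFst S T ≫ freeChain.map (sumInl S T) + sumSnd S T ≫ freeChain.map (sumInr S T) = 𝟙 _ := by
  refine freeChain_sum_hom_ext ?_ ?_
  · rw [Preadditive.comp_add, ← Category.assoc, ← Category.assoc, sumInl_sumFst, sumInl_sumSnd]
    simp
  · rw [Preadditive.comp_add, ← Category.assoc, ← Category.assoc, sumInr_sumFst, sumInr_sumSnd]
    simp

/-- The homology of a disjoint union is the direct sum of the homologies. -/
noncomputable def sumHomologyEquiv (n : ℕ) (S T : SSet.{u}) :
    (freeChain.obj (sumSSet S T)).homology n ≃+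
      (freeChain.obj S).homology n × (freeChain.obj T).homology n :=
  let i := homologyMap (freeChain.map (sumInl S T)) n
  let j := homologyMap (freeChain.map (sumInr S T)) n
  let p := homologyMap (sumFst S T) n
  let q := homologyMap (sumSnd S T) n
  have hip : i ≫ p = 𝟙 _ := by
    rw [← homologyMap_comp, sumInl_sumFst, homologyMap_id]
  have hiq : i ≫ q = 0 := by
    rw [← homologyMap_comp, sumInl_sumSnd, homologyMap_zero]
  have hjp : j ≫ p = 0 := by
    rw [← homologyMap_comp, sumInr_sumFst, homologyMap_zero]
  have hjq : j ≫ q = 𝟙 _ := by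
    rw [← homologyMap_comp, sumInr_sumSnd, homologyMap_id]
  have htot : p ≫ i + q ≫ j = 𝟙 _ := by
    rw [← homologyMap_comp, ← homologyMap_comp, ← homologyMap_add, sum_total, homologyMap_id]
  { toFun := fun x => (p.hom x, q.hom x)
    invFun := fun y => i.hom y.1 + j.hom y.2
    left_inv := fun x => congrArg (fun k => k.hom x) htot
    right_inv := fun y => by
      refine Prod.ext ?_ ?_
      · have h₁ := congrArg (fun k => k.hom y.1) hip
        have h₂ := congrArg (fun k => k.hom y.2) hjp
        change p.hom (i.hom y.1) = y.1 at h₁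
        change p.hom (j.hom y.2) = 0 at h₂
        change p.hom (i.hom y.1 + j.hom y.2) = y.1
        rw [map_add, h₁, h₂, add_zero]
      · have h₁ := congrArg (fun k => k.hom y.1) hiq
        have h₂ := congrArg (fun k => k.hom y.2) hjq
        change q.hom (i.hom y.1) = 0 at h₁
        change q.hom (j.hom y.2) = y.2 at h₂
        change q.hom (i.hom y.1 + j.hom y.2) = y.2
        rw [map_add, h₁, h₂, zero_add]
    map_add' := fun x y => Prod.ext (map_add p.hom x y) (map_add q.hom x y) }

lemma HomologyIso.sum {n : ℕ} {S T S' T' : SSet.{u}} {f : S ⟶ S'} {g : T ⟶ T'}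
    (hf : HomologyIso n f) (hg : HomologyIso n g) : HomologyIso n (sumMap f g) := by
  unfold HomologyIso at hf hg ⊢
  have hl : sumInl S T ≫ sumMap f g = f ≫ sumInl S' T' := rfl
  have hr : sumInr S T ≫ sumMap f g = g ≫ sumInr S' T' := rfl
  have hp : freeChain.map (sumMap f g) ≫ sumFst S' T' = sumFst S T ≫ freeChain.map f := by
    refine freeChain_sum_hom_ext ?_ ?_
    · rw [← Category.assoc, ← Functor.map_comp, hl, Functor.map_comp, Category.assoc,
        sumInl_sumFst, ← Category.assoc, sumInl_sumFst, Category.comp_id, Category.id_comp]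
    · rw [← Category.assoc, ← Functor.map_comp, hr, Functor.map_comp, Category.assoc,
        sumInr_sumFst, ← Category.assoc, sumInr_sumFst, comp_zero, zero_comp]
  have hq : freeChain.map (sumMap f g) ≫ sumSnd S' T' = sumSnd S T ≫ freeChain.map g := by
    refine freeChain_sum_hom_ext ?_ ?_
    · rw [← Category.assoc, ← Functor.map_comp, hl, Functor.map_comp, Category.assoc,
        sumInl_sumSnd, ← Category.assoc, sumInl_sumSnd, comp_zero, zero_comp]
    · rw [← Category.assoc, ← Functor.map_comp, hr, Functor.map_comp, Category.assoc,
        sumInr_sumSnd, ← Category.assoc, sumInr_sumSnd, Category.comp_id, Category.id_comp]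
  have hp' := congrArg (fun k => homologyMap k n) hp
  have hq' := congrArg (fun k => homologyMap k n) hq
  have hl' := congrArg (fun k => homologyMap (freeChain.map k) n) hl
  have hr' := congrArg (fun k => homologyMap (freeChain.map k) n) hr
  have ht := congrArg (fun k => homologyMap k n) (sum_total S T)
  have ht' := congrArg (fun k => homologyMap k n) (sum_total S' T')
  simp only [Functor.map_comp, homologyMap_comp, homologyMap_add, homologyMap_id]
    at hp' hq' hl' hr' ht ht'
  refine ⟨homologyMap (sumFst S' T') n ≫ inv (homologyMap (freeChain.map f) n) ≫
      homologyMap (freeChain.map (sumInl S T)) n +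
    homologyMap (sumSnd S' T') n ≫ inv (homologyMap (freeChain.map g) n) ≫
      homologyMap (freeChain.map (sumInr S T)) n, ?_, ?_⟩
  · rw [Preadditive.comp_add, reassoc_of% hp', reassoc_of% hq', IsIso.hom_inv_id_assoc,
      IsIso.hom_inv_id_assoc, ht]
  · rw [Preadditive.add_comp, Category.assoc, Category.assoc, Category.assoc, Category.assoc,
      hl', hr', IsIso.inv_hom_id_assoc, IsIso.inv_hom_id_assoc, ht']

/-! ### Exactness criteria for free chains -/

/-- If any two points of a fiber of `c` differ by an element of the range of `α`, then a chain that
vanishes in the quotient lies in this range: it can be moved to a section of `c`. -/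
lemma mem_range_of_mapDomain_eq_zero {A V C : Type*} (α : (A →₀ ℤ) →ₗ[ℤ] V →₀ ℤ) (c : V → C)
    (hc : Function.Surjective c)
    (hconn : ∀ x y, c x = c y →
      (Finsupp.single x 1 - Finsupp.single y 1 : V →₀ ℤ) ∈ LinearMap.range α)
    (z : V →₀ ℤ) (hz : Finsupp.mapDomain c z = 0) : z ∈ LinearMap.range α := by
  have key : ∀ z : V →₀ ℤ,
      z - Finsupp.mapDomain (Function.surjInv hc) (Finsupp.mapDomain c z) ∈ LinearMap.range α := by
    intro z
    induction z using Finsupp.induction_linear with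
    | zero => simp
    | add z w hz hw =>
      have := add_mem hz hw
      rwa [← add_sub_add_comm, ← Finsupp.mapDomain_add, ← Finsupp.mapDomain_add] at this
    | single x a =>
      rw [Finsupp.mapDomain_single, Finsupp.mapDomain_single]
      have := Submodule.smul_mem _ a (hconn x (Function.surjInv hc (c x))
        (Function.surjInv_eq hc (c x)).symm)
      rwa [smul_sub, Finsupp.smul_single_one, Finsupp.smul_single_one] at this
  simpa [hz] using key z

/-- Two maps `p, q : A ⟶ V` of simplicial sets and a map `c : V ⟶ C` present the chains of `C` as
the quotient of the chains of `V` by the differences `p a - q a`, without relations between these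
differences. Regarding the simplices of `A` as edges of a graph with vertices the simplices
of `V`, this graph is a forest in each degree, with set of components the simplices of `C`. -/
structure IsForestPresentation {A V C : SSet.{u}} (p q : A ⟶ V) (c : V ⟶ C) : Prop where
  w : p ≫ c = q ≫ c
  injective (n : ℕ) : Function.Injective (chainsMap p n - chainsMap q n)
  surjective (n : ℕ) : Function.Surjective (c.app (.op ⦋n⦌))
  connected (n : ℕ) (x y : V _⦋n⦌) : c.app _ x = c.app _ y →
    (Finsupp.single x 1 - Finsupp.single y 1 : chains V n) ∈
      LinearMap.range (chainsMap p n - chainsMap q n)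

namespace IsForestPresentation

variable {A V C : SSet.{u}} {p q : A ⟶ V} {c : V ⟶ C}

/-- The short complex of chain complexes of a forest presentation. -/
noncomputable def shortComplex (h : IsForestPresentation p q c) :
    ShortComplex (ChainComplex (ModuleCat.{u} ℤ) ℕ) where
  f := freeChain.map p - freeChain.map q
  g := freeChain.map c
  zero := by rw [Preadditive.sub_comp, ← Functor.map_comp, ← Functor.map_comp, h.w, sub_self]

lemma shortExact (h : IsForestPresentation p q c) : h.shortComplex.ShortExact := by
  refine shortExact_of_degreewise_shortExact _ fun n => ?_
  have hinj : Function.Injective ((freeChain.map p - freeChain.map q).f n).hom := h.injective n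
  have hsurj : Function.Surjective ((freeChain.map c).f n).hom :=
    Finsupp.mapDomain_surjective (h.surjective n)
  have : Mono ((freeChain.map p - freeChain.map q).f n) := (ModuleCat.mono_iff_injective _).2 hinj
  have : Epi ((freeChain.map c).f n) := (ModuleCat.epi_iff_surjective _).2 hsurj
  exact
    { exact := (ShortComplex.moduleCat_exact_iff _).2 fun z hz =>
        mem_range_of_mapDomain_eq_zero (chainsMap p n - chainsMap q n) (c.app _)
          (h.surjective n) (h.connected n) z hz
      mono_f := ‹_›
      epi_g := ‹_› }

/-- If the edges have no homology, then the components have the homology of the vertices. -/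
lemma homologyIso (h : IsForestPresentation p q c) {n : ℕ}
    (h₁ : IsZero ((freeChain.obj A).homology (n + 1)))
    (h₀ : IsZero ((freeChain.obj A).homology n)) : HomologyIso (n + 1) c := by
  have hm : Mono (homologyMap h.shortComplex.g (n + 1)) :=
    (h.shortExact.homology_exact₂ (n + 1)).mono_g (h₁.eq_of_src _ _)
  have he : Epi (homologyMap h.shortComplex.g (n + 1)) :=
    (h.shortExact.homology_exact₃ (n + 1) n rfl).epi_f (h₀.eq_of_tgt _ _)
  exact isIso_of_mono_of_epi (homologyMap h.shortComplex.g (n + 1))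

/-- The five lemma for a map between two forest presentations. -/
lemma homologyIso_map {A' V' C' : SSet.{u}} {p' q' : A' ⟶ V'} {c' : V' ⟶ C'}
    (h : IsForestPresentation p q c) (h' : IsForestPresentation p' q' c')
    {a : A ⟶ A'} {v : V ⟶ V'} {f : C ⟶ C'}
    (hp : p ≫ v = a ≫ p') (hq : q ≫ v = a ≫ q') (hc : c ≫ f = v ≫ c') {n : ℕ}
    (ha₁ : HomologyIso (n + 1) a) (ha₀ : HomologyIso n a)
    (hv₁ : HomologyIso (n + 1) v) (hv₀ : HomologyIso n v) : HomologyIso (n + 1) f := by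
  unfold HomologyIso at ha₁ ha₀ hv₁ hv₀
  let φ : h.shortComplex ⟶ h'.shortComplex :=
    { τ₁ := freeChain.map a
      τ₂ := freeChain.map v
      τ₃ := freeChain.map f
      comm₁₂ := by
        change freeChain.map a ≫ (freeChain.map p' - freeChain.map q') =
          (freeChain.map p - freeChain.map q) ≫ freeChain.map v
        rw [Preadditive.comp_sub, Preadditive.sub_comp, ← Functor.map_comp, ← Functor.map_comp,
          ← Functor.map_comp, ← Functor.map_comp, hp, hq]
      comm₂₃ := by
        change freeChain.map v ≫ freeChain.map c' = freeChain.map c ≫ freeChain.map f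
        rw [← Functor.map_comp, ← Functor.map_comp, hc] }
  refine HomologySequence.isIso_homologyMap_τ₃ φ h.shortExact h'.shortExact (n + 1)
    (IsIso.epi_of_iso (homologyMap (freeChain.map a) (n + 1))) hv₁ ?_ ?_
  · rintro j hj
    obtain rfl : j = n := by simpa using hj
    exact ha₀
  · rintro j hj
    obtain rfl : j = n := by simpa using hj
    exact IsIso.mono_of_iso (homologyMap (freeChain.map v) j)

end IsForestPresentation

/-- An inclusion of simplicial sets is a homology isomorphism if every relative cycle is
a relative boundary. -/
lemma homologyIso_of_relative_cycles {P T : SSet.{u}} (i : P ⟶ T)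
    (hi : ∀ n, Function.Injective (i.app (.op ⦋n⦌)))
    (h₀ : ∀ c : chains T 0, ∃ d b, c - boundary T 0 d = chainsMap i 0 b)
    (h : ∀ n (c : chains T (n + 1)) (a : chains P n), boundary T n c = chainsMap i n a →
      ∃ d b, c - boundary T (n + 1) d = chainsMap i (n + 1) b) (n : ℕ) :
    HomologyIso n i := by
  have hmono : ∀ n, Mono ((freeChain.map i).f n) := fun n =>
    (ModuleCat.mono_iff_injective _).2 (Finsupp.mapDomain_injective (hi n))
  have : Mono (freeChain.map i) := mono_of_mono_f _ hmono
  let S : ShortComplex (ChainComplex (ModuleCat.{u} ℤ) ℕ) :=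
    ShortComplex.mk (freeChain.map i) (cokernel.π (freeChain.map i)) (cokernel.condition _)
  have hS : S.ShortExact :=
    { exact := ShortComplex.exact_cokernel _
      mono_f := ‹_›
      epi_g := by dsimp only [S]; infer_instance }
  have hex : ∀ n (z : chains T n), (S.g.f n).hom z = 0 → ∃ b, chainsMap i n b = z := by
    intro n z hz
    have := (hS.map_of_exact (eval _ _ n)).exact
    exact (ShortComplex.moduleCat_exact_iff _).1 this z hz
  have hsurj : ∀ n, Function.Surjective (S.g.f n).hom := by
    intro n
    have := (hS.map_of_exact (eval _ _ n)).epi_g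
    exact (ModuleCat.epi_iff_surjective _).1 this
  have hb : ∀ n (d : chains T (n + 1)), (S.X₃.d (n + 1) n).hom ((S.g.f (n + 1)).hom d) =
      (S.g.f n).hom (boundary T n d) := by
    intro n d
    have := congrArg (fun k => k.hom d) (S.g.comm (n + 1) n)
    have hd : S.X₂.d (n + 1) n = ModuleCat.ofHom (boundary T n) := freeChain_d T n
    rw [hd] at this
    exact this
  have hzero : ∀ n (b : chains P n), (S.g.f n).hom (chainsMap i n b) = 0 := by
    intro n b
    exact congrArg (fun k => (k.f n).hom b) S.zero
  have hcongr : ∀ n (c e : chains T n) (b : chains P n), c - e = chainsMap i n b →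
      (S.g.f n).hom e = (S.g.f n).hom c := by
    intro n c e b hb
    have h₁ : (S.g.f n).hom (c - e : chains T n) = (S.g.f n).hom c - (S.g.f n).hom e :=
      map_sub (S.g.f n).hom c e
    have h₂ : (S.g.f n).hom (c - e : chains T n) = 0 := hb ▸ hzero n b
    exact (sub_eq_zero.1 (h₁.symm.trans h₂)).symm
  -- the hypotheses say that the complex of relative chains is acyclic
  have hex3 : ∀ n, S.X₃.ExactAt n := by
    intro n
    cases n with
    | zero =>
      rw [exactAt_iff' S.X₃ 1 0 0 (by simp) (by simp), ShortComplex.moduleCat_exact_iff]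
      intro z _
      obtain ⟨c, rfl⟩ := hsurj 0 z
      obtain ⟨d, b, hdb⟩ := h₀ c
      refine ⟨(S.g.f 1).hom d, ?_⟩
      refine (hb 0 d).trans ?_
      exact hcongr 0 c _ b hdb
    | succ n =>
      rw [exactAt_iff' S.X₃ (n + 2) (n + 1) n (by simp) (by simp),
        ShortComplex.moduleCat_exact_iff]
      intro z hz
      obtain ⟨c, rfl⟩ := hsurj (n + 1) z
      obtain ⟨a, ha⟩ := hex n _ ((hb n c).symm.trans hz)
      obtain ⟨d, b, hdb⟩ := h n c a ha.symm
      refine ⟨(S.g.f (n + 2)).hom d, ?_⟩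
      refine (hb (n + 1) d).trans ?_
      exact hcongr (n + 1) c _ b hdb
  have hz : ∀ n, IsZero (S.X₃.homology n) := fun n => (hex3 n).isZero_homology
  have hm : Mono (homologyMap S.f n) :=
    (hS.homology_exact₁ (n + 1) n rfl).mono_g ((hz (n + 1)).eq_of_src _ _)
  have he : Epi (homologyMap S.f n) :=
    (hS.homology_exact₂ n).epi_f ((hz n).eq_of_tgt _ _)
  exact isIso_of_mono_of_epi (homologyMap S.f n)

/-! ### Barycentric subdivision of tuples of points -/

/-- The simplicial set whose `n`-simplices are the `(n + 1)`-tuples of elements of `Z`. -/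
def tuples (Z : Type u) : SSet.{u} where
  obj k := Fin (k.unop.len + 1) → Z
  map θ := ↾fun v => v ∘ θ.unop.toOrderHom

/-- The map on tuples induced by a map of sets. -/
def tuplesMap {Z Z' : Type u} (φ : Z → Z') : tuples Z ⟶ tuples Z' where
  app k := ↾fun v => φ ∘ v

namespace Subdivision

variable {Z Z' : Type u}

/-- The chain on a tuple. -/
noncomputable def tuple {n : ℕ} (v : Fin (n + 1) → Z) : chains (tuples Z) n :=
  Finsupp.single (v : (tuples Z) _⦋n⦌) 1

lemma chains_induction {n : ℕ} {p : chains (tuples Z) n → Prop} (c : chains (tuples Z) n)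
    (h₀ : p 0) (hadd : ∀ c d, p c → p d → p (c + d)) (hsmul : ∀ (a : ℤ) c, p c → p (a • c))
    (h : ∀ v : Fin (n + 1) → Z, p (tuple v)) : p c := by
  induction c using Finsupp.induction_linear with
  | zero => exact h₀
  | add c d hc hd => exact hadd c d hc hd
  | single v a =>
    have hv : Finsupp.single v a = a • tuple v := (Finsupp.smul_single_one v a).symm
    rw [hv]
    exact hsmul a _ (h v)

lemma linearMap_ext_tuple {n : ℕ} {M : Type*} [AddCommGroup M]
    {f g : chains (tuples Z) n →ₗ[ℤ] M} (h : ∀ v : Fin (n + 1) → Z, f (tuple v) = g (tuple v)) :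
    f = g :=
  Finsupp.lhom_ext' fun v => LinearMap.ext_ring (h v)

lemma boundary_tuple {n : ℕ} (v : Fin (n + 2) → Z) :
    boundary (tuples Z) n (tuple v) =
      ∑ i : Fin (n + 2), (-1 : ℤ) ^ (i : ℕ) • tuple (v ∘ i.succAbove) :=
  boundary_single _ _ _

lemma chainsMap_tuple (φ : Z → Z') {n : ℕ} (v : Fin (n + 1) → Z) :
    chainsMap (tuplesMap φ) n (tuple v) = tuple (φ ∘ v) :=
  chainsMap_single _ _ _ _

/-- The cone operator, which adds the vertex `b` in front of a tuple. -/
noncomputable def cone (b : Z) (n : ℕ) : chains (tuples Z) n →ₗ[ℤ] chains (tuples Z) (n + 1) :=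
  Finsupp.lmapDomain ℤ ℤ fun v : Fin (n + 1) → Z => (Fin.cons b v : Fin (n + 2) → Z)

lemma cone_tuple (b : Z) {n : ℕ} (v : Fin (n + 1) → Z) :
    cone b n (tuple v) = tuple (Fin.cons b v : Fin (n + 2) → Z) :=
  Finsupp.mapDomain_single

lemma cons_comp_succAbove_succ (b : Z) {n : ℕ} (v : Fin (n + 2) → Z) (i : Fin (n + 2)) :
    (Fin.cons b v : Fin (n + 3) → Z) ∘ i.succ.succAbove = Fin.cons b (v ∘ i.succAbove) := by
  funext j
  cases j using Fin.cases with
  | zero => simp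
  | succ j => simp

lemma boundary_cone (b : Z) (n : ℕ) (c : chains (tuples Z) (n + 1)) :
    boundary (tuples Z) (n + 1) (cone b (n + 1) c) = c - cone b n (boundary (tuples Z) n c) := by
  suffices h : boundary (tuples Z) (n + 1) ∘ₗ cone b (n + 1) =
      LinearMap.id - cone b n ∘ₗ boundary (tuples Z) n from congrArg (fun f => f c) h
  refine linearMap_ext_tuple fun v => ?_
  simp only [LinearMap.comp_apply, LinearMap.sub_apply, LinearMap.id_apply]
  rw [cone_tuple, boundary_tuple, Fin.sum_univ_succ, boundary_tuple, map_sum, sub_eq_add_neg,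
    ← Finset.sum_neg_distrib]
  congr 1
  · simp only [Fin.val_zero, pow_zero, one_smul]
    rfl
  · refine Finset.sum_congr rfl fun i _ => ?_
    rw [cons_comp_succAbove_succ, map_smul, cone_tuple, Fin.val_succ, pow_succ]
    simp

/-- In degree zero the boundary of the cone on a point is the point minus the apex; the apex
cancels on a chain of augmentation zero, such as a boundary. -/
lemma boundary_cone_boundary (b : Z) (c : chains (tuples Z) 1) :
    boundary (tuples Z) 0 (cone b 0 (boundary (tuples Z) 0 c)) = boundary (tuples Z) 0 c := by
  suffices h : boundary (tuples Z) 0 ∘ₗ cone b 0 ∘ₗ boundary (tuples Z) 0 =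
      boundary (tuples Z) 0 from congrArg (fun f => f c) h
  refine linearMap_ext_tuple fun v => ?_
  have hc : ∀ w : Fin 1 → Z, boundary (tuples Z) 0 (cone b 0 (tuple w)) =
      tuple w - tuple fun _ => b := by
    intro w
    rw [cone_tuple, boundary_tuple, Fin.sum_univ_two]
    have h₀ : (Fin.cons b w : Fin 2 → Z) ∘ (0 : Fin 2).succAbove = w := by
      funext j
      simp
    have h₁ : (Fin.cons b w : Fin 2 → Z) ∘ (1 : Fin 2).succAbove = fun _ => b := by
      funext j
      fin_cases j
      rfl
    rw [h₀, h₁]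
    simp [sub_eq_add_neg]
  simp only [LinearMap.comp_apply]
  rw [boundary_tuple, Fin.sum_univ_two]
  simp [hc, sub_eq_add_neg]

variable (β : ∀ n, (Fin (n + 1) → Z) → Z)

/-- Barycentric subdivision of chains of tuples, for an arbitrary choice `β` of barycenters: the
subdivision of a simplex is the cone from its barycenter over the subdivision of its boundary. -/
noncomputable def sd (n : ℕ) : chains (tuples Z) n →ₗ[ℤ] chains (tuples Z) n :=
  Nat.rec (motive := fun n => chains (tuples Z) n →ₗ[ℤ] chains (tuples Z) n) LinearMap.id
    (fun n sdn => Finsupp.linearCombination ℤ fun v : Fin (n + 2) → Z =>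
      cone (β (n + 1) v) n (sdn (boundary (tuples Z) n (tuple v)))) n

/-- The chain homotopy from barycentric subdivision to the identity. -/
noncomputable def sdHomotopy (n : ℕ) : chains (tuples Z) n →ₗ[ℤ] chains (tuples Z) (n + 1) :=
  Nat.rec (motive := fun n => chains (tuples Z) n →ₗ[ℤ] chains (tuples Z) (n + 1)) 0
    (fun n h => Finsupp.linearCombination ℤ fun v : Fin (n + 2) → Z =>
      cone (β (n + 1) v) (n + 1) (tuple v - h (boundary (tuples Z) n (tuple v)))) n

lemma sd_zero (c : chains (tuples Z) 0) : sd β 0 c = c := rfl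

lemma sdHomotopy_zero (c : chains (tuples Z) 0) : sdHomotopy β 0 c = 0 := rfl

lemma sd_succ_tuple {n : ℕ} (v : Fin (n + 2) → Z) :
    sd β (n + 1) (tuple v) = cone (β (n + 1) v) n (sd β n (boundary (tuples Z) n (tuple v))) :=
  (Finsupp.linearCombination_single ℤ 1 (v : Fin (n + 2) → Z)).trans (one_smul ℤ _)

lemma sdHomotopy_succ_tuple {n : ℕ} (v : Fin (n + 2) → Z) :
    sdHomotopy β (n + 1) (tuple v) = cone (β (n + 1) v) (n + 1)
      (tuple v - sdHomotopy β n (boundary (tuples Z) n (tuple v))) :=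
  (Finsupp.linearCombination_single ℤ 1 (v : Fin (n + 2) → Z)).trans (one_smul ℤ _)

lemma boundary_sd (n : ℕ) (c : chains (tuples Z) (n + 1)) :
    boundary (tuples Z) n (sd β (n + 1) c) = sd β n (boundary (tuples Z) n c) := by
  induction n with
  | zero =>
    suffices h : boundary (tuples Z) 0 ∘ₗ sd β 1 = sd β 0 ∘ₗ boundary (tuples Z) 0 from
      congrArg (fun f => f c) h
    refine linearMap_ext_tuple fun v => ?_
    simp only [LinearMap.comp_apply]
    rw [sd_succ_tuple, sd_zero, boundary_cone_boundary]
  | succ n ih =>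
    suffices h : boundary (tuples Z) (n + 1) ∘ₗ sd β (n + 2) =
      sd β (n + 1) ∘ₗ boundary (tuples Z) (n + 1) from congrArg (fun f => f c) h
    refine linearMap_ext_tuple fun v => ?_
    simp only [LinearMap.comp_apply]
    rw [sd_succ_tuple, boundary_cone, ih, boundary_boundary, map_zero, map_zero, sub_zero]

lemma boundary_sdHomotopy (n : ℕ) (c : chains (tuples Z) (n + 1)) :
    boundary (tuples Z) (n + 1) (sdHomotopy β (n + 1) c) =
      c - sd β (n + 1) c - sdHomotopy β n (boundary (tuples Z) n c) := by
  induction n with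
  | zero =>
    suffices h : boundary (tuples Z) 1 ∘ₗ sdHomotopy β 1 = LinearMap.id - sd β 1 -
        sdHomotopy β 0 ∘ₗ boundary (tuples Z) 0 from congrArg (fun f => f c) h
    refine linearMap_ext_tuple fun v => ?_
    simp only [LinearMap.comp_apply, LinearMap.sub_apply, LinearMap.id_apply]
    rw [sdHomotopy_succ_tuple, sdHomotopy_zero, sub_zero, boundary_cone, sd_succ_tuple, sd_zero,
      sub_zero]
  | succ n ih =>
    suffices h : boundary (tuples Z) (n + 2) ∘ₗ sdHomotopy β (n + 2) = LinearMap.id -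
        sd β (n + 2) - sdHomotopy β (n + 1) ∘ₗ boundary (tuples Z) (n + 1) from
      congrArg (fun f => f c) h
    refine linearMap_ext_tuple fun v => ?_
    simp only [LinearMap.comp_apply, LinearMap.sub_apply, LinearMap.id_apply]
    rw [sdHomotopy_succ_tuple, boundary_cone, map_sub, ih, boundary_boundary, map_zero, sub_zero,
      sub_sub_cancel, sd_succ_tuple]
    abel

variable {β} {β' : ∀ n, (Fin (n + 1) → Z') → Z'}

lemma chainsMap_cone (φ : Z → Z') (b : Z) (n : ℕ) (c : chains (tuples Z) n) :
    chainsMap (tuplesMap φ) (n + 1) (cone b n c) =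
      cone (φ b) n (chainsMap (tuplesMap φ) n c) := by
  suffices h : chainsMap (tuplesMap φ) (n + 1) ∘ₗ cone b n =
      cone (φ b) n ∘ₗ chainsMap (tuplesMap φ) n from congrArg (fun f => f c) h
  refine linearMap_ext_tuple fun v => ?_
  simp only [LinearMap.comp_apply]
  rw [cone_tuple, chainsMap_tuple, chainsMap_tuple, cone_tuple]
  congr 1
  funext j
  cases j using Fin.cases with
  | zero => simp
  | succ j => simp

lemma chainsMap_sd (φ : Z → Z') (hφ : ∀ n v, φ (β n v) = β' n (φ ∘ v)) (n : ℕ)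
    (c : chains (tuples Z) n) :
    chainsMap (tuplesMap φ) n (sd β n c) = sd β' n (chainsMap (tuplesMap φ) n c) := by
  induction n with
  | zero => rfl
  | succ n ih =>
    suffices h : chainsMap (tuplesMap φ) (n + 1) ∘ₗ sd β (n + 1) =
        sd β' (n + 1) ∘ₗ chainsMap (tuplesMap φ) (n + 1) from congrArg (fun f => f c) h
    refine linearMap_ext_tuple fun v => ?_
    simp only [LinearMap.comp_apply]
    rw [sd_succ_tuple, chainsMap_cone, ih, chainsMap_boundary, chainsMap_tuple, sd_succ_tuple, hφ]

lemma chainsMap_sdHomotopy (φ : Z → Z') (hφ : ∀ n v, φ (β n v) = β' n (φ ∘ v)) (n : ℕ)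
    (c : chains (tuples Z) n) :
    chainsMap (tuplesMap φ) (n + 1) (sdHomotopy β n c) =
      sdHomotopy β' n (chainsMap (tuplesMap φ) n c) := by
  induction n with
  | zero => exact map_zero _
  | succ n ih =>
    suffices h : chainsMap (tuplesMap φ) (n + 2) ∘ₗ sdHomotopy β (n + 1) =
        sdHomotopy β' (n + 1) ∘ₗ chainsMap (tuplesMap φ) (n + 1) from congrArg (fun f => f c) h
    refine linearMap_ext_tuple fun v => ?_
    simp only [LinearMap.comp_apply]
    rw [sdHomotopy_succ_tuple, chainsMap_cone, map_sub, ih, chainsMap_boundary, chainsMap_tuple,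
      sdHomotopy_succ_tuple, hφ]

/-! ### The mesh of a barycentric subdivision -/

/-- The chains of tuples satisfying a predicate. -/
def tupleChains {n : ℕ} (p : (Fin (n + 1) → Z) → Prop) : Submodule ℤ (chains (tuples Z) n) :=
  Finsupp.supported ℤ ℤ {v : (tuples Z) _⦋n⦌ | p v}

lemma tuple_mem_tupleChains {n : ℕ} {p : (Fin (n + 1) → Z) → Prop} {v : Fin (n + 1) → Z}
    (h : p v) : tuple v ∈ tupleChains p :=
  Finsupp.single_mem_supported ℤ _ h

lemma map_mem_of_mem_tupleChains {n : ℕ} {p : (Fin (n + 1) → Z) → Prop}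
    {M : Type*} [AddCommGroup M] (f : chains (tuples Z) n →ₗ[ℤ] M) (N : Submodule ℤ M)
    (h : ∀ v, p v → f (tuple v) ∈ N) {c : chains (tuples Z) n} (hc : c ∈ tupleChains p) :
    f c ∈ N := by
  have : tupleChains p ≤ N.comap f := by
    unfold tupleChains
    rw [Finsupp.supported_eq_span_single, Submodule.span_le]
    rintro _ ⟨v, hv, rfl⟩
    exact h v hv
  exact this hc

lemma tupleChains_mono {n : ℕ} {p q : (Fin (n + 1) → Z) → Prop} (h : ∀ v, p v → q v) :
    tupleChains p ≤ tupleChains q :=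
  Finsupp.supported_mono fun v hv => h v hv

variable {E : Type*} [NormedAddCommGroup E] [NormedSpace ℝ E] (e : Z → E)
  (hβ : ∀ n v, e (β n v) = ((n : ℝ) + 1)⁻¹ • ∑ i, e (v i))

include hβ

lemma norm_sub_barycenter_le {n : ℕ} {v : Fin (n + 1) → Z} {q : E} {r : ℝ}
    (h : ∀ i, ‖e (v i) - q‖ ≤ r) : ‖e (β n v) - q‖ ≤ r := by
  have hn : (0 : ℝ) < (n : ℝ) + 1 := by positivity
  have : e (β n v) - q = ((n : ℝ) + 1)⁻¹ • ∑ i, (e (v i) - q) := by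
    rw [hβ, Finset.sum_sub_distrib, smul_sub, Finset.sum_const, Finset.card_univ, Fintype.card_fin,
      ← Nat.cast_smul_eq_nsmul ℝ, smul_smul]
    push_cast
    rw [inv_mul_cancel₀ hn.ne', one_smul]
  rw [this, norm_smul, norm_inv, Real.norm_of_nonneg hn.le, inv_mul_le_iff₀ hn]
  refine (norm_sum_le _ _).trans ((Finset.sum_le_card_nsmul _ _ r fun i _ => h i).trans ?_)
  simp

lemma norm_sub_barycenter_le_mesh {n : ℕ} {v : Fin (n + 1) → Z} {ε : ℝ}
    (h : ∀ i j, ‖e (v i) - e (v j)‖ ≤ ε) (i : Fin (n + 1)) :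
    ‖e (v i) - e (β n v)‖ ≤ n / (n + 1) * ε := by
  have hn : (0 : ℝ) < (n : ℝ) + 1 := by positivity
  have : e (v i) - e (β n v) = ((n : ℝ) + 1)⁻¹ • ∑ j, (e (v i) - e (v j)) := by
    rw [hβ, Finset.sum_sub_distrib, smul_sub, Finset.sum_const, Finset.card_univ, Fintype.card_fin,
      ← Nat.cast_smul_eq_nsmul ℝ, smul_smul]
    push_cast
    rw [inv_mul_cancel₀ hn.ne', one_smul]
  rw [this, norm_smul, norm_inv, Real.norm_of_nonneg hn.le, div_mul_eq_mul_div, div_eq_inv_mul]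
  refine mul_le_mul_of_nonneg_left ?_ (by positivity)
  rw [← Finset.add_sum_erase _ _ (Finset.mem_univ i), sub_self, zero_add]
  refine (norm_sum_le _ _).trans ((Finset.sum_le_card_nsmul _ _ ε fun j _ => h i j).trans ?_)
  rw [Finset.card_erase_of_mem (Finset.mem_univ i)]
  simp

/-- The simplices of the subdivision of `v` have mesh smaller than that of `v` by the
factor `n / (n + 1)`, and their vertices lie in each ball which contains the vertices of `v`. -/
lemma sd_tuple_mem {n : ℕ} (v : Fin (n + 1) → Z) {ε : ℝ}
    (h : ∀ i j, ‖e (v i) - e (v j)‖ ≤ ε) :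
    sd β n (tuple v) ∈ tupleChains fun w : Fin (n + 1) → Z =>
      (∀ i j, ‖e (w i) - e (w j)‖ ≤ n / (n + 1) * ε) ∧
        ∀ q r, (∀ i, ‖e (v i) - q‖ ≤ r) → ∀ i, ‖e (w i) - q‖ ≤ r := by
  have hε : 0 ≤ ε := (norm_nonneg _).trans (h 0 0)
  induction n with
  | zero =>
    refine tuple_mem_tupleChains ⟨fun i j => ?_, fun q r hq => hq⟩
    rw [Subsingleton.elim (α := Fin 1) i j]
    simp
  | succ n ih =>
    rw [sd_succ_tuple, boundary_tuple, map_sum, map_sum]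
    refine sum_mem fun k _ => ?_
    rw [map_smul, map_smul]
    refine Submodule.smul_mem _ _ ?_
    refine map_mem_of_mem_tupleChains (cone (β (n + 1) v) n) _ ?_
      (ih (v ∘ k.succAbove) fun i j => h _ _)
    rintro w ⟨hw₁, hw₂⟩
    rw [cone_tuple]
    have hle : (n : ℝ) / (n + 1) * ε ≤ ((n + 1 : ℕ) : ℝ) / ((n + 1 : ℕ) + 1) * ε := by
      refine mul_le_mul_of_nonneg_right ?_ hε
      push_cast
      rw [div_le_div_iff₀ (by positivity) (by positivity)]
      nlinarith
    have hb : ∀ i, ‖e (w i) - e (β (n + 1) v)‖ ≤ ((n + 1 : ℕ) : ℝ) / ((n + 1 : ℕ) + 1) * ε :=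
      hw₂ _ _ fun i => norm_sub_barycenter_le_mesh e hβ h _
    refine tuple_mem_tupleChains ⟨fun i j => ?_, fun q r hq i => ?_⟩
    · cases i using Fin.cases with
      | zero =>
        cases j using Fin.cases with
        | zero =>
          simp only [Fin.cons_zero, sub_self, norm_zero]
          positivity
        | succ j =>
          rw [Fin.cons_zero, Fin.cons_succ, norm_sub_rev]
          exact hb j
      | succ i =>
        cases j using Fin.cases with
        | zero => exact hb i
        | succ j => exact (hw₁ i j).trans hle
    · cases i using Fin.cases with
      | zero => exact norm_sub_barycenter_le e hβ hq
      | succ i => exact hw₂ q r (fun i => hq _) i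

lemma iterate_sd_tuple_mem {n : ℕ} (v : Fin (n + 1) → Z) {ε : ℝ}
    (h : ∀ i j, ‖e (v i) - e (v j)‖ ≤ ε) (k : ℕ) :
    (sd β n)^[k] (tuple v) ∈ tupleChains fun w : Fin (n + 1) → Z =>
      ∀ i j, ‖e (w i) - e (w j)‖ ≤ ((n : ℝ) / (n + 1)) ^ k * ε := by
  induction k with
  | zero => simpa using tuple_mem_tupleChains (p := fun w => ∀ i j, ‖e (w i) - e (w j)‖ ≤ ε) h
  | succ k ih =>
    rw [Function.iterate_succ_apply']
    refine map_mem_of_mem_tupleChains (sd β n) _ (fun w hw => ?_) ih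
    refine tupleChains_mono (fun w' hw' => ?_) (sd_tuple_mem e hβ w hw)
    intro i j
    rw [pow_succ', mul_assoc]
    exact hw'.1 i j

end Subdivision

/-! ### Barycentric subdivision of singular chains -/

/-- The coordinates of a point of a topological simplex. -/
noncomputable def coords {l : SimplexCategory} (p : SimplexCategory.toTop.{u}.obj l) :
    Fin (l.len + 1) → ℝ :=
  p.down.1

lemma coords_injective {l : SimplexCategory} {p q : SimplexCategory.toTop.{u}.obj l}
    (h : coords p = coords q) : p = q :=
  ULift.ext _ _ (Subtype.ext h)

lemma coords_nonneg {l : SimplexCategory} (p : SimplexCategory.toTop.{u}.obj l)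
    (i : Fin (l.len + 1)) : 0 ≤ coords p i :=
  p.down.2.1 i

lemma sum_coords {l : SimplexCategory} (p : SimplexCategory.toTop.{u}.obj l) :
    ∑ i, coords p i = 1 :=
  p.down.2.2

lemma continuous_coords (l : SimplexCategory) : Continuous (coords.{u} (l := l)) :=
  continuous_subtype_val.comp continuous_uliftDown

/-- The point of a topological simplex with given coordinates. -/
noncomputable def mkPoint {l : SimplexCategory} (x : Fin (l.len + 1) → ℝ) (h₀ : ∀ i, 0 ≤ x i)
    (h₁ : ∑ i, x i = 1) : SimplexCategory.toTop.{u}.obj l :=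
  ULift.up ⟨x, h₀, h₁⟩

lemma coords_mkPoint {l : SimplexCategory} (x : Fin (l.len + 1) → ℝ) (h₀ : ∀ i, 0 ≤ x i)
    (h₁ : ∑ i, x i = 1) : coords (mkPoint.{u} x h₀ h₁) = x := rfl

lemma coords_toTop_map {k l : SimplexCategory} (θ : k ⟶ l)
    (p : SimplexCategory.toTop.{u}.obj k) (j : Fin (l.len + 1)) :
    coords (SimplexCategory.toTop.map θ p) j =
      ∑ i with θ.toOrderHom i = j, coords p i := by
  have h := stdSimplex.map_coe (S := ℝ) θ.toOrderHom p.down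
  have h' := congrFun h j
  refine Eq.trans h' ?_
  rw [FunOnFinite.linearMap_apply_apply]
  rfl

/-- The affine map between topological simplices with given values at the vertices, as a map of
sets. -/
noncomputable def affineFun {k l : SimplexCategory}
    (v : Fin (k.len + 1) → SimplexCategory.toTop.{u}.obj l)
    (p : SimplexCategory.toTop.{u}.obj k) : SimplexCategory.toTop.{u}.obj l :=
  mkPoint (fun j => ∑ i, coords p i * coords (v i) j)
    (fun j => Finset.sum_nonneg fun i _ => mul_nonneg (coords_nonneg _ _) (coords_nonneg _ _))
    (by
      rw [Finset.sum_comm]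
      simp_rw [← Finset.mul_sum, sum_coords, mul_one, sum_coords])

lemma continuous_affineFun {k l : SimplexCategory}
    (v : Fin (k.len + 1) → SimplexCategory.toTop.{u}.obj l) : Continuous (affineFun v) := by
  refine continuous_uliftUp.comp (Continuous.subtype_mk (continuous_pi fun j => ?_) _)
  refine continuous_finsetSum _ fun i _ => ?_
  exact ((continuous_apply i).comp (continuous_coords k)).mul continuous_const

/-- The affine map between topological simplices with given values at the vertices. -/
noncomputable def affineMap {k l : SimplexCategory}
    (v : Fin (k.len + 1) → SimplexCategory.toTop.{u}.obj l) :
    SimplexCategory.toTop.{u}.obj k ⟶ SimplexCategory.toTop.{u}.obj l :=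
  TopCat.ofHom ⟨affineFun v, continuous_affineFun v⟩

lemma coords_affineMap {k l : SimplexCategory}
    (v : Fin (k.len + 1) → SimplexCategory.toTop.{u}.obj l) (p : SimplexCategory.toTop.{u}.obj k)
    (j : Fin (l.len + 1)) : coords (affineMap v p) j = ∑ i, coords p i * coords (v i) j := rfl

/-- The vertices of a topological simplex. -/
noncomputable def vertices (l : SimplexCategory) (i : Fin (l.len + 1)) :
    SimplexCategory.toTop.{u}.obj l :=
  ULift.up (stdSimplex.vertex i)

lemma coords_vertices {l : SimplexCategory} (i j : Fin (l.len + 1)) :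
    coords (vertices.{u} l i) j = if j = i then 1 else 0 := by
  change (Pi.single i (1 : ℝ) : Fin (l.len + 1) → ℝ) j = _
  rw [Pi.single_apply]

lemma affineMap_vertices (l : SimplexCategory) : affineMap (vertices.{u} l) = 𝟙 _ := by
  ext p
  refine coords_injective (funext fun j => ?_)
  rw [coords_affineMap]
  simp [coords_vertices]

lemma affineMap_apply_vertices {k l : SimplexCategory}
    (v : Fin (k.len + 1) → SimplexCategory.toTop.{u}.obj l) (i : Fin (k.len + 1)) :
    affineMap v (vertices k i) = v i := by
  refine coords_injective (funext fun j => ?_)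
  rw [coords_affineMap]
  simp [coords_vertices]

lemma affineMap_comp {k l m : SimplexCategory}
    (v : Fin (k.len + 1) → SimplexCategory.toTop.{u}.obj l)
    (w : Fin (l.len + 1) → SimplexCategory.toTop.{u}.obj m) :
    affineMap v ≫ affineMap w = affineMap fun i => affineMap w (v i) := by
  ext p
  refine coords_injective (funext fun j => ?_)
  change coords (affineMap w (affineMap v p)) j = _
  simp only [coords_affineMap, Finset.sum_mul, Finset.mul_sum]
  rw [Finset.sum_comm]
  simp only [mul_assoc]

lemma toTop_map_affineMap {k k' l : SimplexCategory} (θ : k' ⟶ k)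
    (v : Fin (k.len + 1) → SimplexCategory.toTop.{u}.obj l) :
    SimplexCategory.toTop.map θ ≫ affineMap v = affineMap (v ∘ θ.toOrderHom) := by
  ext p
  refine coords_injective (funext fun j => ?_)
  change coords (affineMap v (SimplexCategory.toTop.map θ p)) j = _
  simp only [coords_affineMap, coords_toTop_map]
  rw [← Finset.sum_fiberwise (s := Finset.univ) (g := θ.toOrderHom)]
  refine Finset.sum_congr rfl fun i _ => ?_
  rw [Finset.sum_mul]
  refine Finset.sum_congr rfl fun a ha => ?_
  rw [Function.comp_apply, (Finset.mem_filter.1 ha).2]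

/-- The singular simplex given by a continuous map from a topological simplex. -/
noncomputable def singularSimplex {X : TopCat.{u}} {k : SimplexCategoryᵒᵖ}
    (σ : SimplexCategory.toTop.obj k.unop ⟶ X) : (TopCat.toSSet.obj X).obj k :=
  ULift.up σ

lemma singularSimplex_down {X : TopCat.{u}} {k : SimplexCategoryᵒᵖ}
    (σ : (TopCat.toSSet.obj X).obj k) : singularSimplex σ.down = σ := rfl

/-- A tuple of points of the domain of `σ` spans an affine singular simplex, which is composed
with `σ`. -/
noncomputable def affineSimplices {X : TopCat.{u}} {l : SimplexCategory}
    (σ : SimplexCategory.toTop.{u}.obj l ⟶ X) :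
    tuples (SimplexCategory.toTop.{u}.obj l) ⟶ TopCat.toSSet.obj X where
  app k := ↾fun v => singularSimplex (affineMap v ≫ σ)
  naturality k k' θ := by
    ext v
    exact congrArg (fun f => singularSimplex (f ≫ σ)) (toTop_map_affineMap θ.unop v).symm

lemma tuplesMap_affineSimplices {X : TopCat.{u}} {k l : SimplexCategory}
    (v : Fin (k.len + 1) → SimplexCategory.toTop.{u}.obj l)
    (σ : SimplexCategory.toTop.{u}.obj l ⟶ X) :
    tuplesMap (affineMap v) ≫ affineSimplices σ = affineSimplices (affineMap v ≫ σ) := by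
  ext m w
  exact congrArg (fun f => singularSimplex (f ≫ σ)) (affineMap_comp w v).symm

/-- The barycenter of a tuple of points of a topological simplex. -/
noncomputable def barycenter (l : SimplexCategory) (n : ℕ)
    (v : Fin (n + 1) → SimplexCategory.toTop.{u}.obj l) : SimplexCategory.toTop.{u}.obj l :=
  affineMap (k := ⦋n⦌) v (mkPoint (fun _ => ((n : ℝ) + 1)⁻¹) (fun _ => by positivity) (by
    simp only [Finset.sum_const, Finset.card_univ, Fintype.card_fin, SimplexCategory.len_mk,
      nsmul_eq_mul]
    push_cast
    exact mul_inv_cancel₀ (by positivity)))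

lemma coords_barycenter (l : SimplexCategory) (n : ℕ)
    (v : Fin (n + 1) → SimplexCategory.toTop.{u}.obj l) :
    coords (barycenter l n v) = ((n : ℝ) + 1)⁻¹ • ∑ i, coords (v i) := by
  funext j
  rw [barycenter, coords_affineMap]
  simp only [coords_mkPoint, Pi.smul_apply, Finset.sum_apply, smul_eq_mul, Finset.mul_sum]

lemma affineMap_barycenter {k l : SimplexCategory}
    (w : Fin (k.len + 1) → SimplexCategory.toTop.{u}.obj l) (n : ℕ)
    (v : Fin (n + 1) → SimplexCategory.toTop.{u}.obj k) :
    affineMap w (barycenter k n v) = barycenter l n (affineMap w ∘ v) := by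
  unfold barycenter
  rw [← TopCat.comp_app, affineMap_comp]
  rfl

namespace Subdivision

variable {X : TopCat.{u}}

lemma tuple_vertices (σ : (TopCat.toSSet.obj X) _⦋n⦌) :
    chainsMap (affineSimplices σ.down) n (tuple (vertices ⦋n⦌)) = Finsupp.single σ 1 := by
  refine (chainsMap_single _ _ _ _).trans ?_
  refine congrArg (fun τ => Finsupp.single τ (1 : ℤ)) ?_
  change singularSimplex (affineMap (vertices ⦋n⦌) ≫ σ.down) = σ
  rw [affineMap_vertices, Category.id_comp, singularSimplex_down]

/-- Barycentric subdivision of singular chains: the affine subdivision of the standard simplex,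
pushed forward along each singular simplex. -/
noncomputable def singularSd (X : TopCat.{u}) (n : ℕ) :
    chains (TopCat.toSSet.obj X) n →ₗ[ℤ] chains (TopCat.toSSet.obj X) n :=
  Finsupp.linearCombination ℤ fun σ =>
    chainsMap (affineSimplices σ.down) n (sd (barycenter ⦋n⦌) n (tuple (vertices ⦋n⦌)))

/-- The chain homotopy from barycentric subdivision of singular chains to the identity. -/
noncomputable def singularSdHomotopy (X : TopCat.{u}) (n : ℕ) :
    chains (TopCat.toSSet.obj X) n →ₗ[ℤ] chains (TopCat.toSSet.obj X) (n + 1) :=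
  Finsupp.linearCombination ℤ fun σ => chainsMap (affineSimplices σ.down) (n + 1)
    (sdHomotopy (barycenter ⦋n⦌) n (tuple (vertices ⦋n⦌)))

lemma chainsMap_comp {S T U : SSet.{u}} (f : S ⟶ T) (g : T ⟶ U) (n : ℕ) (c : chains S n) :
    chainsMap (f ≫ g) n c = chainsMap g n (chainsMap f n c) :=
  congrArg (fun φ => (φ.f n).hom c) (freeChain.map_comp f g)

lemma singularSd_affineSimplices {l : SimplexCategory} (σ : SimplexCategory.toTop.{u}.obj l ⟶ X)
    (n : ℕ) (c : chains (tuples (SimplexCategory.toTop.{u}.obj l)) n) :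
    singularSd X n (chainsMap (affineSimplices σ) n c) =
      chainsMap (affineSimplices σ) n (sd (barycenter l) n c) := by
  suffices h : singularSd X n ∘ₗ chainsMap (affineSimplices σ) n =
      chainsMap (affineSimplices σ) n ∘ₗ sd (barycenter l) n from congrArg (fun f => f c) h
  refine linearMap_ext_tuple fun v => ?_
  have hv : chainsMap (affineSimplices σ) n (tuple v) =
      Finsupp.single (singularSimplex (affineMap (k := ⦋n⦌) v ≫ σ)) 1 := chainsMap_single _ _ _ _
  have hv' : tuple v = chainsMap (tuplesMap (affineMap (k := ⦋n⦌) v)) n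
      (tuple (vertices ⦋n⦌)) := by
    rw [chainsMap_tuple]
    exact congrArg tuple (funext fun i => (affineMap_apply_vertices (k := ⦋n⦌) v i).symm)
  simp only [LinearMap.comp_apply]
  rw [hv, singularSd, Finsupp.linearCombination_single, one_smul]
  conv_rhs => rw [hv', ← chainsMap_sd _ fun m w => affineMap_barycenter (k := ⦋n⦌) v m w]
  rw [← chainsMap_comp, tuplesMap_affineSimplices]
  rfl

lemma singularSdHomotopy_affineSimplices {l : SimplexCategory}
    (σ : SimplexCategory.toTop.{u}.obj l ⟶ X)
    (n : ℕ) (c : chains (tuples (SimplexCategory.toTop.{u}.obj l)) n) :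
    singularSdHomotopy X n (chainsMap (affineSimplices σ) n c) =
      chainsMap (affineSimplices σ) (n + 1) (sdHomotopy (barycenter l) n c) := by
  suffices h : singularSdHomotopy X n ∘ₗ chainsMap (affineSimplices σ) n =
      chainsMap (affineSimplices σ) (n + 1) ∘ₗ sdHomotopy (barycenter l) n from
    congrArg (fun f => f c) h
  refine linearMap_ext_tuple fun v => ?_
  have hv : chainsMap (affineSimplices σ) n (tuple v) =
      Finsupp.single (singularSimplex (affineMap (k := ⦋n⦌) v ≫ σ)) 1 := chainsMap_single _ _ _ _
  have hv' : tuple v = chainsMap (tuplesMap (affineMap (k := ⦋n⦌) v)) n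
      (tuple (vertices ⦋n⦌)) := by
    rw [chainsMap_tuple]
    exact congrArg tuple (funext fun i => (affineMap_apply_vertices (k := ⦋n⦌) v i).symm)
  simp only [LinearMap.comp_apply]
  rw [hv, singularSdHomotopy, Finsupp.linearCombination_single, one_smul]
  conv_rhs => rw [hv', ← chainsMap_sdHomotopy _ fun m w => affineMap_barycenter (k := ⦋n⦌) v m w]
  rw [← chainsMap_comp, tuplesMap_affineSimplices]
  rfl

lemma singular_linearMap_ext {n : ℕ} {M : Type*} [AddCommGroup M]
    {f g : chains (TopCat.toSSet.obj X) n →ₗ[ℤ] M}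
    (h : ∀ (σ : SimplexCategory.toTop.{u}.obj ⦋n⦌ ⟶ X),
      f (chainsMap (affineSimplices σ) n (tuple (vertices ⦋n⦌))) =
        g (chainsMap (affineSimplices σ) n (tuple (vertices ⦋n⦌)))) : f = g :=
  Finsupp.lhom_ext' fun σ => LinearMap.ext_ring (by
    have := h σ.down
    rwa [tuple_vertices] at this)

lemma boundary_singularSdHomotopy (n : ℕ) (c : chains (TopCat.toSSet.obj X) (n + 1)) :
    boundary _ (n + 1) (singularSdHomotopy X (n + 1) c) =
      c - singularSd X (n + 1) c - singularSdHomotopy X n (boundary _ n c) := by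
  suffices h : boundary _ (n + 1) ∘ₗ singularSdHomotopy X (n + 1) = LinearMap.id -
      singularSd X (n + 1) - singularSdHomotopy X n ∘ₗ boundary _ n from congrArg (fun f => f c) h
  refine singular_linearMap_ext fun σ => ?_
  simp only [LinearMap.comp_apply, LinearMap.sub_apply, LinearMap.id_apply]
  rw [singularSdHomotopy_affineSimplices, singularSd_affineSimplices, ← chainsMap_boundary,
    ← chainsMap_boundary, boundary_sdHomotopy, singularSdHomotopy_affineSimplices, map_sub,
    map_sub]

lemma boundary_singularSd (n : ℕ) (c : chains (TopCat.toSSet.obj X) (n + 1)) :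
    boundary _ n (singularSd X (n + 1) c) = singularSd X n (boundary _ n c) := by
  suffices h : boundary _ n ∘ₗ singularSd X (n + 1) = singularSd X n ∘ₗ boundary _ n from
    congrArg (fun f => f c) h
  refine singular_linearMap_ext fun σ => ?_
  simp only [LinearMap.comp_apply]
  rw [singularSd_affineSimplices, ← chainsMap_boundary, ← chainsMap_boundary, boundary_sd,
    singularSd_affineSimplices]

end Subdivision

/-! ### Small singular simplices -/

/-- The continuous map underlying a singular simplex. -/
noncomputable def simplexMap {X : TopCat.{u}} {k : SimplexCategoryᵒᵖ}
    (σ : (TopCat.toSSet.obj X).obj k) : SimplexCategory.toTop.{u}.obj k.unop ⟶ X :=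
  σ.down

/-- The singular simplices whose image lies in one of the sets of a family. -/
def smallSimplices {X : TopCat.{u}} (𝒰 : Set (Set X)) : (TopCat.toSSet.obj X).Subcomplex where
  obj k := {σ | ∃ U ∈ 𝒰, ∀ p, simplexMap σ p ∈ U}
  map θ := by
    rintro σ ⟨U, hU, h⟩
    exact ⟨U, hU, fun p => h _⟩

lemma mem_smallSimplices {X : TopCat.{u}} {𝒰 : Set (Set X)} {k : SimplexCategoryᵒᵖ}
    {σ : (TopCat.toSSet.obj X).obj k} :
    σ ∈ (smallSimplices 𝒰).obj k ↔ ∃ U ∈ 𝒰, ∀ p, simplexMap σ p ∈ U := Iff.rfl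

/-- The chains of a simplicial set which lie in a subcomplex. -/
noncomputable def subcomplexChains {S : SSet.{u}} (A : S.Subcomplex) (n : ℕ) :
    Submodule ℤ (chains S n) :=
  Finsupp.supported ℤ ℤ (A.obj (Opposite.op ⦋n⦌))

lemma single_mem_subcomplexChains {S : SSet.{u}} {A : S.Subcomplex} {n : ℕ} {x : S _⦋n⦌}
    (hx : x ∈ A.obj (Opposite.op ⦋n⦌)) (a : ℤ) :
    (Finsupp.single x a : chains S n) ∈ subcomplexChains A n :=
  Finsupp.single_mem_supported ℤ a hx

lemma subcomplexChains_induction {S : SSet.{u}} {A : S.Subcomplex} {n : ℕ}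
    {M : Type*} [AddCommGroup M] (N : Submodule ℤ M) (f : chains S n →ₗ[ℤ] M)
    (h : ∀ x ∈ A.obj (Opposite.op ⦋n⦌), f (Finsupp.single x 1) ∈ N) {c : chains S n}
    (hc : c ∈ subcomplexChains A n) : f c ∈ N := by
  suffices h' : subcomplexChains A n ≤ N.comap f from h' hc
  rw [subcomplexChains, Finsupp.supported_eq_span_single, Submodule.span_le]
  rintro _ ⟨x, hx, rfl⟩
  exact h x hx

lemma mem_subcomplexChains_iff {S : SSet.{u}} {A : S.Subcomplex} {n : ℕ} {c : chains S n} :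
    c ∈ subcomplexChains A n ↔ ∃ b, c = chainsMap A.ι n b := by
  constructor
  · intro hc
    suffices h : c ∈ LinearMap.range (chainsMap A.ι n) from h.imp fun _ => Eq.symm
    refine subcomplexChains_induction (LinearMap.range (chainsMap A.ι n)) LinearMap.id ?_ hc
    intro x hx
    exact ⟨Finsupp.single ⟨x, hx⟩ 1, chainsMap_single _ _ _ _⟩
  · rintro ⟨b, rfl⟩
    induction b using Finsupp.induction_linear with
    | zero => rw [map_zero]; exact zero_mem _
    | add b c hb hc => rw [map_add]; exact add_mem hb hc
    | single x a =>
      rw [chainsMap_single]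
      exact single_mem_subcomplexChains x.2 a

namespace Subdivision

variable {X : TopCat.{u}} {𝒰 : Set (Set X)}

lemma affineSimplices_tuple_mem {l : SimplexCategory} {σ : SimplexCategory.toTop.{u}.obj l ⟶ X}
    {U : Set X} (hU : U ∈ 𝒰) {n : ℕ} {w : Fin (n + 1) → SimplexCategory.toTop.{u}.obj l}
    (h : ∀ p, σ (affineMap (k := ⦋n⦌) w p) ∈ U) :
    chainsMap (affineSimplices σ) n (tuple w) ∈ subcomplexChains (smallSimplices 𝒰) n := by
  have hw : chainsMap (affineSimplices σ) n (tuple w) =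
      Finsupp.single (singularSimplex (affineMap (k := ⦋n⦌) w ≫ σ)) 1 := chainsMap_single _ _ _ _
  rw [hw]
  exact single_mem_subcomplexChains (mem_smallSimplices.2 ⟨U, hU, h⟩) 1

lemma chainsMap_affineSimplices_mem {l : SimplexCategory}
    {σ : SimplexCategory.toTop.{u}.obj l ⟶ X} {U : Set X} (hU : U ∈ 𝒰) (hσ : ∀ p, σ p ∈ U) (n : ℕ)
    (c : chains (tuples (SimplexCategory.toTop.{u}.obj l)) n) :
    chainsMap (affineSimplices σ) n c ∈ subcomplexChains (smallSimplices 𝒰) n := by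
  refine chains_induction (p := fun c => chainsMap (affineSimplices σ) n c ∈
    subcomplexChains (smallSimplices 𝒰) n) c ?_ (fun c d hc hd => ?_) (fun a c hc => ?_)
    fun v => ?_
  · rw [map_zero]; exact zero_mem _
  · rw [map_add]; exact add_mem hc hd
  · rw [map_smul]; exact Submodule.smul_mem _ _ hc
  · exact affineSimplices_tuple_mem hU fun p => hσ _

lemma singularSd_mem {n : ℕ} {c : chains (TopCat.toSSet.obj X) n}
    (hc : c ∈ subcomplexChains (smallSimplices 𝒰) n) :
    singularSd X n c ∈ subcomplexChains (smallSimplices 𝒰) n := by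
  refine subcomplexChains_induction _ _ (fun σ hσ => ?_) hc
  obtain ⟨U, hU, h⟩ := mem_smallSimplices.1 hσ
  rw [singularSd, Finsupp.linearCombination_single, one_smul]
  exact chainsMap_affineSimplices_mem hU h _ _

lemma singularSdHomotopy_mem {n : ℕ} {c : chains (TopCat.toSSet.obj X) n}
    (hc : c ∈ subcomplexChains (smallSimplices 𝒰) n) :
    singularSdHomotopy X n c ∈ subcomplexChains (smallSimplices 𝒰) (n + 1) := by
  refine subcomplexChains_induction _ _ (fun σ hσ => ?_) hc
  obtain ⟨U, hU, h⟩ := mem_smallSimplices.1 hσ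
  rw [singularSdHomotopy, Finsupp.linearCombination_single, one_smul]
  exact chainsMap_affineSimplices_mem hU h _ _

lemma iterate_singularSd_mem {n : ℕ} {c : chains (TopCat.toSSet.obj X) n}
    (hc : c ∈ subcomplexChains (smallSimplices 𝒰) n) (k : ℕ) :
    (singularSd X n)^[k] c ∈ subcomplexChains (smallSimplices 𝒰) n := by
  induction k with
  | zero => exact hc
  | succ k ih =>
    rw [Function.iterate_succ_apply']
    exact singularSd_mem ih

lemma iterate_singularSd_affineSimplices {l : SimplexCategory}
    (σ : SimplexCategory.toTop.{u}.obj l ⟶ X)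
    (n : ℕ) (c : chains (tuples (SimplexCategory.toTop.{u}.obj l)) n) (k : ℕ) :
    (singularSd X n)^[k] (chainsMap (affineSimplices σ) n c) =
      chainsMap (affineSimplices σ) n ((sd (barycenter l) n)^[k] c) := by
  induction k with
  | zero => rfl
  | succ k ih => rw [Function.iterate_succ_apply', ih, Function.iterate_succ_apply',
      singularSd_affineSimplices]

/-- Lebesgue's number lemma for a singular simplex. -/
lemma exists_lebesgue_number (h𝒰 : ∀ U ∈ 𝒰, IsOpen U) (hcover : ⋃₀ 𝒰 = Set.univ)
    {l : SimplexCategory} (σ : SimplexCategory.toTop.{u}.obj l ⟶ X) :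
    ∃ δ > 0, ∀ p : SimplexCategory.toTop.{u}.obj l, ∃ U ∈ 𝒰,
      ∀ q, ‖coords q - coords p‖ < δ → σ q ∈ U := by
  let g : stdSimplex ℝ (Fin (l.len + 1)) → X := fun y => σ (ULift.up y)
  have hg : Continuous g := σ.hom.continuous.comp continuous_uliftUp
  have hc : (Set.univ : Set (stdSimplex ℝ (Fin (l.len + 1)))) ⊆ ⋃ U : 𝒰, g ⁻¹' U := by
    intro y _
    have hy : g y ∈ ⋃₀ 𝒰 := hcover ▸ Set.mem_univ _
    obtain ⟨U, hU, hy⟩ := hy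
    exact Set.mem_iUnion.2 ⟨⟨U, hU⟩, hy⟩
  obtain ⟨δ, hδ, h⟩ := lebesgue_number_lemma_of_metric isCompact_univ
    (fun U : 𝒰 => (h𝒰 U U.2).preimage hg) hc
  refine ⟨δ, hδ, fun p => ?_⟩
  obtain ⟨U, hU⟩ := h p.down (Set.mem_univ _)
  refine ⟨U, U.2, fun q hq => ?_⟩
  have hq' : dist (α := stdSimplex ℝ (Fin (l.len + 1))) q.down p.down < δ :=
    (dist_eq_norm (coords q) (coords p)).trans_lt hq
  exact hU (Metric.mem_ball.2 hq')

lemma norm_coords_affineMap_sub_lt {k l : SimplexCategory}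
    (w : Fin (k.len + 1) → SimplexCategory.toTop.{u}.obj l) {x : Fin (l.len + 1) → ℝ} {δ : ℝ}
    (h : ∀ i, ‖coords (w i) - x‖ < δ) (p : SimplexCategory.toTop.{u}.obj k) :
    ‖coords (affineMap w p) - x‖ < δ := by
  have : ∑ i, coords p i • coords (w i) ∈ Metric.ball x δ :=
    (convex_ball x δ).sum_mem (fun i _ => coords_nonneg p i) (sum_coords p)
      fun i _ => by rw [Metric.mem_ball, dist_eq_norm]; exact h i
  rw [Metric.mem_ball, dist_eq_norm] at this
  have h' : coords (affineMap w p) = ∑ i, coords p i • coords (w i) := by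
    funext j
    rw [coords_affineMap]
    simp
  rwa [h']

/-- Iterated subdivision makes each chain small, as the mesh tends to zero. -/
lemma exists_iterate_singularSd_mem (h𝒰 : ∀ U ∈ 𝒰, IsOpen U) (hcover : ⋃₀ 𝒰 = Set.univ)
    {n : ℕ} (c : chains (TopCat.toSSet.obj X) n) :
    ∃ k, (singularSd X n)^[k] c ∈ subcomplexChains (smallSimplices 𝒰) n := by
  induction c using Finsupp.induction_linear with
  | zero => exact ⟨0, zero_mem _⟩
  | add c d hc hd =>
    obtain ⟨k, hk⟩ := hc
    obtain ⟨m, hm⟩ := hd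
    refine ⟨m + k, ?_⟩
    rw [iterate_map_add]
    refine add_mem ?_ ?_
    · rw [Function.iterate_add_apply]
      exact iterate_singularSd_mem hk m
    · rw [add_comm, Function.iterate_add_apply]
      exact iterate_singularSd_mem hm k
  | single σ a =>
    obtain ⟨δ, hδ, h⟩ := exists_lebesgue_number h𝒰 hcover (simplexMap σ)
    have hlt : (n / (n + 1) : ℝ) < 1 := (div_lt_one (by positivity)).2 (by linarith)
    obtain ⟨k, hk⟩ := exists_pow_lt_of_lt_one hδ hlt
    refine ⟨k, ?_⟩
    have hs : (Finsupp.single σ a : chains (TopCat.toSSet.obj X) n) =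
        a • chainsMap (affineSimplices (simplexMap σ)) n (tuple (vertices ⦋n⦌)) := by
      refine Eq.trans (Finsupp.smul_single_one _ _).symm (congrArg (a • ·) ?_)
      exact (tuple_vertices σ).symm
    have hit : (singularSd X n)^[k] (a • chainsMap (affineSimplices (simplexMap σ)) n
        (tuple (vertices ⦋n⦌))) = a • (singularSd X n)^[k]
        (chainsMap (affineSimplices (simplexMap σ)) n (tuple (vertices ⦋n⦌))) :=
      Function.Commute.iterate_left (f := singularSd X n) (g := fun c => a • c)
        (fun c => map_smul _ _ _) k _
    rw [hs, hit, iterate_singularSd_affineSimplices]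
    refine Submodule.smul_mem _ _ ?_
    have hmem := iterate_sd_tuple_mem (β := barycenter.{u} ⦋n⦌) (coords.{u} (l := ⦋n⦌))
      (fun m v => coords_barycenter ⦋n⦌ m v) (ε := 1) (vertices ⦋n⦌) (fun i j => by
        rw [pi_norm_le_iff_of_nonneg zero_le_one]
        intro r
        rw [Pi.sub_apply, coords_vertices, coords_vertices]
        split_ifs <;> simp) k
    refine map_mem_of_mem_tupleChains (chainsMap (affineSimplices (simplexMap σ)) n)
      (subcomplexChains (smallSimplices 𝒰) n) (fun w hw => ?_) hmem
    obtain ⟨U, hU, hUs⟩ := h (w 0)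
    refine affineSimplices_tuple_mem hU fun p => ?_
    refine hUs _ (norm_coords_affineMap_sub_lt (k := ⦋n⦌) w (fun i => ?_) p)
    refine (hw i 0).trans_lt ?_
    rw [mul_one]
    exact hk

/-- A chain with small boundary is homologous to its iterated subdivisions, up to small chains. -/
lemma exists_sub_boundary_sub_mem {n : ℕ} (k : ℕ) (c : chains (TopCat.toSSet.obj X) (n + 1))
    (hc : boundary _ n c ∈ subcomplexChains (smallSimplices 𝒰) n) :
    ∃ d, c - boundary _ (n + 1) d - (singularSd X (n + 1))^[k] c ∈
      subcomplexChains (smallSimplices 𝒰) (n + 1) := by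
  induction k generalizing c with
  | zero => exact ⟨0, by simp⟩
  | succ k ih =>
    obtain ⟨d, hd⟩ := ih (singularSd X (n + 1) c) (by
      rw [boundary_singularSd]
      exact singularSd_mem hc)
    refine ⟨singularSdHomotopy X (n + 1) c + d, ?_⟩
    rw [map_add, boundary_singularSdHomotopy, Function.iterate_succ_apply]
    convert add_mem (singularSdHomotopy_mem hc) hd using 1
    abel

end Subdivision

lemma subsingleton_toTop_zero (p q : SimplexCategory.toTop.{u}.obj ⦋0⦌) : p = q := by
  refine coords_injective (funext fun i => ?_)
  have h : ∀ p : SimplexCategory.toTop.{u}.obj ⦋0⦌, coords p i = 1 := by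
    intro p
    rw [← sum_coords p]
    exact (Fin.sum_univ_one (coords p)).symm ▸ congrArg _ (Subsingleton.elim (α := Fin 1) _ _)
  rw [h, h]

/-- The small simplices theorem: the singular simplices subordinate to an open cover compute
the homology of the space. -/
theorem homologyIso_smallSimplices {X : TopCat.{u}} {𝒰 : Set (Set X)}
    (h𝒰 : ∀ U ∈ 𝒰, IsOpen U) (hcover : ⋃₀ 𝒰 = Set.univ) (n : ℕ) :
    HomologyIso n (smallSimplices 𝒰).ι := by
  refine homologyIso_of_relative_cycles _ (fun n => Subtype.val_injective) (fun c => ?_)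
    (fun n c a hca => ?_) n
  · refine ⟨0, mem_subcomplexChains_iff.1 ?_⟩
    rw [map_zero, sub_zero]
    intro σ _
    have hσ : simplexMap σ (vertices ⦋0⦌ 0) ∈ ⋃₀ 𝒰 := hcover ▸ Set.mem_univ _
    obtain ⟨U, hU, h⟩ := hσ
    exact mem_smallSimplices.2 ⟨U, hU, fun p => subsingleton_toTop_zero (vertices ⦋0⦌ 0) p ▸ h⟩
  · obtain ⟨k, hk⟩ := Subdivision.exists_iterate_singularSd_mem h𝒰 hcover c
    obtain ⟨d, hd⟩ := Subdivision.exists_sub_boundary_sub_mem k c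
      (mem_subcomplexChains_iff.2 ⟨a, hca⟩)
    refine ⟨d, mem_subcomplexChains_iff.1 ?_⟩
    have := add_mem hd hk
    rwa [sub_add_cancel] at this

/-! ### Mayer–Vietoris -/

/-- A commutative square of simplicial sets in which `C` is the union of `P` and `Q`, with
intersection `A`. -/
structure IsUnionSquare {A P Q C : SSet.{u}} (a : A ⟶ P) (b : A ⟶ Q) (i : P ⟶ C) (j : Q ⟶ C) :
    Prop where
  w : a ≫ i = b ≫ j
  left_injective (k : SimplexCategoryᵒᵖ) : Function.Injective (i.app k)
  right_injective (k : SimplexCategoryᵒᵖ) : Function.Injective (j.app k)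
  inter (k : SimplexCategoryᵒᵖ) (x : P.obj k) (y : Q.obj k) : i.app k x = j.app k y →
    ∃ z, a.app k z = x ∧ b.app k z = y
  union (k : SimplexCategoryᵒᵖ) (z : C.obj k) : (∃ x, i.app k x = z) ∨ ∃ y, j.app k y = z
  inter_injective (k : SimplexCategoryᵒᵖ) : Function.Injective (a.app k)

namespace IsUnionSquare

variable {A P Q C : SSet.{u}} {a : A ⟶ P} {b : A ⟶ Q} {i : P ⟶ C} {j : Q ⟶ C}

/-- A union of two simplicial sets is presented by the graph with vertices the simplices of the two
parts, and one edge for each simplex of the intersection. -/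
lemma isForestPresentation (h : IsUnionSquare a b i j) :
    IsForestPresentation (a ≫ sumInl P Q) (b ≫ sumInr P Q) (sumDesc i j) where
  w := h.w
  injective n := by
    intro c d hcd
    have hp : ∀ c, sumFstChains P Q n ((chainsMap (a ≫ sumInl P Q) n -
        chainsMap (b ≫ sumInr P Q) n) c) = chainsMap a n c := by
      intro c
      rw [LinearMap.sub_apply, map_sub, Subdivision.chainsMap_comp, Subdivision.chainsMap_comp,
        sumFstChains_inl, sumFstChains_inr, sub_zero]
    exact Finsupp.mapDomain_injective (h.inter_injective (.op ⦋n⦌))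
      ((hp c).symm.trans ((congrArg _ hcd).trans (hp d)))
  surjective n z := by
    rcases h.union _ z with ⟨x, hx⟩ | ⟨y, hy⟩
    · exact ⟨(sumInl P Q).app _ x, hx⟩
    · exact ⟨(sumInr P Q).app _ y, hy⟩
  connected n x y hxy := by
    have key : ∀ (x : P _⦋n⦌) (y : Q _⦋n⦌), i.app _ x = j.app _ y →
        (Finsupp.single ((sumInl P Q).app _ x) 1 - Finsupp.single ((sumInr P Q).app _ y) 1 :
          chains (sumSSet P Q) n) ∈
        LinearMap.range (chainsMap (a ≫ sumInl P Q) n - chainsMap (b ≫ sumInr P Q) n) := by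
      intro x y hxy
      obtain ⟨z, rfl, rfl⟩ := h.inter _ x y hxy
      refine ⟨Finsupp.single z 1, ?_⟩
      rw [LinearMap.sub_apply, chainsMap_single, chainsMap_single]
      rfl
    rcases sumSSet_cases x with ⟨x, rfl⟩ | ⟨x, rfl⟩ <;>
      rcases sumSSet_cases y with ⟨y, rfl⟩ | ⟨y, rfl⟩
    · rw [h.left_injective _ hxy, sub_self]
      exact zero_mem _
    · exact key x y hxy
    · have := neg_mem (key y x hxy.symm)
      rwa [neg_sub (Finsupp.single _ _)] at this
    · rw [h.right_injective _ hxy, sub_self]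
      exact zero_mem _

lemma sum (h : IsUnionSquare a b i j) {A' P' Q' C' : SSet.{u}} {a' : A' ⟶ P'} {b' : A' ⟶ Q'}
    {i' : P' ⟶ C'} {j' : Q' ⟶ C'} (h' : IsUnionSquare a' b' i' j') :
    IsUnionSquare (sumMap a a') (sumMap b b') (sumMap i i') (sumMap j j') where
  w := sum_hom_ext (congrArg (· ≫ sumInl C C') h.w) (congrArg (· ≫ sumInr C C') h'.w)
  left_injective k := Sum.map_injective.2 ⟨h.left_injective k, h'.left_injective k⟩
  right_injective k := Sum.map_injective.2 ⟨h.right_injective k, h'.right_injective k⟩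
  inter_injective k := Sum.map_injective.2 ⟨h.inter_injective k, h'.inter_injective k⟩
  inter k x y hxy := by
    rcases x with x | x <;> rcases y with y | y
    · obtain ⟨z, hz, hz'⟩ := h.inter k x y (Sum.inl_injective hxy)
      exact ⟨Sum.inl z, congrArg Sum.inl hz, congrArg Sum.inl hz'⟩
    · exact (Sum.inl_ne_inr hxy).elim
    · exact (Sum.inr_ne_inl hxy).elim
    · obtain ⟨z, hz, hz'⟩ := h'.inter k x y (Sum.inr_injective hxy)
      exact ⟨Sum.inr z, congrArg Sum.inr hz, congrArg Sum.inr hz'⟩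
  union k z := by
    rcases z with z | z
    · exact (h.union k z).imp (fun ⟨x, hx⟩ => ⟨Sum.inl x, congrArg Sum.inl hx⟩)
        (fun ⟨x, hx⟩ => ⟨Sum.inl x, congrArg Sum.inl hx⟩)
    · exact (h'.union k z).imp (fun ⟨x, hx⟩ => ⟨Sum.inr x, congrArg Sum.inr hx⟩)
        (fun ⟨x, hx⟩ => ⟨Sum.inr x, congrArg Sum.inr hx⟩)

end IsUnionSquare

/-- The restriction of a continuous map to subspaces. -/
def restrictMap {X Y : TopCat.{u}} (f : X ⟶ Y) {U : Set X} {V : Set Y} (h : Set.MapsTo f U V) :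
    TopCat.of U ⟶ TopCat.of V :=
  TopCat.ofHom ⟨h.restrict f U V, f.hom.continuous.restrict h⟩

/-- The inclusion of a subspace. -/
def subspaceIncl {X : TopCat.{u}} (U : Set X) : TopCat.of U ⟶ X :=
  TopCat.ofHom ⟨Subtype.val, continuous_subtype_val⟩

/-- The inclusion of one subspace into a larger one. -/
abbrev subspaceOfLE {X : TopCat.{u}} {U V : Set X} (h : U ⊆ V) : TopCat.of U ⟶ TopCat.of V :=
  restrictMap (𝟙 X) h

/-- The singular simplices of a set of a family are small. -/
noncomputable def smallOfMem {X : TopCat.{u}} {𝒰 : Set (Set X)} {U : Set X} (hU : U ∈ 𝒰) :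
    TopCat.toSSet.obj (TopCat.of U) ⟶ (smallSimplices 𝒰 : SSet.{u}) where
  app k := ↾fun σ => ⟨(TopCat.toSSet.map (subspaceIncl U)).app k σ,
    U, hU, fun p => (simplexMap σ p).2⟩

lemma subspaceIncl_injective {X : TopCat.{u}} (U : Set X) {k : SimplexCategoryᵒᵖ} :
    Function.Injective ((TopCat.toSSet.map (subspaceIncl U)).app k) := by
  intro σ τ h
  have h' : simplexMap σ ≫ subspaceIncl U = simplexMap τ ≫ subspaceIncl U := congrArg simplexMap h
  have h'' : simplexMap σ = simplexMap τ := by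
    refine TopCat.hom_ext (ContinuousMap.ext fun p => Subtype.ext ?_)
    exact congrArg (fun f => f p) h'
  exact congrArg singularSimplex h''

lemma exists_lift_subspaceIncl {X : TopCat.{u}} {U : Set X} {k : SimplexCategoryᵒᵖ}
    (σ : (TopCat.toSSet.obj X).obj k) (h : ∀ p, simplexMap σ p ∈ U) :
    ∃ τ, (TopCat.toSSet.map (subspaceIncl U)).app k τ = σ :=
  ⟨singularSimplex (TopCat.ofHom ⟨fun p => ⟨simplexMap σ p, h p⟩,
    (simplexMap σ).hom.continuous.subtype_mk _⟩), rfl⟩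

lemma isUnionSquare_singular {X : TopCat.{u}} (U V : Set X) :
    IsUnionSquare
      (TopCat.toSSet.map (subspaceOfLE (Set.inter_subset_left : U ∩ V ⊆ U)))
      (TopCat.toSSet.map (subspaceOfLE (Set.inter_subset_right : U ∩ V ⊆ V)))
      (smallOfMem (𝒰 := {U, V}) (Set.mem_insert U {V}))
      (smallOfMem (𝒰 := {U, V}) (Set.mem_insert_of_mem U rfl)) where
  w := rfl
  left_injective k x y h := subspaceIncl_injective U (congrArg Subtype.val h)
  right_injective k x y h := subspaceIncl_injective V (congrArg Subtype.val h)
  inter_injective k x y h := by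
    refine subspaceIncl_injective (U ∩ V) ?_
    exact congrArg ((TopCat.toSSet.map (subspaceIncl U)).app k) h
  inter k x y h := by
    have h₁ : (TopCat.toSSet.map (subspaceIncl U)).app k x =
      (TopCat.toSSet.map (subspaceIncl V)).app k y := congrArg Subtype.val h
    have h₂ : ∀ p, (simplexMap x p : X) = (simplexMap y p : X) := fun p =>
      congrArg (fun σ => simplexMap σ p) h₁
    refine ⟨singularSimplex (TopCat.ofHom ⟨fun p => ⟨simplexMap x p, (simplexMap x p).2,
      h₂ p ▸ (simplexMap y p).2⟩, ?_⟩), ?_, ?_⟩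
    · exact (continuous_subtype_val.comp (simplexMap x).hom.continuous).subtype_mk _
    · exact subspaceIncl_injective U rfl
    · exact subspaceIncl_injective V h₁
  union k z := by
    obtain ⟨σ, W, hW, hσ⟩ := z
    rcases hW with rfl | rfl
    · obtain ⟨τ, hτ⟩ := exists_lift_subspaceIncl σ hσ
      exact Or.inl ⟨τ, Subtype.ext hτ⟩
    · obtain ⟨τ, hτ⟩ := exists_lift_subspaceIncl σ hσ
      exact Or.inr ⟨τ, Subtype.ext hτ⟩

/-- The map on small simplices induced by a map of spaces with covers. -/
noncomputable def smallMap {X Y : TopCat.{u}} (f : X ⟶ Y) {U V : Set X} {U' V' : Set Y}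
    (hU : Set.MapsTo f U U') (hV : Set.MapsTo f V V') :
    (smallSimplices {U, V} : SSet.{u}) ⟶ (smallSimplices {U', V'} : SSet.{u}) where
  app k := ↾fun σ => ⟨(TopCat.toSSet.map f).app k σ.1, by
    obtain ⟨σ, W, hW, hσ⟩ := σ
    rcases hW with rfl | rfl
    · exact ⟨U', Set.mem_insert _ _, fun p => hU (hσ p)⟩
    · exact ⟨V', Set.mem_insert_of_mem _ rfl, fun p => hV (hσ p)⟩⟩

/-- The Mayer–Vietoris principle: two continuous maps `X₁ → X ← X₂` induce an isomorphism from the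
homology of the disjoint union of `X₁` and `X₂` to that of `X` if they do so over the sets of
an open cover `U, V` and over `U ∩ V`. -/
theorem homologyIso_of_cover {X₁ X₂ X : TopCat.{u}} (f₁ : X₁ ⟶ X) (f₂ : X₂ ⟶ X)
    {U₁ V₁ : Set X₁} {U₂ V₂ : Set X₂} {U V : Set X}
    (hU₁ : IsOpen U₁) (hV₁ : IsOpen V₁) (h₁ : U₁ ∪ V₁ = Set.univ)
    (hU₂ : IsOpen U₂) (hV₂ : IsOpen V₂) (h₂ : U₂ ∪ V₂ = Set.univ)
    (hU : IsOpen U) (hV : IsOpen V) (h : U ∪ V = Set.univ)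
    (fU₁ : Set.MapsTo f₁ U₁ U) (fV₁ : Set.MapsTo f₁ V₁ V)
    (fU₂ : Set.MapsTo f₂ U₂ U) (fV₂ : Set.MapsTo f₂ V₂ V) {n : ℕ}
    (isoU : ∀ m, m = n ∨ m = n + 1 → HomologyIso m
      (sumDesc (TopCat.toSSet.map (restrictMap f₁ fU₁)) (TopCat.toSSet.map (restrictMap f₂ fU₂))))
    (isoV : ∀ m, m = n ∨ m = n + 1 → HomologyIso m
      (sumDesc (TopCat.toSSet.map (restrictMap f₁ fV₁)) (TopCat.toSSet.map (restrictMap f₂ fV₂))))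
    (isoUV : ∀ m, m = n ∨ m = n + 1 → HomologyIso m
      (sumDesc (TopCat.toSSet.map (restrictMap f₁ (fU₁.inter_inter fV₁)))
        (TopCat.toSSet.map (restrictMap f₂ (fU₂.inter_inter fV₂))))) :
    HomologyIso (n + 1) (sumDesc (TopCat.toSSet.map f₁) (TopCat.toSSet.map f₂)) := by
  have hs : ∀ {X : TopCat.{u}} {U V : Set X}, IsOpen U → IsOpen V → U ∪ V = Set.univ →
      HomologyIso (n + 1) (smallSimplices {U, V}).ι := fun {X U V} hU hV h =>
    homologyIso_smallSimplices (by rintro W (rfl | rfl) <;> assumption)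
      (by rw [Set.sUnion_pair, h]) _
  have hf : HomologyIso (n + 1) (sumDesc (smallMap f₁ fU₁ fV₁) (smallMap f₂ fU₂ fV₂)) := by
    refine ((isUnionSquare_singular U₁ V₁).sum
      (isUnionSquare_singular U₂ V₂)).isForestPresentation.homologyIso_map
      (isUnionSquare_singular U V).isForestPresentation
      (v := sumMap (sumDesc _ _) (sumDesc _ _)) ?_ ?_ ?_ (isoUV _ (Or.inr rfl))
      (isoUV _ (Or.inl rfl)) ((isoU _ (Or.inr rfl)).sum (isoV _ (Or.inr rfl)))
      ((isoU _ (Or.inl rfl)).sum (isoV _ (Or.inl rfl)))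
    · exact sum_hom_ext rfl rfl
    · exact sum_hom_ext rfl rfl
    · exact sum_hom_ext (sum_hom_ext rfl rfl) (sum_hom_ext rfl rfl)
  refine HomologyIso.of_square' (sum_hom_ext ?_ ?_) ((hs hU₁ hV₁ h₁).sum (hs hU₂ hV₂ h₂))
    (hs hU hV h) hf
  · rfl
  · rfl

/-! ### Homology of double mapping cylinders -/

/-- The inclusion of a deformation retract `B` into a quotient `W` of `Y` is a homology
isomorphism; the retraction and the deformation are given on `Y`, compatibly with the quotient
map. -/
lemma homologyIso_of_isQuotientMap {Y : Type u} [TopologicalSpace Y] {B W : TopCat.{u}}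
    {k : Y → W} (hk : IsQuotientMap k) (e : B ⟶ W) (r : C(Y, B))
    (hr : ∀ y y', k y = k y' → r y = r y') (H : C(Y × unitInterval, Y))
    (hH : ∀ y y' s, k y = k y' → k (H (y, s)) = k (H (y', s)))
    (h₀ : ∀ y, k (H (y, 0)) = e (r y)) (h₁ : ∀ y, k (H (y, 1)) = k y)
    (hs : ∀ b, ∃ y, k y = e b ∧ r y = b) (n : ℕ) : HomologyIso n (TopCat.toSSet.map e) := by
  let g : C(W, B) := ⟨fun w => r (Function.surjInv hk.surjective w), by
    refine hk.continuous_iff.2 (r.continuous.congr fun y => ?_)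
    exact hr _ _ (Function.surjInv_eq hk.surjective (k y)).symm⟩
  have hg : ∀ y, g (k y) = r y := fun y => hr _ _ (Function.surjInv_eq hk.surjective (k y))
  let G : W × unitInterval → W := fun p => k (H (Function.surjInv hk.surjective p.1, p.2))
  have hG : ∀ y s, G (k y, s) = k (H (y, s)) := fun y s =>
    hH _ _ _ (Function.surjInv_eq hk.surjective (k y))
  have hGc : Continuous G := by
    refine hk.continuous_lift_prod_left ?_
    exact (hk.continuous.comp H.continuous).congr fun p => (hG p.1 p.2).symm
  refine homologyIso_toSSet_map e (TopCat.ofHom g) ?_ ⟨?_⟩ n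
  · have : (e ≫ TopCat.ofHom g).hom = (𝟙 B : B ⟶ B).hom := by
      refine ContinuousMap.ext fun b => ?_
      obtain ⟨y, hy, hb⟩ := hs b
      refine Eq.trans (congrArg g hy.symm) ?_
      rw [hg, hb]
      rfl
    rw [this]
  · refine
      { toFun := fun p => G (p.2, p.1)
        continuous_toFun := hGc.comp continuous_swap
        map_zero_left := fun w => ?_
        map_one_left := fun w => ?_ }
    · obtain ⟨y, rfl⟩ := hk.surjective w
      refine (hG y 0).trans ((h₀ y).trans ?_)
      exact congrArg e (hg y).symm
    · obtain ⟨y, rfl⟩ := hk.surjective w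
      exact (hG y 1).trans (h₁ y)

/-- The restriction of a quotient map to an open subset of the target, with the preimage of the
subset given as the image of an open embedding. -/
lemma isQuotientMap_of_isOpenEmbedding {E X Y : Type*} [TopologicalSpace E] [TopologicalSpace X]
    [TopologicalSpace Y] {π : E → X} (hπ : IsQuotientMap π) {W : Set X} (hW : IsOpen W)
    {m : Y → E} (hm : IsOpenEmbedding m) (hr : Set.range m = π ⁻¹' W) {k : Y → W}
    (hk : ∀ y, (k y : X) = π (m y)) : IsQuotientMap k := by
  have h := hπ.restrictPreimage_isOpen hW
  let φ : Y ≃ₜ π ⁻¹' W := hm.toIsEmbedding.toHomeomorph.trans (Homeomorph.setCongr hr)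
  have : k = W.restrictPreimage π ∘ φ := funext fun y => Subtype.ext (hk y)
  rw [this]
  exact h.comp φ.isQuotientMap

namespace DoubleCylinder

variable {A B C : TopCat.{u}} (f : A ⟶ B) (g : A ⟶ C)

/-- The quotient map onto the double mapping cylinder. -/
def mk : (A × unitInterval) ⊕ (B ⊕ C) → homotopyPushout f g := Quot.mk _

lemma isQuotientMap_mk : IsQuotientMap (mk f g) := isQuotientMap_quot_mk

variable {f g} in
lemma mk_left (a : A) : mk f g (Sum.inl (a, 0)) = mk f g (Sum.inr (Sum.inl (f a))) :=
  Quot.sound (DoubleCylinderRel.left a)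

variable {f g} in
lemma mk_right (a : A) : mk f g (Sum.inl (a, 1)) = mk f g (Sum.inr (Sum.inr (g a))) :=
  Quot.sound (DoubleCylinderRel.right a)

/-- A function on the double mapping cylinder. -/
def lift {T : Sort*} (p : A → unitInterval → T) (b : B → T) (c : C → T)
    (h₀ : ∀ a, p a 0 = b (f a)) (h₁ : ∀ a, p a 1 = c (g a)) : homotopyPushout f g → T :=
  Quot.lift (fun x => match x with
    | .inl y => p y.1 y.2
    | .inr (.inl y) => b y
    | .inr (.inr y) => c y) (by
    rintro _ _ (a | a)
    · exact h₀ a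
    · exact h₁ a)

/-- The height function of the double mapping cylinder. -/
def height : homotopyPushout f g → unitInterval :=
  lift f g (fun _ t => t) (fun _ => 0) (fun _ => 1) (fun _ => rfl) (fun _ => rfl)

lemma continuous_height : Continuous (height f g) := by
  refine (isQuotientMap_mk f g).continuous_iff.2 ?_
  refine continuous_sum_dom.2 ⟨continuous_snd, continuous_sum_dom.2 ⟨?_, ?_⟩⟩
  · exact continuous_const
  · exact continuous_const

/-- The complement of the right end of the double mapping cylinder. -/
def lower : Set (homotopyPushout f g) := {x | height f g x < 1}

/-- The complement of the left end of the double mapping cylinder. -/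
def upper : Set (homotopyPushout f g) := {x | 0 < height f g x}

lemma isOpen_lower : IsOpen (lower f g) := isOpen_Iio.preimage (continuous_height f g)

lemma isOpen_upper : IsOpen (upper f g) := isOpen_Ioi.preimage (continuous_height f g)

lemma lower_union_upper : lower f g ∪ upper f g = Set.univ := by
  ext x
  simp only [Set.mem_union, Set.mem_univ, iff_true]
  rcases lt_or_ge (height f g x) 1 with h | h
  · exact Or.inl h
  · exact Or.inr (lt_of_lt_of_le zero_lt_one h)

/-- The inclusion of the left end. -/
def leftEnd : B ⟶ TopCat.of (lower f g) :=
  TopCat.ofHom ⟨fun b => ⟨mk f g (Sum.inr (Sum.inl b)), (zero_lt_one : (0 : unitInterval) < 1)⟩,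
    ((isQuotientMap_mk f g).continuous.comp (continuous_inr.comp continuous_inl)).subtype_mk _⟩

/-- The inclusion of the right end. -/
def rightEnd : C ⟶ TopCat.of (upper f g) :=
  TopCat.ofHom ⟨fun c => ⟨mk f g (Sum.inr (Sum.inr c)), (zero_lt_one : (0 : unitInterval) < 1)⟩,
    ((isQuotientMap_mk f g).continuous.comp (continuous_inr.comp continuous_inr)).subtype_mk _⟩

/-- The middle point of the unit interval. -/
noncomputable def half : unitInterval := ⟨1 / 2, by norm_num, by norm_num⟩

lemma half_pos : 0 < half := by
  rw [← Subtype.coe_lt_coe]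
  norm_num [half]

lemma half_lt_one : half < 1 := by
  rw [← Subtype.coe_lt_coe]
  norm_num [half]

/-- The inclusion of the middle level. -/
noncomputable def middle : A ⟶ TopCat.of ↥(lower f g ∩ upper f g) :=
  TopCat.ofHom ⟨fun a => ⟨mk f g (Sum.inl (a, half)), half_lt_one, half_pos⟩,
    ((isQuotientMap_mk f g).continuous.comp (continuous_inl.comp
      (continuous_id.prodMk continuous_const))).subtype_mk _⟩

lemma isOpenEmbedding_sumMap {P Q P' Q' : Type*} [TopologicalSpace P] [TopologicalSpace Q]
    [TopologicalSpace P'] [TopologicalSpace Q'] {p : P → P'} {q : Q → Q'}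
    (hp : IsOpenEmbedding p) (hq : IsOpenEmbedding q) : IsOpenEmbedding (Sum.map p q) :=
  .of_continuous_injective_isOpenMap (hp.continuous.sumMap hq.continuous)
    (Sum.map_injective.2 ⟨hp.injective, hq.injective⟩)
    (isOpenMap_sum.2 ⟨isOpenMap_inl.comp hp.isOpenMap, isOpenMap_inr.comp hq.isOpenMap⟩)

/-- The complement of the right end retracts onto the left end, by scaling the height. -/
lemma homologyIso_leftEnd (n : ℕ) : HomologyIso n (TopCat.toSSet.map (leftEnd f g)) := by
  let J : Set unitInterval := Set.Iio 1
  let m : (A × J) ⊕ B → (A × unitInterval) ⊕ (B ⊕ C) := Sum.map (Prod.map id Subtype.val) Sum.inl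
  have hm : IsOpenEmbedding m :=
    isOpenEmbedding_sumMap (IsOpenEmbedding.id.prodMap (isOpen_Iio.isOpenEmbedding_subtypeVal))
      .inl
  let k : (A × J) ⊕ B → lower f g := fun y => ⟨mk f g (m y), by
    rcases y with y | y
    · exact y.2.2
    · exact (zero_lt_one : (0 : unitInterval) < 1)⟩
  have hk : IsQuotientMap k := by
    refine isQuotientMap_of_isOpenEmbedding (isQuotientMap_mk f g) (isOpen_lower f g) hm ?_
      fun _ => rfl
    ext x
    constructor
    · rintro ⟨y, rfl⟩
      exact (k y).2
    · intro hx
      rcases x with x | x | x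
      · exact ⟨Sum.inl (x.1, ⟨x.2, hx⟩), rfl⟩
      · exact ⟨Sum.inr x, rfl⟩
      · exact (lt_irrefl (1 : unitInterval) hx).elim
  let r : C((A × J) ⊕ B, B) :=
    ⟨Sum.elim (fun y => f y.1) id, continuous_sum_dom.2
      ⟨f.hom.continuous.comp continuous_fst, continuous_id⟩⟩
  let H : C(((A × J) ⊕ B) × unitInterval, (A × J) ⊕ B) :=
    ⟨fun p => Sum.map
      (fun y => (y.1, (⟨p.2 * y.2, lt_of_le_of_lt unitInterval.mul_le_right y.2.2⟩ : J))) id p.1, by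
      refine (Homeomorph.sumProdDistrib.symm.comp_continuous_iff').1
        (continuous_sum_dom.2 ⟨?_, ?_⟩)
      · refine continuous_inl.comp (Continuous.prodMk (by fun_prop) ?_)
        refine Continuous.subtype_mk ?_ _
        exact continuous_snd.mul
          (continuous_subtype_val.comp (continuous_snd.comp continuous_fst))
      · exact continuous_inr.comp continuous_fst⟩
  refine homologyIso_of_isQuotientMap hk (leftEnd f g) r ?_ H ?_ ?_ ?_ ?_ n
  · let ρ : homotopyPushout f g → Option B :=
      lift f g (fun a t => if t < 1 then some (f a) else none) some (fun _ => none)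
        (fun a => if_pos zero_lt_one) (fun a => if_neg (lt_irrefl _))
    have hρ : ∀ y, ρ (k y) = some (r y) := by
      rintro (y | y)
      · exact if_pos y.2.2
      · rfl
    intro y y' h
    have := congrArg (fun x => ρ x.1) h
    exact Option.some_injective _ ((hρ y).symm.trans (this.trans (hρ y')))
  · intro y y' s h
    let ρ : homotopyPushout f g → homotopyPushout f g :=
      lift f g (fun a t => if t < 1 then mk f g (Sum.inl (a, s * t)) else
        mk f g (Sum.inr (Sum.inr (g a)))) (fun b => mk f g (Sum.inr (Sum.inl b)))
        (fun c => mk f g (Sum.inr (Sum.inr c)))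
        (fun a => by rw [if_pos zero_lt_one, mul_zero, mk_left])
        (fun a => if_neg (lt_irrefl _))
    have hρ : ∀ y, ρ (k y) = (k (H (y, s))).1 := by
      rintro (y | y)
      · exact if_pos y.2.2
      · rfl
    have := congrArg (fun x => ρ x.1) h
    exact Subtype.ext ((hρ y).symm.trans (this.trans (hρ y')))
  · rintro (y | y)
    · refine Subtype.ext (Eq.trans ?_ (mk_left y.1))
      exact congrArg (fun t => mk f g (Sum.inl (y.1, t))) (zero_mul _)
    · rfl
  · rintro (y | y)
    · exact Subtype.ext (congrArg (fun t => mk f g (Sum.inl (y.1, t))) (one_mul _))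
    · rfl
  · exact fun b => ⟨Sum.inr b, rfl, rfl⟩

/-- The complement of the left end retracts onto the right end. -/
lemma homologyIso_rightEnd (n : ℕ) : HomologyIso n (TopCat.toSSet.map (rightEnd f g)) := by
  let J : Set unitInterval := Set.Ioi 0
  let m : (A × J) ⊕ C → (A × unitInterval) ⊕ (B ⊕ C) := Sum.map (Prod.map id Subtype.val) Sum.inr
  have hm : IsOpenEmbedding m :=
    isOpenEmbedding_sumMap (IsOpenEmbedding.id.prodMap (isOpen_Ioi.isOpenEmbedding_subtypeVal))
      .inr
  let k : (A × J) ⊕ C → upper f g := fun y => ⟨mk f g (m y), by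
    rcases y with y | y
    · exact y.2.2
    · exact (zero_lt_one : (0 : unitInterval) < 1)⟩
  have hk : IsQuotientMap k := by
    refine isQuotientMap_of_isOpenEmbedding (isQuotientMap_mk f g) (isOpen_upper f g) hm ?_
      fun _ => rfl
    ext x
    constructor
    · rintro ⟨y, rfl⟩
      exact (k y).2
    · intro hx
      rcases x with x | x | x
      · exact ⟨Sum.inl (x.1, ⟨x.2, hx⟩), rfl⟩
      · exact (lt_irrefl (0 : unitInterval) hx).elim
      · exact ⟨Sum.inr x, rfl⟩
  let r : C((A × J) ⊕ C, C) :=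
    ⟨Sum.elim (fun y => g y.1) id, continuous_sum_dom.2
      ⟨g.hom.continuous.comp continuous_fst, continuous_id⟩⟩
  have hlt : ∀ (s : unitInterval) (t : J),
      unitInterval.symm (s * unitInterval.symm t) ∈ J := by
    intro s t
    change (0 : unitInterval) < unitInterval.symm (s * unitInterval.symm t)
    refine unitInterval.lt_symm_comm.1 ?_
    rw [unitInterval.symm_zero]
    refine lt_of_le_of_lt unitInterval.mul_le_right (unitInterval.symm_lt_comm.1 ?_)
    rw [unitInterval.symm_one]
    exact t.2
  let H : C(((A × J) ⊕ C) × unitInterval, (A × J) ⊕ C) :=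
    ⟨fun p => Sum.map
      (fun y : A × J =>
        (y.1, (⟨unitInterval.symm (p.2 * unitInterval.symm y.2), hlt p.2 y.2⟩ : J))) id p.1, by
      refine (Homeomorph.sumProdDistrib.symm.comp_continuous_iff').1
        (continuous_sum_dom.2 ⟨?_, ?_⟩)
      · refine continuous_inl.comp (Continuous.prodMk (by fun_prop) ?_)
        refine Continuous.subtype_mk ?_ _
        exact unitInterval.continuous_symm.comp (continuous_snd.mul
          (unitInterval.continuous_symm.comp
            (continuous_subtype_val.comp (continuous_snd.comp continuous_fst))))
      · exact continuous_inr.comp continuous_fst⟩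
  refine homologyIso_of_isQuotientMap hk (rightEnd f g) r ?_ H ?_ ?_ ?_ ?_ n
  · let ρ : homotopyPushout f g → Option C :=
      lift f g (fun a t => if 0 < t then some (g a) else none) (fun _ => none) some
        (fun a => if_neg (lt_irrefl _)) (fun a => if_pos zero_lt_one)
    have hρ : ∀ y, ρ (k y) = some (r y) := by
      rintro (y | y)
      · exact if_pos y.2.2
      · rfl
    intro y y' h
    have := congrArg (fun x => ρ x.1) h
    exact Option.some_injective _ ((hρ y).symm.trans (this.trans (hρ y')))
  · intro y y' s h
    let ρ : homotopyPushout f g → homotopyPushout f g :=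
      lift f g (fun a t => if 0 < t then
          mk f g (Sum.inl (a, unitInterval.symm (s * unitInterval.symm t))) else
        mk f g (Sum.inr (Sum.inl (f a)))) (fun b => mk f g (Sum.inr (Sum.inl b)))
        (fun c => mk f g (Sum.inr (Sum.inr c))) (fun a => if_neg (lt_irrefl _))
        (fun a => by
          rw [if_pos zero_lt_one, unitInterval.symm_one, mul_zero, unitInterval.symm_zero,
            mk_right])
    have hρ : ∀ y, ρ (k y) = (k (H (y, s))).1 := by
      rintro (y | y)
      · exact if_pos y.2.2
      · rfl
    have := congrArg (fun x => ρ x.1) h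
    exact Subtype.ext ((hρ y).symm.trans (this.trans (hρ y')))
  · rintro (y | y)
    · refine Subtype.ext (Eq.trans ?_ (mk_right y.1))
      refine congrArg (fun t => mk f g (Sum.inl (y.1, t))) ?_
      change unitInterval.symm (0 * unitInterval.symm y.2) = 1
      rw [zero_mul, unitInterval.symm_zero]
    · rfl
  · rintro (y | y)
    · refine Subtype.ext (congrArg (fun t => mk f g (Sum.inl (y.1, t))) ?_)
      change unitInterval.symm (1 * unitInterval.symm y.2) = y.2
      rw [one_mul, unitInterval.symm_symm]
    · rfl
  · exact fun b => ⟨Sum.inr b, rfl, rfl⟩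

/-- The complement of the two ends is an open cylinder, which retracts onto its middle level. -/
lemma homologyIso_middle (n : ℕ) : HomologyIso n (TopCat.toSSet.map (middle f g)) := by
  let J : Set unitInterval := Set.Ioo 0 1
  let m : A × J → (A × unitInterval) ⊕ (B ⊕ C) := Sum.inl ∘ Prod.map id Subtype.val
  have hm : IsOpenEmbedding m :=
    IsOpenEmbedding.inl.comp (IsOpenEmbedding.id.prodMap (isOpen_Ioo.isOpenEmbedding_subtypeVal))
  let k : A × J → ↥(lower f g ∩ upper f g) := fun y => ⟨mk f g (m y), y.2.2.2, y.2.2.1⟩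
  have hk : IsQuotientMap k := by
    refine isQuotientMap_of_isOpenEmbedding (isQuotientMap_mk f g)
      ((isOpen_lower f g).inter (isOpen_upper f g)) hm ?_ fun _ => rfl
    ext x
    constructor
    · rintro ⟨y, rfl⟩
      exact (k y).2
    · intro hx
      rcases x with x | x | x
      · exact ⟨(x.1, ⟨x.2, hx.2, hx.1⟩), rfl⟩
      · exact (lt_irrefl (0 : unitInterval) hx.2).elim
      · exact (lt_irrefl (1 : unitInterval) hx.1).elim
  have hkinj : Function.Injective k := by
    let ρ : homotopyPushout f g → Option (A × unitInterval) :=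
      lift f g (fun a t => if t ∈ J then some (a, t) else none) (fun _ => none) (fun _ => none)
        (fun a => if_neg fun h => lt_irrefl _ h.1) (fun a => if_neg fun h => lt_irrefl _ h.2)
    have hρ : ∀ y : A × J, ρ (k y) = some (y.1, y.2.1) := fun y => if_pos y.2.2
    intro y y' h
    have := congrArg (fun x => ρ x.1) h
    have := Option.some_injective _ ((hρ y).symm.trans (this.trans (hρ y')))
    exact Prod.ext (Prod.ext_iff.1 this).1 (Subtype.ext (Prod.ext_iff.1 this).2)
  have hmem : ∀ (s : unitInterval) (t : J), 0 < (1 - s : ℝ) * (1 / 2) + s * t ∧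
      (1 - s : ℝ) * (1 / 2) + s * t < 1 := by
    intro s t
    have h₀ : (0 : ℝ) < t := t.2.1
    have h₁ : (t : ℝ) < 1 := t.2.2
    have hs₀ := s.2.1
    have hs₁ := s.2.2
    rcases eq_or_lt_of_le hs₀ with hs | hs
    · rw [← hs]; norm_num
    · exact ⟨by nlinarith, by nlinarith⟩
  let H : C((A × J) × unitInterval, A × J) :=
    ⟨fun p => (p.1.1, ⟨⟨_, (hmem p.2 p.1.2).1.le, (hmem p.2 p.1.2).2.le⟩,
      (hmem p.2 p.1.2).1, (hmem p.2 p.1.2).2⟩), by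
      refine Continuous.prodMk (by fun_prop) (Continuous.subtype_mk (Continuous.subtype_mk ?_ _) _)
      fun_prop⟩
  refine homologyIso_of_isQuotientMap hk (middle f g) ⟨Prod.fst, continuous_fst⟩ ?_ H ?_ ?_ ?_ ?_ n
  · intro y y' h
    rw [hkinj h]
  · intro y y' s h
    rw [hkinj h]
  · intro y
    refine Subtype.ext (congrArg (fun t => mk f g (Sum.inl (y.1, t))) (Subtype.ext ?_))
    change (1 - ((0 : unitInterval) : ℝ)) * (1 / 2) + ((0 : unitInterval) : ℝ) * y.2 = 1 / 2
    norm_num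
  · intro y
    refine Subtype.ext (congrArg (fun t => mk f g (Sum.inl (y.1, t))) (Subtype.ext ?_))
    change (1 - ((1 : unitInterval) : ℝ)) * (1 / 2) + ((1 : unitInterval) : ℝ) * y.2 = y.2
    norm_num
  · exact fun a => ⟨(a, ⟨half, half_pos, half_lt_one⟩), rfl, rfl⟩

variable {f g}

/-- The map of double mapping cylinders induced by a map of diagrams. -/
def map {A' B' C' : TopCat.{u}} {f' : A' ⟶ B'} {g' : A' ⟶ C'} (a : A' ⟶ A) (b : B' ⟶ B)
    (c : C' ⟶ C) (hf : a ≫ f = f' ≫ b) (hg : a ≫ g = g' ≫ c) :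
    homotopyPushout f' g' ⟶ homotopyPushout f g :=
  TopCat.ofHom ⟨Quot.map (Sum.map (Prod.map a id) (Sum.map b c)) (by
    rintro _ _ (x | x)
    · have h : f (a x) = b (f' x) := congrArg (fun k => k x) hf
      change DoubleCylinderRel f g (Sum.inl (a x, 0)) (Sum.inr (Sum.inl (b (f' x))))
      rw [← h]
      exact .left _
    · have h : g (a x) = c (g' x) := congrArg (fun k => k x) hg
      change DoubleCylinderRel f g (Sum.inl (a x, 1)) (Sum.inr (Sum.inr (c (g' x))))
      rw [← h]
      exact .right _), by
    refine (isQuotientMap_mk f' g').continuous_iff.2 ((isQuotientMap_mk f g).continuous.comp ?_)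
    exact (a.hom.continuous.prodMap continuous_id).sumMap
      (b.hom.continuous.sumMap c.hom.continuous)⟩

lemma height_map {A' B' C' : TopCat.{u}} {f' : A' ⟶ B'} {g' : A' ⟶ C'} (a : A' ⟶ A) (b : B' ⟶ B)
    (c : C' ⟶ C) (hf : a ≫ f = f' ≫ b) (hg : a ≫ g = g' ≫ c) (x : homotopyPushout f' g') :
    height f g (map a b c hf hg x) = height f' g' x := by
  obtain ⟨x, rfl⟩ := (isQuotientMap_mk f' g').surjective x
  rcases x with x | x | x <;> rfl

/-- Two maps of diagrams which are jointly homology isomorphisms on the three corners induce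
a homology isomorphism of double mapping cylinders. -/
theorem homologyIso_map {A₁ B₁ C₁ A₂ B₂ C₂ : TopCat.{u}} {f₁ : A₁ ⟶ B₁} {g₁ : A₁ ⟶ C₁}
    {f₂ : A₂ ⟶ B₂} {g₂ : A₂ ⟶ C₂} (a₁ : A₁ ⟶ A) (b₁ : B₁ ⟶ B) (c₁ : C₁ ⟶ C)
    (hf₁ : a₁ ≫ f = f₁ ≫ b₁) (hg₁ : a₁ ≫ g = g₁ ≫ c₁) (a₂ : A₂ ⟶ A) (b₂ : B₂ ⟶ B) (c₂ : C₂ ⟶ C)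
    (hf₂ : a₂ ≫ f = f₂ ≫ b₂) (hg₂ : a₂ ≫ g = g₂ ≫ c₂) {n : ℕ}
    (hA : ∀ m, m = n ∨ m = n + 1 →
      HomologyIso m (sumDesc (TopCat.toSSet.map a₁) (TopCat.toSSet.map a₂)))
    (hB : ∀ m, m = n ∨ m = n + 1 →
      HomologyIso m (sumDesc (TopCat.toSSet.map b₁) (TopCat.toSSet.map b₂)))
    (hC : ∀ m, m = n ∨ m = n + 1 →
      HomologyIso m (sumDesc (TopCat.toSSet.map c₁) (TopCat.toSSet.map c₂))) :
    HomologyIso (n + 1) (sumDesc (TopCat.toSSet.map (map a₁ b₁ c₁ hf₁ hg₁))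
      (TopCat.toSSet.map (map a₂ b₂ c₂ hf₂ hg₂))) := by
  have hl : ∀ {A' B' C' : TopCat.{u}} {f' : A' ⟶ B'} {g' : A' ⟶ C'} (a : A' ⟶ A) (b : B' ⟶ B)
      (c : C' ⟶ C) (hf : a ≫ f = f' ≫ b) (hg : a ≫ g = g' ≫ c),
      Set.MapsTo (map a b c hf hg) (lower f' g') (lower f g) := by
    intro A' B' C' f' g' a b c hf hg x hx
    exact (height_map a b c hf hg x).trans_lt hx
  have hu : ∀ {A' B' C' : TopCat.{u}} {f' : A' ⟶ B'} {g' : A' ⟶ C'} (a : A' ⟶ A) (b : B' ⟶ B)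
      (c : C' ⟶ C) (hf : a ≫ f = f' ≫ b) (hg : a ≫ g = g' ≫ c),
      Set.MapsTo (map a b c hf hg) (upper f' g') (upper f g) := by
    intro A' B' C' f' g' a b c hf hg x hx
    exact lt_of_lt_of_eq hx (height_map a b c hf hg x).symm
  refine homologyIso_of_cover _ _ (isOpen_lower f₁ g₁) (isOpen_upper f₁ g₁)
    (lower_union_upper f₁ g₁) (isOpen_lower f₂ g₂) (isOpen_upper f₂ g₂)
    (lower_union_upper f₂ g₂) (isOpen_lower f g) (isOpen_upper f g)
    (lower_union_upper f g) (hl _ _ _ hf₁ hg₁) (hu _ _ _ hf₁ hg₁) (hl _ _ _ hf₂ hg₂)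
    (hu _ _ _ hf₂ hg₂) (fun m hm => ?_) (fun m hm => ?_) (fun m hm => ?_)
  · refine HomologyIso.of_square' ?_
      ((homologyIso_leftEnd f₁ g₁ m).sum (homologyIso_leftEnd f₂ g₂ m))
      (homologyIso_leftEnd f g m) (hB m hm)
    exact sum_hom_ext rfl rfl
  · refine HomologyIso.of_square' ?_
      ((homologyIso_rightEnd f₁ g₁ m).sum (homologyIso_rightEnd f₂ g₂ m))
      (homologyIso_rightEnd f g m) (hC m hm)
    exact sum_hom_ext rfl rfl
  · refine HomologyIso.of_square' ?_
      ((homologyIso_middle f₁ g₁ m).sum (homologyIso_middle f₂ g₂ m))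
      (homologyIso_middle f g m) (hA m hm)
    exact sum_hom_ext rfl rfl

end DoubleCylinder

/-! ### Geometric realization -/

/-- The characteristic map of a simplex. -/
noncomputable def charMap {S : SSet.{u}} {k : SimplexCategoryᵒᵖ} (x : S.obj k) :
    SimplexCategory.toTop.{u}.obj k.unop ⟶ SSet.toTop.obj S :=
  simplexMap ((sSetTopAdj.unit.app S).app k x)

lemma charMap_map {S : SSet.{u}} {k l : SimplexCategoryᵒᵖ} (θ : k ⟶ l) (x : S.obj k) :
    charMap (S.map θ x) = SimplexCategory.toTop.map θ.unop ≫ charMap x :=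
  congrArg simplexMap (congrArg (fun f => f x) ((sSetTopAdj.unit.app S).naturality θ))

lemma charMap_comp {S T : SSet.{u}} (f : S ⟶ T) {k : SimplexCategoryᵒᵖ} (x : S.obj k) :
    charMap x ≫ SSet.toTop.map f = charMap (f.app k x) :=
  (congrArg (fun h => simplexMap (h.app k x)) (sSetTopAdj.unit.naturality f)).symm

/-- The continuous map on a geometric realization that corresponds to a map to a singular
simplicial set. -/
noncomputable def realizationDesc {S : SSet.{u}} {Y : TopCat.{u}} (φ : S ⟶ TopCat.toSSet.obj Y) :
    SSet.toTop.obj S ⟶ Y :=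
  (sSetTopAdj.homEquiv S Y).symm φ

lemma charMap_realizationDesc {S : SSet.{u}} {Y : TopCat.{u}} (φ : S ⟶ TopCat.toSSet.obj Y)
    {k : SimplexCategoryᵒᵖ} (x : S.obj k) :
    charMap x ≫ realizationDesc φ = simplexMap (φ.app k x) := by
  have h := (sSetTopAdj.homEquiv S Y).apply_symm_apply φ
  rw [Adjunction.homEquiv_unit] at h
  exact congrArg (fun h => simplexMap (h.app k x)) h

lemma realization_hom_ext {S : SSet.{u}} {Y : TopCat.{u}} {f g : SSet.toTop.obj S ⟶ Y}
    (h : ∀ (k : SimplexCategoryᵒᵖ) (x : S.obj k), charMap x ≫ f = charMap x ≫ g) : f = g := by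
  refine (sSetTopAdj.homEquiv S Y).injective ?_
  rw [Adjunction.homEquiv_unit, Adjunction.homEquiv_unit]
  ext k x
  exact congrArg singularSimplex (h k x)

lemma realization_continuousMap_ext {S : SSet.{u}} {Y : Type u} [TopologicalSpace Y]
    {f g : C(SSet.toTop.obj S, Y)}
    (h : ∀ (k : SimplexCategoryᵒᵖ) (x : S.obj k) t, f (charMap x t) = g (charMap x t)) : f = g :=
  congrArg TopCat.Hom.hom (realization_hom_ext (Y := TopCat.of Y) (f := TopCat.ofHom f)
    (g := TopCat.ofHom g) fun k x => TopCat.hom_ext (ContinuousMap.ext (h k x)))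

/-- Every point of a geometric realization lies in the image of a characteristic map. -/
lemma exists_charMap {S : SSet.{u}} (e : SSet.toTop.obj S) :
    ∃ (k : SimplexCategoryᵒᵖ) (x : S.obj k) (t : SimplexCategory.toTop.{u}.obj k.unop),
      charMap x t = e := by
  -- two maps to an indiscrete space agree if they agree on all simplices
  have h := @realization_continuousMap_ext S (ULift.{u} Prop) ⊤
    (@ContinuousMap.mk _ _ _ ⊤ (fun e => ULift.up (∃ (k : SimplexCategoryᵒᵖ) (x : S.obj k)
      (t : SimplexCategory.toTop.{u}.obj k.unop), charMap x t = e)) continuous_top)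
    (@ContinuousMap.mk _ _ _ ⊤ (fun e => ULift.up True) continuous_top)
    (fun k x t => congrArg ULift.up (eq_true ⟨k, x, t, rfl⟩))
  exact of_eq_true (congrArg ULift.down (congrFun (congrArg (@ContinuousMap.toFun _ _ _ ⊤) h) e))

/-- The topology of a geometric realization is coinduced by the characteristic maps. -/
lemma continuous_of_charMap {S : SSet.{u}} {Y : Type u} [TopologicalSpace Y]
    (f : SSet.toTop.obj S → Y)
    (h : ∀ (k : SimplexCategoryᵒᵖ) (x : S.obj k), Continuous fun t => f (charMap x t)) :
    Continuous f := by
  let φ : S ⟶ TopCat.toSSet.obj (TopCat.of Y) :=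
    { app k := ↾fun x => singularSimplex (TopCat.ofHom ⟨fun t => f (charMap x t), h k x⟩)
      naturality k l θ := by
        ext x
        refine congrArg singularSimplex (TopCat.hom_ext (ContinuousMap.ext fun t => ?_))
        exact congrArg (fun g => f (g t)) (charMap_map θ x) }
  refine (realizationDesc φ).hom.continuous.congr fun e => ?_
  obtain ⟨k, x, t, rfl⟩ := exists_charMap e
  exact congrArg (fun f => f t) (charMap_realizationDesc φ x)

/-- A map of simplicial sets that is constant on the fibers of a levelwise surjective map descends
along it. -/
noncomputable def descend {S B T : SSet.{u}} (p : S ⟶ B)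
    (hp : ∀ k : SimplexCategoryᵒᵖ, Function.Surjective (p.app k)) (φ : S ⟶ T)
    (h : ∀ (k : SimplexCategoryᵒᵖ) (x y : S.obj k), p.app k x = p.app k y →
      φ.app k x = φ.app k y) : B ⟶ T where
  app k := ↾fun b => φ.app k (Function.surjInv (hp k) b)
  naturality k l θ := by
    ext b
    have hb := Function.surjInv_eq (hp k) b
    have h₁ : φ.app l (Function.surjInv (hp l) (B.map θ b)) =
        φ.app l (S.map θ (Function.surjInv (hp k) b)) := by
      refine h l _ _ ((Function.surjInv_eq (hp l) _).trans ?_)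
      refine Eq.trans ?_ (congrArg (fun f => f (Function.surjInv (hp k) b)) (p.naturality θ)).symm
      exact congrArg (B.map θ) hb.symm
    exact h₁.trans (congrArg (fun f => f (Function.surjInv (hp k) b)) (φ.naturality θ))

lemma comp_descend {S B T : SSet.{u}} (p : S ⟶ B)
    (hp : ∀ k : SimplexCategoryᵒᵖ, Function.Surjective (p.app k)) (φ : S ⟶ T)
    (h : ∀ (k : SimplexCategoryᵒᵖ) (x y : S.obj k), p.app k x = p.app k y →
      φ.app k x = φ.app k y) : p ≫ descend p hp φ h = φ := by
  ext k x
  exact h k _ _ (Function.surjInv_eq (hp k) _)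

lemma comp_hom_ext {S B T : SSet.{u}} {p : S ⟶ B}
    (hp : ∀ k : SimplexCategoryᵒᵖ, Function.Surjective (p.app k)) {f g : B ⟶ T}
    (h : p ≫ f = p ≫ g) : f = g := by
  ext k b
  obtain ⟨x, rfl⟩ := hp k b
  exact congrArg (fun k' => k'.app k x) h

/-! ### Orbits of tuples -/

/-- A map from the tuples of elements of `Z` to a simplicial set which is a quotient map by
the action of the group `H`. -/
structure IsOrbitMap (H : Type*) [Group H] {Z : Type u} [MulAction H Z] {B : SSet.{u}}
    (p : tuples Z ⟶ B) : Prop where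
  surjective (k : SimplexCategoryᵒᵖ) : Function.Surjective (p.app k)
  eq_iff (k : SimplexCategoryᵒᵖ) (v w : (tuples Z).obj k) :
    p.app k v = p.app k w ↔ ∃ h : H, (tuplesMap (h • ·)).app k v = w

/-- The characteristic map of a tuple. -/
noncomputable def tupleMap {Z : Type u} {l : SimplexCategory} (w : Fin (l.len + 1) → Z) :
    SimplexCategory.toTop.{u}.obj l ⟶ SSet.toTop.obj (tuples Z) :=
  charMap (S := tuples Z) (k := .op l) w

lemma exists_tupleMap {Z : Type u} (e : SSet.toTop.obj (tuples Z)) :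
    ∃ (l : SimplexCategory) (w : Fin (l.len + 1) → Z) (t : SimplexCategory.toTop.{u}.obj l),
      tupleMap w t = e := by
  obtain ⟨k, v, t, h⟩ := exists_charMap e
  exact ⟨k.unop, v, t, h⟩

lemma tupleMap_map {Z : Type u} {k l : SimplexCategory} (θ : k ⟶ l) (w : Fin (l.len + 1) → Z)
    (t : SimplexCategory.toTop.{u}.obj k) :
    tupleMap w (SimplexCategory.toTop.map θ t) = tupleMap (w ∘ θ.toOrderHom) t :=
  (congrArg (fun f => f t) (charMap_map (S := tuples Z) θ.op w)).symm

lemma toTop_map_tupleMap {Z Z' : Type u} (φ : Z → Z') {l : SimplexCategory}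
    (w : Fin (l.len + 1) → Z) (t : SimplexCategory.toTop.{u}.obj l) :
    SSet.toTop.map (tuplesMap φ) (tupleMap w t) = tupleMap (φ ∘ w) t :=
  congrArg (fun f => f t) (charMap_comp (k := .op l) (tuplesMap φ) w)

/-- A point `t` of a simplex divides the unit interval into intervals of lengths `t i`. This is
the length of the part of the `i`-th interval that lies below `a`. -/
noncomputable def lengthBelow (a : ℝ) {n : ℕ} (t : Fin n → ℝ) (i : Fin n) : ℝ :=
  min (∑ j ∈ Finset.Iic i, t j) a - min (∑ j ∈ Finset.Iio i, t j) a

lemma lengthBelow_nonneg (a : ℝ) {n : ℕ} {t : Fin n → ℝ} (ht : ∀ i, 0 ≤ t i) (i : Fin n) :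
    0 ≤ lengthBelow a t i :=
  sub_nonneg.2 (min_le_min_right a (Finset.sum_le_sum_of_subset_of_nonneg
    Finset.Iio_subset_Iic_self fun j _ _ => ht j))

lemma sum_lengthBelow {a : ℝ} (ha : 0 ≤ a) {n : ℕ} (t : Fin n → ℝ) (L : Finset (Fin n)) :
    (∀ i ∈ L, ∀ j < i, j ∈ L) → ∑ i ∈ L, lengthBelow a t i = min (∑ i ∈ L, t i) a := by
  classical
  induction L using Finset.induction_on_max with
  | empty => intro _; simp [ha]
  | insert i L hi ih =>
    intro h
    have hL : L = Finset.Iio i := by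
      ext j
      rw [Finset.mem_Iio]
      refine ⟨hi j, fun hj => ?_⟩
      exact (Finset.mem_insert.1 (h i (Finset.mem_insert_self _ _) j hj)).resolve_left hj.ne
    have hL' : insert i L = Finset.Iic i := by
      rw [hL, Finset.Iio_insert]
    rw [Finset.sum_insert fun h => (hi i h).false, ih (by
      intro k hk j hj
      rw [hL, Finset.mem_Iio] at hk ⊢
      exact hj.trans hk), hL', lengthBelow, hL, sub_add_cancel]

/-- Merging consecutive intervals along a monotone map adds up their lengths, so that
`lengthBelow` is compatible with the simplicial structure. -/
lemma lengthBelow_fiber {a : ℝ} (ha : 0 ≤ a) {m n : ℕ} (θ : Fin m →o Fin n) (t : Fin m → ℝ)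
    (j : Fin n) : lengthBelow a (fun j => ∑ i with θ i = j, t i) j =
      ∑ i with θ i = j, lengthBelow a t i := by
  have hle : ∀ f : Fin m → ℝ, ∑ k ∈ Finset.Iic j, ∑ i with θ i = k, f i =
      ∑ i with θ i ≤ j, f i := by
    intro f
    rw [← Finset.sum_fiberwise_of_maps_to (s := Finset.univ.filter fun i => θ i ≤ j)
      (t := Finset.Iic j) (g := θ) (by simp)]
    refine Finset.sum_congr rfl fun k hk => Finset.sum_congr ?_ fun _ _ => rfl
    ext i
    simp only [Finset.mem_filter, Finset.mem_univ, true_and, Finset.mem_Iic] at hk ⊢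
    exact ⟨fun h => ⟨h ▸ hk, h⟩, fun h => h.2⟩
  have hlt : ∀ f : Fin m → ℝ, ∑ k ∈ Finset.Iio j, ∑ i with θ i = k, f i =
      ∑ i with θ i < j, f i := by
    intro f
    rw [← Finset.sum_fiberwise_of_maps_to (s := Finset.univ.filter fun i => θ i < j)
      (t := Finset.Iio j) (g := θ) (by simp)]
    refine Finset.sum_congr rfl fun k hk => Finset.sum_congr ?_ fun _ _ => rfl
    ext i
    simp only [Finset.mem_filter, Finset.mem_univ, true_and, Finset.mem_Iio] at hk ⊢
    exact ⟨fun h => ⟨h ▸ hk, h⟩, fun h => h.2⟩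
  rw [lengthBelow, hle, hlt, ← sum_lengthBelow ha, ← sum_lengthBelow ha, ← hle, ← hlt,
    ← Finset.Iio_insert, Finset.sum_insert (by simp), add_sub_cancel_right]
  · intro i hi k hk
    simp only [Finset.mem_filter, Finset.mem_univ, true_and] at hi ⊢
    exact (θ.monotone hk.le).trans_lt hi
  · intro i hi k hk
    simp only [Finset.mem_filter, Finset.mem_univ, true_and] at hi ⊢
    exact (θ.monotone hk.le).trans hi

open Classical in
/-- A point of the realization of `tuples Z` can be regarded as a step function on the unit
interval with values in `Z`. This is the length of the set on which the step function has
value `z`, inside the interval from `0` to `a`. -/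
noncomputable def weightSimplex {Z : Type u} (a : ℝ) (z : Z) {l : SimplexCategory}
    (v : Fin (l.len + 1) → Z) (t : SimplexCategory.toTop.{u}.obj l) : ℝ :=
  ∑ i with v i = z, lengthBelow a (coords t) i

lemma continuous_weightSimplex {Z : Type u} (a : ℝ) (z : Z) {l : SimplexCategory}
    (v : Fin (l.len + 1) → Z) : Continuous (weightSimplex.{u} a z v) := by
  have h : ∀ i, Continuous fun t : SimplexCategory.toTop.{u}.obj l => coords t i := fun i =>
    (continuous_apply i).comp (continuous_coords l)
  refine continuous_finsetSum _ fun i _ => Continuous.sub ?_ ?_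
  · exact (continuous_finsetSum _ fun j _ => h j).min continuous_const
  · exact (continuous_finsetSum _ fun j _ => h j).min continuous_const

lemma weightSimplex_map {Z : Type u} {a : ℝ} (ha : 0 ≤ a) (z : Z) {k l : SimplexCategory}
    (θ : k ⟶ l) (v : Fin (l.len + 1) → Z) (t : SimplexCategory.toTop.{u}.obj k) :
    weightSimplex a z v (SimplexCategory.toTop.map θ t) =
      weightSimplex a z (v ∘ θ.toOrderHom) t := by
  classical
  have hc : coords (SimplexCategory.toTop.map θ t) =
      fun j => ∑ i with θ.toOrderHom i = j, coords t i := funext (coords_toTop_map θ t)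
  rw [weightSimplex, weightSimplex, hc]
  simp_rw [lengthBelow_fiber ha]
  rw [← Finset.sum_fiberwise_of_maps_to (s := Finset.univ.filter fun i => (v ∘ θ.toOrderHom) i = z)
      (t := Finset.univ.filter fun j => v j = z) (g := θ.toOrderHom) (by simp)]
  refine Finset.sum_congr rfl fun k hk => Finset.sum_congr ?_ fun _ _ => rfl
  ext i
  simp only [Finset.mem_filter, Finset.mem_univ, true_and, Function.comp_apply] at hk ⊢
  exact ⟨fun h => ⟨h ▸ hk, h⟩, fun h => h.2⟩

/-- The map of simplicial sets given by `weightSimplex`. -/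
noncomputable def weightMap {Z : Type u} {a : ℝ} (ha : 0 ≤ a) (z : Z) :
    tuples Z ⟶ TopCat.toSSet.obj (TopCat.of (ULift.{u} ℝ)) where
  app k := ↾fun v => singularSimplex (TopCat.ofHom ⟨fun t => ULift.up (weightSimplex a z v t),
    continuous_uliftUp.comp (continuous_weightSimplex a z v)⟩)
  naturality k l θ := by
    ext v
    refine congrArg singularSimplex (TopCat.hom_ext (ContinuousMap.ext fun t => ?_))
    exact congrArg ULift.up (weightSimplex_map ha z θ.unop v t).symm

/-- The continuous function on the realization of `tuples Z` given by `weightSimplex`. -/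
noncomputable def weight {Z : Type u} {a : ℝ} (ha : 0 ≤ a) (z : Z)
    (e : SSet.toTop.obj (tuples Z)) : ℝ :=
  (realizationDesc (weightMap ha z) e).down

lemma continuous_weight {Z : Type u} {a : ℝ} (ha : 0 ≤ a) (z : Z) :
    Continuous (weight ha z) :=
  continuous_uliftDown.comp (realizationDesc (weightMap ha z)).hom.continuous

lemma weight_tupleMap {Z : Type u} {a : ℝ} (ha : 0 ≤ a) (z : Z) {l : SimplexCategory}
    (w : Fin (l.len + 1) → Z) (t : SimplexCategory.toTop.{u}.obj l) :
    weight ha z (tupleMap w t) = weightSimplex a z w t :=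
  congrArg (fun f => (f t).down) (charMap_realizationDesc (k := .op l) (weightMap ha z) w)

lemma weight_map {Z : Type u} {a : ℝ} (ha : 0 ≤ a) {φ : Z → Z} (hφ : Function.Injective φ)
    (z : Z) (e : SSet.toTop.obj (tuples Z)) :
    weight ha (φ z) (SSet.toTop.map (tuplesMap φ) e) = weight ha z e := by
  obtain ⟨k, v, t, rfl⟩ := exists_tupleMap e
  rw [toTop_map_tupleMap, weight_tupleMap, weight_tupleMap]
  refine Finset.sum_congr (Finset.ext fun i => ?_) fun _ _ => rfl
  simp only [Finset.mem_filter, Function.comp_apply, hφ.eq_iff]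

/-- Two distinct values of a step function are attained on disjoint subsets of `[0, a]`. -/
lemma weight_add_weight_le {Z : Type u} {a : ℝ} (ha : 0 ≤ a) {z z' : Z} (hz : z ≠ z')
    (e : SSet.toTop.obj (tuples Z)) : weight ha z e + weight ha z' e ≤ a := by
  classical
  obtain ⟨k, v, t, rfl⟩ := exists_tupleMap e
  rw [weight_tupleMap, weight_tupleMap, weightSimplex, weightSimplex, ← Finset.sum_union]
  · refine (Finset.sum_le_sum_of_subset_of_nonneg (Finset.subset_univ _) fun i _ _ =>
      lengthBelow_nonneg a (coords_nonneg t) i).trans ?_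
    rw [sum_lengthBelow ha _ _ (by simp)]
    exact min_le_right _ _
  · rw [Finset.disjoint_filter]
    rintro i _ rfl h
    exact hz h

/-- The first interval of positive length of a step function is `[0, a]` for some `a`, and the value
there has the full weight `a`. -/
lemma exists_weight_eq {Z : Type u} (e : SSet.toTop.obj (tuples Z)) :
    ∃ (a : ℝ) (ha : 0 ≤ a) (z : Z), 0 < a ∧ a ≤ weight ha z e := by
  classical
  obtain ⟨k, v, t, rfl⟩ := exists_tupleMap e
  have hne : (Finset.univ.filter fun i => coords t i ≠ 0).Nonempty := by
    by_contra h
    rw [Finset.not_nonempty_iff_eq_empty, Finset.filter_eq_empty_iff] at h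
    have := sum_coords t
    rw [Finset.sum_eq_zero fun i hi => not_not.1 (h hi)] at this
    exact zero_ne_one this
  -- the leading interval of the step function
  let i := (Finset.univ.filter fun i => coords t i ≠ 0).min' hne
  have hi : coords t i ≠ 0 := (Finset.mem_filter.1 (Finset.min'_mem _ hne)).2
  have hj : ∀ j < i, coords t j = 0 := by
    intro j hj
    by_contra h
    exact (Finset.min'_le _ j (Finset.mem_filter.2 ⟨Finset.mem_univ _, h⟩)).not_gt hj
  refine ⟨coords t i, coords_nonneg t i, v i,
    (coords_nonneg t i).lt_of_ne' hi, ?_⟩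
  rw [weight_tupleMap, weightSimplex]
  have h₀ : ∑ j ∈ Finset.Iio i, coords t j = 0 :=
    Finset.sum_eq_zero fun j h => hj j (Finset.mem_Iio.1 h)
  have h : lengthBelow (coords t i) (coords t) i = coords t i := by
    rw [lengthBelow, ← Finset.Iio_insert, Finset.sum_insert (by simp), h₀, add_zero, min_self,
      min_eq_left (coords_nonneg t i), sub_zero]
  refine h.symm.le.trans (Finset.single_le_sum (f := lengthBelow (coords t i) (coords t))
    (fun j _ => lengthBelow_nonneg _ (coords_nonneg t) j) ?_)
  simp

/-! ### The covering map of a free action -/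

/-- A group acting on `Z` acts on the realization of `tuples Z`. -/
noncomputable instance {H : Type*} {Z : Type u} [Monoid H] [MulAction H Z] :
    MulAction H (SSet.toTop.obj (tuples Z)) where
  smul h e := SSet.toTop.map (tuplesMap (h • ·)) e
  one_smul e := by
    obtain ⟨l, w, t, rfl⟩ := exists_tupleMap e
    refine (toTop_map_tupleMap _ w t).trans (congrArg (fun w => tupleMap w t) ?_)
    exact funext fun i => one_smul H (w i)
  mul_smul g h e := by
    obtain ⟨l, w, t, rfl⟩ := exists_tupleMap e
    refine (toTop_map_tupleMap _ w t).trans ?_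
    refine Eq.trans ?_ (congrArg (SSet.toTop.map (tuplesMap (g • ·)))
      (toTop_map_tupleMap (h • ·) w t)).symm
    refine Eq.trans ?_ (toTop_map_tupleMap _ _ t).symm
    exact congrArg (fun w => tupleMap w t) (funext fun i => mul_smul g h (w i))

lemma smul_tupleMap {H : Type*} {Z : Type u} [Monoid H] [MulAction H Z] (h : H)
    {l : SimplexCategory} (w : Fin (l.len + 1) → Z) (t : SimplexCategory.toTop.{u}.obj l) :
    h • (tupleMap w t : SSet.toTop.obj (tuples Z)) = tupleMap (h • w) t :=
  toTop_map_tupleMap (h • ·) w t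

namespace IsOrbitMap

variable {H : Type*} [Group H] {Z : Type u} [MulAction H Z] {B : SSet.{u}} {p : tuples Z ⟶ B}

lemma charMap_app (p : tuples Z ⟶ B) {l : SimplexCategory} (w : Fin (l.len + 1) → Z)
    (t : SimplexCategory.toTop.{u}.obj l) :
    charMap (p.app (.op l) w) t = SSet.toTop.map p (tupleMap w t) :=
  congrArg (fun f => f t) (charMap_comp (k := .op l) p w).symm

lemma toTop_map_surjective (hp : IsOrbitMap H p) : Function.Surjective (SSet.toTop.map p) := by
  intro e
  obtain ⟨k, x, t, rfl⟩ := exists_charMap e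
  obtain ⟨w, rfl⟩ := hp.surjective k x
  exact ⟨tupleMap w t, (charMap_app p w t).symm⟩

lemma isQuotientMap (hp : IsOrbitMap H p) : IsQuotientMap (SSet.toTop.map p) := by
  refine (isQuotientMap_iff _).2 ⟨isCoinducing_iff.2 fun s => ⟨fun hs => ?_, fun hs => ?_⟩,
    hp.toTop_map_surjective⟩
  · have h : Continuous fun e => ULift.up.{u} (e ∈ s) := by
      refine continuous_of_charMap _ fun k x => ?_
      obtain ⟨w, rfl⟩ := hp.surjective k x
      have hw : Continuous fun t => SSet.toTop.map p (tupleMap (l := k.unop) w t) ∈ s :=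
        (isOpen_iff_continuous_mem.1 hs).comp (tupleMap (l := k.unop) w).hom.continuous
      refine continuous_uliftUp.comp (hw.congr fun t => ?_)
      exact congrArg (· ∈ s) (charMap_app p (l := k.unop) w t).symm
    exact isOpen_iff_continuous_mem.2 (continuous_uliftDown.comp h)
  · exact hs.preimage (SSet.toTop.map p).hom.continuous

lemma toTop_map_smul (hp : IsOrbitMap H p) (h : H) (e : SSet.toTop.obj (tuples Z)) :
    SSet.toTop.map p (h • e) = SSet.toTop.map p e := by
  obtain ⟨l, w, t, rfl⟩ := exists_tupleMap e
  rw [smul_tupleMap, ← charMap_app, ← charMap_app]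
  exact congrArg (fun x => charMap x t) ((hp.eq_iff (.op l) w (h • w : Fin (l.len + 1) → Z)).2
    ⟨h, rfl⟩).symm

instance : ContinuousConstSMul H (SSet.toTop.obj (tuples Z)) where
  continuous_const_smul h := (SSet.toTop.map (tuplesMap (h • ·))).hom.continuous

/-- The fibers of the realization are orbits: the projection to the topological orbit space factors
through the realization of the orbit map. -/
lemma mem_orbit_of_toTop_map_eq (hp : IsOrbitMap H p) {e e' : SSet.toTop.obj (tuples Z)}
    (h : SSet.toTop.map p e = SSet.toTop.map p e') : e ∈ MulAction.orbit H e' := by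
  let Q : TopCat.{u} := TopCat.of (MulAction.orbitRel.Quotient H (SSet.toTop.obj (tuples Z)))
  let q : SSet.toTop.obj (tuples Z) ⟶ Q := TopCat.ofHom ⟨Quotient.mk _, continuous_quotient_mk'⟩
  let φ : tuples Z ⟶ TopCat.toSSet.obj Q := sSetTopAdj.homEquiv _ _ q
  have hφ : ∀ {l : SimplexCategory} (w : Fin (l.len + 1) → Z),
      φ.app (.op l) w = singularSimplex (tupleMap w ≫ q) := by
    intro l w
    have : φ = sSetTopAdj.unit.app _ ≫ TopCat.toSSet.map q := Adjunction.homEquiv_unit ..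
    rw [this]
    rfl
  let ψ : B ⟶ TopCat.toSSet.obj Q := descend p hp.surjective φ (by
    intro k v w hvw
    obtain ⟨g, rfl⟩ := (hp.eq_iff k v w).1 hvw
    refine (hφ (l := k.unop) v).trans (Eq.trans ?_ (hφ (l := k.unop) _).symm)
    refine congrArg singularSimplex (TopCat.hom_ext (ContinuousMap.ext fun t => ?_))
    refine Quotient.sound (s := MulAction.orbitRel H _) ⟨g⁻¹, ?_⟩
    refine (congrArg (g⁻¹ • ·) (smul_tupleMap g (l := k.unop) v t).symm).trans ?_
    exact inv_smul_smul g _)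
  have hψ : SSet.toTop.map p ≫ realizationDesc ψ = q := by
    refine (sSetTopAdj.homEquiv _ _).injective ?_
    rw [Adjunction.homEquiv_naturality_left, realizationDesc, Equiv.apply_symm_apply]
    exact comp_descend _ _ _ _
  have hq : ∀ e, q e = realizationDesc ψ (SSet.toTop.map p e) := fun e =>
    congrArg (fun f => f e) hψ.symm
  exact Quotient.exact (s := MulAction.orbitRel H _)
    ((hq e).trans ((congrArg (realizationDesc ψ) h).trans (hq e').symm))

/-- The realization of the orbit map of a free action is a covering map. Around a point with leading
interval `[0, a]` and leading value `z`, the step functions that have value `z` on more than half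
of `[0, a]` form an open set which is disjoint from its translates. -/
lemma isQuotientCoveringMap (hp : IsOrbitMap H p) [IsCancelSMul H Z] :
    IsQuotientCoveringMap (SSet.toTop.map p) H where
  toIsQuotientMap := hp.isQuotientMap
  continuous_const_smul := continuous_const_smul
  apply_eq_iff_mem_orbit := by
    refine ⟨hp.mem_orbit_of_toTop_map_eq, ?_⟩
    rintro ⟨h, rfl⟩
    exact hp.toTop_map_smul h _
  disjoint e := by
    obtain ⟨a, ha, z, ha', he⟩ := exists_weight_eq e
    refine ⟨{e | a / 2 < weight ha z e}, ?_, fun h => ?_⟩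
    · refine (isOpen_Ioi.preimage (continuous_weight ha z)).mem_nhds ?_
      exact lt_of_lt_of_le (half_lt_self ha') he
    · rintro ⟨_, ⟨e', he', rfl⟩, hhe'⟩
      -- otherwise the step function of `h • e'` would mostly have two different values
      by_contra hne
      have hz : z ≠ h⁻¹ • z := by
        intro hz
        refine hne (inv_eq_one.1 (IsCancelSMul.right_cancel h⁻¹ 1 z ?_))
        rw [one_smul, ← hz]
      have hw := weight_map ha (MulAction.injective h) (h⁻¹ • z) e'
      rw [smul_inv_smul] at hw
      have h₁ : a / 2 < weight ha z (SSet.toTop.map (tuplesMap (h • ·)) e') := hhe'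
      have h₂ := weight_add_weight_le ha hz e'
      rw [hw] at h₁
      have h₃ : a / 2 < weight ha z e' := he'
      linarith

end IsOrbitMap

/-! ### Lifting singular simplices -/

lemma isPathConnected_ball_stdSimplex {n : ℕ} (x : stdSimplex ℝ (Fin (n + 1))) {r : ℝ}
    (hr : 0 < r) : IsPathConnected (Metric.ball x r) := by
  refine (IsInducing.subtypeVal.isPathConnected_iff).2 ?_
  have h : Subtype.val '' Metric.ball x r =
      Metric.ball (x : Fin (n + 1) → ℝ) r ∩ stdSimplex ℝ (Fin (n + 1)) := by
    ext y
    constructor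
    · rintro ⟨y, hy, rfl⟩
      exact ⟨hy, y.2⟩
    · rintro ⟨hy, hy'⟩
      exact ⟨⟨y, hy'⟩, hy, rfl⟩
  rw [h]
  exact ((convex_ball _ r).inter (convex_stdSimplex ℝ _)).isPathConnected
    ⟨x, Metric.mem_ball_self hr, x.2⟩

instance (n : ℕ) : LocallyPathConnectedSpace (stdSimplex ℝ (Fin (n + 1))) :=
  .of_bases (fun _ => Metric.nhds_basis_ball) fun x _ hr => isPathConnected_ball_stdSimplex x hr

instance (n : ℕ) : ContractibleSpace (stdSimplex ℝ (Fin (n + 1))) :=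
  (convex_stdSimplex ℝ (Fin (n + 1))).contractibleSpace ⟨_, (stdSimplex.vertex 0).2⟩

namespace IsCoveringMap

variable {X Y : TopCat.{u}} {f : X ⟶ Y}

lemma exists_singularSimplex_lift (hf : IsCoveringMap f) (hs : Function.Surjective f)
    (k : SimplexCategoryᵒᵖ) :
    Function.Surjective ((TopCat.toSSet.map f).app k) := by
  intro σ
  let a₀ : stdSimplex ℝ (Fin (k.unop.len + 1)) := stdSimplex.vertex 0
  let g : C(stdSimplex ℝ (Fin (k.unop.len + 1)), Y) :=
    ⟨fun y => simplexMap σ (ULift.up y), (simplexMap σ).hom.continuous.comp continuous_uliftUp⟩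
  obtain ⟨e₀, he₀⟩ := hs (g a₀)
  obtain ⟨F, ⟨-, hF⟩, -⟩ := hf.existsUnique_continuousMap_lifts g a₀ e₀ he₀
  refine ⟨singularSimplex (TopCat.ofHom ⟨fun t => F t.down,
    F.continuous.comp continuous_uliftDown⟩), ?_⟩
  exact congrArg singularSimplex (TopCat.hom_ext (ContinuousMap.ext fun t => congrFun hF t.down))

lemma singularSimplex_ext (hf : IsCoveringMap f) {k : SimplexCategoryᵒᵖ}
    {σ τ : (TopCat.toSSet.obj X).obj k}
    (h : (TopCat.toSSet.map f).app k σ = (TopCat.toSSet.map f).app k τ)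
    (t₀ : SimplexCategory.toTop.{u}.obj k.unop) (h₀ : simplexMap σ t₀ = simplexMap τ t₀) :
    σ = τ := by
  let up (σ : (TopCat.toSSet.obj X).obj k) : C(stdSimplex ℝ (Fin (k.unop.len + 1)), X) :=
    ⟨fun y => simplexMap σ (ULift.up y), (simplexMap σ).hom.continuous.comp continuous_uliftUp⟩
  have hu : ∀ y, f (up σ y) = f (up τ y) := fun y =>
    congrArg (fun σ => simplexMap σ (ULift.up y)) h
  have := hf.eq_of_comp_eq (up σ).continuous (up τ).continuous (funext hu) t₀.down h₀
  exact congrArg singularSimplex (TopCat.hom_ext (ContinuousMap.ext fun t =>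
    congrFun this t.down))

end IsCoveringMap

namespace IsOrbitMap

variable {H : Type*} [Group H] {Z : Type u} [MulAction H Z] {B : SSet.{u}} {p : tuples Z ⟶ B}

/-- Singular simplices lift along the realization of the orbit map of a free action. -/
lemma toSSet_surjective (hp : IsOrbitMap H p) [IsCancelSMul H Z] (k : SimplexCategoryᵒᵖ) :
    Function.Surjective ((TopCat.toSSet.map (SSet.toTop.map p)).app k) :=
  hp.isQuotientCoveringMap.isCoveringMap.exists_singularSimplex_lift hp.toTop_map_surjective k

end IsOrbitMap

/-- The action on the singular simplices of the realization of `tuples Z`. -/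
noncomputable instance {H : Type*} [Group H] {Z : Type u} [MulAction H Z]
    (k : SimplexCategoryᵒᵖ) : MulAction H
    ((TopCat.toSSet.obj (SSet.toTop.obj (tuples Z))).obj k) where
  smul h σ := (TopCat.toSSet.map (SSet.toTop.map (tuplesMap (h • ·)))).app k σ
  one_smul σ := congrArg singularSimplex (TopCat.hom_ext (ContinuousMap.ext fun t =>
    one_smul H (simplexMap σ t)))
  mul_smul g h σ := congrArg singularSimplex (TopCat.hom_ext (ContinuousMap.ext fun t =>
    mul_smul g h (simplexMap σ t)))

namespace IsOrbitMap

variable {H : Type*} [Group H] {Z : Type u} [MulAction H Z] {B : SSet.{u}} {p : tuples Z ⟶ B}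

/-- Two lifts of a singular simplex differ by the action of an element of the group. -/
lemma toSSet_eq_iff (hp : IsOrbitMap H p) [IsCancelSMul H Z] {k : SimplexCategoryᵒᵖ}
    (σ τ : (TopCat.toSSet.obj (SSet.toTop.obj (tuples Z))).obj k) :
    (TopCat.toSSet.map (SSet.toTop.map p)).app k σ =
      (TopCat.toSSet.map (SSet.toTop.map p)).app k τ ↔ ∃ h : H, h • σ = τ := by
  have hsmul : ∀ (h : H) (σ : (TopCat.toSSet.obj (SSet.toTop.obj (tuples Z))).obj k),
      (TopCat.toSSet.map (SSet.toTop.map p)).app k (h • σ) =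
        (TopCat.toSSet.map (SSet.toTop.map p)).app k σ := fun h σ =>
    congrArg singularSimplex (TopCat.hom_ext (ContinuousMap.ext fun t =>
      hp.toTop_map_smul h (simplexMap σ t)))
  constructor
  · intro h
    have h₀ : SSet.toTop.map p (simplexMap τ (vertices _ 0)) =
        SSet.toTop.map p (simplexMap σ (vertices _ 0)) :=
      congrArg (fun σ => simplexMap σ (vertices _ 0)) h.symm
    obtain ⟨g, hg⟩ := hp.mem_orbit_of_toTop_map_eq h₀
    exact ⟨g, hp.isQuotientCoveringMap.isCoveringMap.singularSimplex_ext ((hsmul g σ).trans h)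
      (vertices _ 0) hg⟩
  · rintro ⟨h, rfl⟩
    exact (hsmul h σ).symm

lemma isCancelSMul_singular (hp : IsOrbitMap H p) [IsCancelSMul H Z] (k : SimplexCategoryᵒᵖ) :
    IsCancelSMul H ((TopCat.toSSet.obj (SSet.toTop.obj (tuples Z))).obj k) := by
  have := hp.isQuotientCoveringMap.isCancelSMul
  refine ⟨fun g h σ hσ => ?_⟩
  exact IsCancelSMul.right_cancel g h (simplexMap σ (vertices _ 0))
    (congrArg (fun σ => simplexMap σ (vertices _ 0)) hσ)

end IsOrbitMap

/-! ### Homotopies between realizations -/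

/-- The join of a simplex with itself. -/
def joinSelf (l : SimplexCategory) : SimplexCategory := ⦋(l.len + 1) + l.len⦌

/-- The first copy of a simplex in its join with itself. -/
def joinLeft (l : SimplexCategory) : l ⟶ joinSelf l :=
  SimplexCategory.Hom.mk ⟨Fin.castAdd (l.len + 1), fun _ _ h => h⟩

/-- The second copy of a simplex in its join with itself. -/
def joinRight (l : SimplexCategory) : l ⟶ joinSelf l :=
  SimplexCategory.Hom.mk ⟨Fin.natAdd (l.len + 1), fun _ _ h => Nat.add_le_add_left h _⟩

/-- Two monotone maps side by side. -/
def appendSelf {m n : ℕ} (θ : Fin m →o Fin n) : Fin (m + m) →o Fin (n + n) :=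
  ⟨Fin.append (Fin.castAdd n ∘ θ) (Fin.natAdd n ∘ θ), by
    intro i j h
    induction i using Fin.addCases with
    | left i =>
      induction j using Fin.addCases with
      | left j =>
        rw [Fin.append_left, Fin.append_left]
        exact θ.monotone (a := i) (b := j) h
      | right j =>
        rw [Fin.append_left, Fin.append_right]
        exact ((θ i).2.trans_le (Nat.le_add_right n _)).le
    | right i =>
      induction j using Fin.addCases with
      | left j => exact ((j.2.trans_le (Nat.le_add_right m i)).not_ge h).elim
      | right j =>
        rw [Fin.append_right, Fin.append_right]
        exact Nat.add_le_add_left (θ.monotone (a := i) (b := j) (Nat.le_of_add_le_add_left h)) n⟩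

/-- The join of a map with itself. -/
def joinMap {k l : SimplexCategory} (θ : k ⟶ l) : joinSelf k ⟶ joinSelf l :=
  SimplexCategory.Hom.mk (appendSelf θ.toOrderHom)

/-- The concatenation of two tuples. -/
def joinAppend {Z : Type*} {l : SimplexCategory} (a b : Fin (l.len + 1) → Z) :
    Fin ((joinSelf l).len + 1) → Z :=
  (Fin.append a b : Fin ((l.len + 1) + (l.len + 1)) → Z)

lemma joinAppend_joinLeft {Z : Type*} {l : SimplexCategory} (a b : Fin (l.len + 1) → Z) :
    joinAppend a b ∘ (joinLeft l).toOrderHom = a :=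
  funext fun i => Fin.append_left a b i

lemma joinAppend_joinRight {Z : Type*} {l : SimplexCategory} (a b : Fin (l.len + 1) → Z) :
    joinAppend a b ∘ (joinRight l).toOrderHom = b :=
  funext fun i => Fin.append_right a b i

lemma joinLeft_joinMap {k l : SimplexCategory} (θ : k ⟶ l) :
    joinLeft k ≫ joinMap θ = θ ≫ joinLeft l :=
  SimplexCategory.Hom.ext _ _ (OrderHom.ext _ _ (funext fun i => Fin.append_left
    (Fin.castAdd (l.len + 1) ∘ θ.toOrderHom) (Fin.natAdd (l.len + 1) ∘ θ.toOrderHom) i))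

lemma joinRight_joinMap {k l : SimplexCategory} (θ : k ⟶ l) :
    joinRight k ≫ joinMap θ = θ ≫ joinRight l :=
  SimplexCategory.Hom.ext _ _ (OrderHom.ext _ _ (funext fun i => Fin.append_right
    (Fin.castAdd (l.len + 1) ∘ θ.toOrderHom) (Fin.natAdd (l.len + 1) ∘ θ.toOrderHom) i))

lemma append_comp_appendSelf {Z : Type*} {m n : ℕ} (θ : Fin m →o Fin n) (a b : Fin n → Z) :
    Fin.append a b ∘ appendSelf θ = Fin.append (a ∘ θ) (b ∘ θ) := by
  funext i
  change Fin.append a b (Fin.append (Fin.castAdd n ∘ θ) (Fin.natAdd n ∘ θ) i) = _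
  induction i using Fin.addCases with
  | left i => simp only [Fin.append_left, Function.comp_apply]
  | right i => simp only [Fin.append_right, Function.comp_apply]

lemma joinAppend_joinMap {Z : Type*} {k l : SimplexCategory} (θ : k ⟶ l)
    (a b : Fin (l.len + 1) → Z) :
    joinAppend a b ∘ (joinMap θ).toOrderHom =
      joinAppend (a ∘ θ.toOrderHom) (b ∘ θ.toOrderHom) :=
  append_comp_appendSelf θ.toOrderHom a b

lemma comp_joinAppend {Z Z' : Type*} (φ : Z → Z') {l : SimplexCategory}
    (a b : Fin (l.len + 1) → Z) : φ ∘ joinAppend a b = joinAppend (φ ∘ a) (φ ∘ b) := by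
  refine funext fun i => ?_
  change Fin ((l.len + 1) + (l.len + 1)) at i
  change φ (Fin.append a b i) = Fin.append (φ ∘ a) (φ ∘ b) i
  induction i using Fin.addCases with
  | left i => simp only [Fin.append_left, Function.comp_apply]
  | right i => simp only [Fin.append_right, Function.comp_apply]

/-- The point on the line segment between two points of a simplex. -/
noncomputable def segmentPoint {l : SimplexCategory} (p q : SimplexCategory.toTop.{u}.obj l)
    (s : unitInterval) : SimplexCategory.toTop.{u}.obj l :=
  mkPoint (fun i => (1 - s) * coords p i + s * coords q i)
    (fun i => add_nonneg (mul_nonneg (sub_nonneg.2 s.2.2) (coords_nonneg p i))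
      (mul_nonneg s.2.1 (coords_nonneg q i)))
    (by rw [Finset.sum_add_distrib, ← Finset.mul_sum, ← Finset.mul_sum, sum_coords, sum_coords]
        ring)

lemma continuous_segmentPoint {l : SimplexCategory} {Y : Type*} [TopologicalSpace Y]
    {p q : Y → SimplexCategory.toTop.{u}.obj l} (hp : Continuous p) (hq : Continuous q) :
    Continuous fun y : Y × unitInterval => segmentPoint (p y.1) (q y.1) y.2 := by
  refine continuous_uliftUp.comp (Continuous.subtype_mk (continuous_pi fun i => ?_) _)
  have h₁ : Continuous fun y : Y × unitInterval => coords (p y.1) i :=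
    (continuous_apply i).comp ((continuous_coords l).comp (hp.comp continuous_fst))
  have h₂ : Continuous fun y : Y × unitInterval => coords (q y.1) i :=
    (continuous_apply i).comp ((continuous_coords l).comp (hq.comp continuous_fst))
  fun_prop

lemma segmentPoint_zero {l : SimplexCategory} (p q : SimplexCategory.toTop.{u}.obj l) :
    segmentPoint p q 0 = p :=
  coords_injective (funext fun i => by simp [segmentPoint, coords_mkPoint])

lemma segmentPoint_one {l : SimplexCategory} (p q : SimplexCategory.toTop.{u}.obj l) :
    segmentPoint p q 1 = q :=
  coords_injective (funext fun i => by simp [segmentPoint, coords_mkPoint])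

lemma toTop_map_segmentPoint {k l : SimplexCategory} (θ : k ⟶ l)
    (p q : SimplexCategory.toTop.{u}.obj k) (s : unitInterval) :
    SimplexCategory.toTop.map θ (segmentPoint p q s) =
      segmentPoint (SimplexCategory.toTop.map θ p) (SimplexCategory.toTop.map θ q) s := by
  refine coords_injective (funext fun i => ?_)
  rw [coords_toTop_map]
  simp only [segmentPoint, coords_mkPoint, coords_toTop_map, Finset.sum_add_distrib,
    Finset.mul_sum]

section

variable {Z Z' : Type u} (f₀ f₁ : Z → Z')

/-- The straight homotopy from `f₀` to `f₁` on a simplex of the realization of `tuples Z`. -/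
noncomputable def tupleHomotopy {l : SimplexCategory} (w : Fin (l.len + 1) → Z)
    (y : SimplexCategory.toTop.{u}.obj l × unitInterval) : SSet.toTop.obj (tuples Z') :=
  tupleMap (joinAppend (f₀ ∘ w) (f₁ ∘ w))
    (segmentPoint (SimplexCategory.toTop.map (joinLeft l) y.1)
      (SimplexCategory.toTop.map (joinRight l) y.1) y.2)

lemma continuous_tupleHomotopy {l : SimplexCategory} (w : Fin (l.len + 1) → Z) :
    Continuous (tupleHomotopy.{u} f₀ f₁ w) :=
  (TopCat.Hom.hom (tupleMap (l := joinSelf l) _)).continuous.comp (continuous_segmentPoint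
    (SimplexCategory.toTop.map (joinLeft l)).hom.continuous
    (SimplexCategory.toTop.map (joinRight l)).hom.continuous)

lemma tupleHomotopy_zero {l : SimplexCategory} (w : Fin (l.len + 1) → Z)
    (t : SimplexCategory.toTop.{u}.obj l) :
    tupleHomotopy f₀ f₁ w (t, 0) = tupleMap (f₀ ∘ w) t := by
  rw [tupleHomotopy, segmentPoint_zero, tupleMap_map, joinAppend_joinLeft]

lemma tupleHomotopy_one {l : SimplexCategory} (w : Fin (l.len + 1) → Z)
    (t : SimplexCategory.toTop.{u}.obj l) :
    tupleHomotopy f₀ f₁ w (t, 1) = tupleMap (f₁ ∘ w) t := by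
  rw [tupleHomotopy, segmentPoint_one, tupleMap_map, joinAppend_joinRight]

lemma tupleHomotopy_map {k l : SimplexCategory} (θ : k ⟶ l) (w : Fin (l.len + 1) → Z)
    (t : SimplexCategory.toTop.{u}.obj k) (s : unitInterval) :
    tupleHomotopy f₀ f₁ w (SimplexCategory.toTop.map θ t, s) =
      tupleHomotopy f₀ f₁ (w ∘ θ.toOrderHom) (t, s) := by
  have hl : SimplexCategory.toTop.{u}.map (joinLeft l) (SimplexCategory.toTop.map θ t) =
      SimplexCategory.toTop.map (joinMap θ) (SimplexCategory.toTop.map (joinLeft k) t) := by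
    rw [← TopCat.comp_app, ← TopCat.comp_app, ← Functor.map_comp, ← Functor.map_comp,
      joinLeft_joinMap]
  have hr : SimplexCategory.toTop.{u}.map (joinRight l) (SimplexCategory.toTop.map θ t) =
      SimplexCategory.toTop.map (joinMap θ) (SimplexCategory.toTop.map (joinRight k) t) := by
    rw [← TopCat.comp_app, ← TopCat.comp_app, ← Functor.map_comp, ← Functor.map_comp,
      joinRight_joinMap]
  rw [tupleHomotopy, hl, hr, ← toTop_map_segmentPoint, tupleMap_map, joinAppend_joinMap]
  rfl

end

namespace IsOrbitMap

variable {H : Type*} [Group H] {Z Z' : Type u} [MulAction H Z] [MulAction H Z'] {B B' : SSet.{u}}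
  {p : tuples Z ⟶ B} {p' : tuples Z' ⟶ B'}

lemma toTop_map_tupleHomotopy_smul (hp' : IsOrbitMap H p') {f₀ f₁ : Z → Z'}
    (h₀ : ∀ (h : H) z, f₀ (h • z) = h • f₀ z) (h₁ : ∀ (h : H) z, f₁ (h • z) = h • f₁ z)
    {l : SimplexCategory} (h : H) (w : Fin (l.len + 1) → Z)
    (y : SimplexCategory.toTop.{u}.obj l × unitInterval) :
    SSet.toTop.map p' (tupleHomotopy f₀ f₁ (h • w) y) =
      SSet.toTop.map p' (tupleHomotopy f₀ f₁ w y) := by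
  have : tupleHomotopy f₀ f₁ (h • w) y = h • tupleHomotopy f₀ f₁ w y := by
    rw [tupleHomotopy, tupleHomotopy, smul_tupleMap]
    refine congrArg (fun w => tupleMap w _) ?_
    have hc : h • joinAppend (f₀ ∘ w) (f₁ ∘ w) =
        joinAppend ((h • ·) ∘ f₀ ∘ w) ((h • ·) ∘ f₁ ∘ w) :=
      comp_joinAppend (fun z : Z' => h • z) (f₀ ∘ w) (f₁ ∘ w)
    rw [hc]
    exact congrArg₂ joinAppend (funext fun i => h₀ h (w i)) (funext fun i => h₁ h (w i))
  rw [this]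
  exact hp'.toTop_map_smul h _

/-- Any two equivariant maps induce homotopic maps between the realizations of the orbits. -/
lemma homotopic (hp : IsOrbitMap H p) (hp' : IsOrbitMap H p') {f₀ f₁ : Z → Z'}
    (h₀ : ∀ (h : H) z, f₀ (h • z) = h • f₀ z) (h₁ : ∀ (h : H) z, f₁ (h • z) = h • f₁ z)
    {F₀ F₁ : B ⟶ B'} (hF₀ : p ≫ F₀ = tuplesMap f₀ ≫ p') (hF₁ : p ≫ F₁ = tuplesMap f₁ ≫ p') :
    (SSet.toTop.map F₀).hom.Homotopic (SSet.toTop.map F₁).hom := by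
  -- a homotopy is a map to a path space, and such maps can be defined simplex by simplex
  let M : TopCat.{u} := TopCat.of C(unitInterval, SSet.toTop.obj B')
  let φ : tuples Z ⟶ TopCat.toSSet.obj M :=
    { app k := ↾fun w => singularSimplex (TopCat.ofHom (ContinuousMap.curry
        ⟨fun y => SSet.toTop.map p' (tupleHomotopy f₀ f₁ (l := k.unop) w y),
          (SSet.toTop.map p').hom.continuous.comp (continuous_tupleHomotopy f₀ f₁ _)⟩))
      naturality k l θ := by
        ext w
        refine congrArg singularSimplex (TopCat.hom_ext (ContinuousMap.ext fun t =>
          ContinuousMap.ext fun s => ?_))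
        exact congrArg (SSet.toTop.map p') (tupleHomotopy_map f₀ f₁ θ.unop w t s).symm }
  have hφ : ∀ (k : SimplexCategoryᵒᵖ) (v w : (tuples Z).obj k), p.app k v = p.app k w →
      φ.app k v = φ.app k w := by
    intro k v w hvw
    obtain ⟨g, rfl⟩ := (hp.eq_iff k v w).1 hvw
    refine congrArg singularSimplex (TopCat.hom_ext (ContinuousMap.ext fun t =>
      ContinuousMap.ext fun s => ?_))
    exact (toTop_map_tupleHomotopy_smul hp' h₀ h₁ g (l := k.unop) v (t, s)).symm
  let ψ : B ⟶ TopCat.toSSet.obj M := descend p hp.surjective φ hφ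
  have hψ : ∀ {l : SimplexCategory} (w : Fin (l.len + 1) → Z)
      (t : SimplexCategory.toTop.{u}.obj l) (s : unitInterval),
      (realizationDesc ψ (SSet.toTop.map p (tupleMap w t)) : C(unitInterval, SSet.toTop.obj B')) s =
        SSet.toTop.map p' (tupleHomotopy f₀ f₁ w (t, s)) := by
    intro l w t s
    have h := congrArg (fun f => f t) (charMap_realizationDesc (k := .op l) ψ (p.app (.op l) w))
    have h' : ψ.app (.op l) (p.app (.op l) w) = φ.app (.op l) w :=
      congrArg (fun f => f.app (.op l) w) (comp_descend p hp.surjective φ hφ)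
    have h'' : realizationDesc ψ (SSet.toTop.map p (tupleMap w t)) =
        simplexMap (φ.app (.op l) w) t := by
      rw [← charMap_app, ← h']
      exact h
    exact congrArg (fun f : C(unitInterval, SSet.toTop.obj B') => f s) h''
  let K : C(SSet.toTop.obj B × unitInterval, SSet.toTop.obj B') :=
    ContinuousMap.uncurry (realizationDesc ψ).hom
  have key : ∀ {f : Z → Z'} {F : B ⟶ B'} (hF : p ≫ F = tuplesMap f ≫ p') {l : SimplexCategory}
      (w : Fin (l.len + 1) → Z) (t : SimplexCategory.toTop.{u}.obj l),
      SSet.toTop.map F (SSet.toTop.map p (tupleMap w t)) =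
        SSet.toTop.map p' (tupleMap (f ∘ w) t) := by
    intro f F hF l w t
    rw [← toTop_map_tupleMap, ← TopCat.comp_app (SSet.toTop.map p),
      ← TopCat.comp_app (SSet.toTop.map _) (SSet.toTop.map p'), ← Functor.map_comp,
      ← Functor.map_comp, hF]
  refine ⟨⟨K.comp ⟨Prod.swap, continuous_swap⟩, fun e => ?_, fun e => ?_⟩⟩
  · obtain ⟨e, rfl⟩ := hp.toTop_map_surjective e
    obtain ⟨l, w, t, rfl⟩ := exists_tupleMap e
    refine (hψ w t 0).trans ?_
    rw [tupleHomotopy_zero]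
    exact (key hF₀ w t).symm
  · obtain ⟨e, rfl⟩ := hp.toTop_map_surjective e
    obtain ⟨l, w, t, rfl⟩ := exists_tupleMap e
    refine (hψ w t 1).trans ?_
    rw [tupleHomotopy_one]
    exact (key hF₁ w t).symm

end IsOrbitMap

/-- The realization of the tuples of elements of a nonempty set is acyclic. -/
lemma isZero_homology_tuples (Z : Type u) [Nonempty Z] {n : ℕ} (hn : n ≠ 0) :
    IsZero ((freeChain.obj (TopCat.toSSet.obj (SSet.toTop.obj (tuples Z)))).homology n) := by
  have hsub : Subsingleton (SSet.toTop.obj (tuples PUnit.{u + 1})) := by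
    refine subsingleton_of_forall_eq
      (tupleMap (l := ⦋0⦌) (fun _ => PUnit.unit) (vertices ⦋0⦌ 0)) fun e => ?_
    obtain ⟨l, w, t, rfl⟩ := exists_tupleMap e
    have h := tupleMap_map (SimplexCategory.const l ⦋0⦌ 0 : l ⟶ ⦋0⦌) (fun _ => PUnit.unit) t
    rw [subsingleton_toTop_zero (SimplexCategory.toTop.map _ t) (vertices ⦋0⦌ 0)] at h
    exact h.symm
  obtain ⟨z₀⟩ := ‹Nonempty Z›
  let f : Z → PUnit.{u + 1} := fun _ => PUnit.unit
  let g : PUnit.{u + 1} → Z := fun _ => z₀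
  have hiso : HomologyIso n (TopCat.toSSet.map (SSet.toTop.map (tuplesMap f))) := by
    refine homologyIso_toSSet_map _ (SSet.toTop.map (tuplesMap g)) ?_ ?_ n
    · rw [← Functor.map_comp, ← CategoryTheory.Functor.map_id]
      let _ : MulAction PUnit.{1} Z :=
        { smul := fun _ z => z, one_smul := fun _ => rfl, mul_smul := fun _ _ _ => rfl }
      have h : IsOrbitMap PUnit (𝟙 (tuples Z)) := ⟨fun k => Function.surjective_id, fun k v w =>
        ⟨fun h => ⟨1, h⟩, fun ⟨_, h⟩ => h⟩⟩
      exact h.homotopic h (f₀ := g ∘ f) (f₁ := fun z => z) (fun _ _ => rfl) (fun _ _ => rfl) rfl rfl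
    · have : SSet.toTop.map (tuplesMap g) ≫ SSet.toTop.map (tuplesMap f) = 𝟙 _ := by
        rw [← Functor.map_comp, ← CategoryTheory.Functor.map_id]
        rfl
      rw [this]
  exact hiso.isZero (isZero_homology_of_subsingleton _ hn)

/-! ### Nerves of groups -/

lemma singleObj_functor_ext {J : Type*} [Category J] {G : Type*} [Monoid G]
    {F F' : J ⥤ SingleObj G} (h : ∀ {i j : J} (f : i ⟶ j), (F.map f : G) = (F'.map f : G)) :
    F = F' := by
  refine CategoryTheory.Functor.ext (fun _ => rfl) fun i j f => ?_
  refine (h f).trans ?_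
  change (F'.map f : G) = 1 * (F'.map f : G) * 1
  rw [one_mul, mul_one]

lemma singleObj_map_congr {J : Type*} [Category J] {G : Type*} [Monoid G]
    {F F' : J ⥤ SingleObj G} (h : F = F') {i j : J} (f : i ⟶ j) :
    (F.map f : G) = (F'.map f : G) := by
  subst h
  rfl

/-- The map from the tuples of elements of a group to the nerve of the group, which sends a
tuple `v` to the functor that sends `i ⟶ j` to `(v j)⁻¹ * v i`. -/
def tuplesToNerve (G : Type u) [Group G] : tuples G ⟶ nerve (SingleObj G) where
  app k := ↾fun v => SingleObj.differenceFunctor fun i => (v i)⁻¹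

lemma tuplesToNerve_comp_nerveMap {G G' : Type u} [Group G] [Group G'] (φ : G →* G') :
    tuplesToNerve G ≫ nerveMap φ.toFunctor = tuplesMap φ ≫ tuplesToNerve G' := by
  ext k v
  refine singleObj_functor_ext fun {i j} f => ?_
  change φ ((v j)⁻¹ * ((v i)⁻¹)⁻¹) = (φ (v j))⁻¹ * ((φ (v i))⁻¹)⁻¹
  simp

/-- The nerve of a group is the quotient of the tuples of its elements by left
multiplication. -/
lemma isOrbitMap_tuplesToNerve (G : Type u) [Group G] : IsOrbitMap G (tuplesToNerve G) where
  surjective k F := by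
    let F' : ComposableArrows (SingleObj G) k.unop.len := F
    let m : ∀ i : Fin (k.unop.len + 1), i ⟶ Fin.last _ := fun i => homOfLE (Fin.le_last i)
    let v : Fin (k.unop.len + 1) → G := fun i => F'.map (m i)
    refine ⟨v, ?_⟩
    refine singleObj_functor_ext fun {i j} f => ?_
    have h : F'.map (m i) = F'.map f ≫ F'.map (m j) := by
      rw [← Functor.map_comp]
      rfl
    have h' : v i = v j * F'.map f := h
    change (v j)⁻¹ * ((v i)⁻¹)⁻¹ = F'.map f
    rw [h', inv_inv, inv_mul_cancel_left]
  eq_iff k v w := by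
    change Fin (k.unop.len + 1) → G at v w
    constructor
    · intro h
      refine ⟨w 0 * (v 0)⁻¹, funext fun i => ?_⟩
      let m : (0 : Fin (k.unop.len + 1)) ⟶ i := homOfLE (Fin.zero_le i)
      have h₁ : (v i)⁻¹ * ((v 0)⁻¹)⁻¹ = (w i)⁻¹ * ((w 0)⁻¹)⁻¹ := singleObj_map_congr h m
      change w 0 * (v 0)⁻¹ * v i = w i
      rw [inv_inv, inv_inv] at h₁
      have h₂ : w 0 = w i * ((v i)⁻¹ * v 0) := by rw [h₁, mul_inv_cancel_left]
      rw [h₂]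
      group
    · rintro ⟨g, rfl⟩
      refine singleObj_functor_ext fun {i j} f => ?_
      change (v j)⁻¹ * ((v i)⁻¹)⁻¹ = (g * v j)⁻¹ * ((g * v i)⁻¹)⁻¹
      group

/-- The simplicial set of orbits of tuples. -/
def orbits (H : Type*) [Group H] (Z : Type u) [MulAction H Z] : SSet.{u} where
  obj k := MulAction.orbitRel.Quotient H (Fin (k.unop.len + 1) → Z)
  map θ := ↾Quotient.map' (fun v => v ∘ θ.unop.toOrderHom) (by
    rintro v w ⟨h, rfl⟩
    exact ⟨h, rfl⟩)
  map_id k := by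
    ext v
    induction v using Quotient.inductionOn'
    rfl
  map_comp θ η := by
    ext v
    induction v using Quotient.inductionOn'
    rfl

/-- The quotient map to the orbits of tuples. -/
def tuplesToOrbits (H : Type*) [Group H] (Z : Type u) [MulAction H Z] :
    tuples Z ⟶ orbits H Z where
  app k := ↾fun v => Quotient.mk'' v

lemma isOrbitMap_tuplesToOrbits (H : Type*) [Group H] (Z : Type u) [MulAction H Z] :
    IsOrbitMap H (tuplesToOrbits H Z) where
  surjective k := Quotient.mk''_surjective
  eq_iff k v w := by
    refine (Quotient.eq'' (s₁ := MulAction.orbitRel H _)).trans ?_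
    exact MulAction.mem_orbit_symm (G := H)

/-- A map of orbit simplicial sets induced by an equivariant map. -/
lemma IsOrbitMap.exists_map {H : Type*} [Group H] {Z Z' : Type u} [MulAction H Z]
    [MulAction H Z'] {B B' : SSet.{u}} {p : tuples Z ⟶ B} {p' : tuples Z' ⟶ B'}
    (hp : IsOrbitMap H p) (hp' : IsOrbitMap H p') {f : Z → Z'}
    (hf : ∀ (h : H) z, f (h • z) = h • f z) : ∃ F : B ⟶ B', p ≫ F = tuplesMap f ≫ p' := by
  refine ⟨descend p hp.surjective (tuplesMap f ≫ p') fun k v w hvw => ?_, comp_descend _ _ _ _⟩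
  obtain ⟨h, rfl⟩ := (hp.eq_iff k v w).1 hvw
  refine (hp'.eq_iff k ((tuplesMap f).app k v) _).2 ⟨h, ?_⟩
  exact funext fun i => (hf h _).symm

/-- If there are equivariant maps in both directions between two `H`-sets, then they induce
homotopy equivalences, hence homology isomorphisms, between the realizations of the orbits. -/
lemma IsOrbitMap.homologyIso {H : Type*} [Group H] {Z Z' : Type u} [MulAction H Z]
    [MulAction H Z'] {B B' : SSet.{u}} {p : tuples Z ⟶ B} {p' : tuples Z' ⟶ B'}
    (hp : IsOrbitMap H p) (hp' : IsOrbitMap H p') {f : Z → Z'} {g : Z' → Z}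
    (hf : ∀ (h : H) z, f (h • z) = h • f z) (hg : ∀ (h : H) z, g (h • z) = h • g z)
    {F : B ⟶ B'} (hF : p ≫ F = tuplesMap f ≫ p') (n : ℕ) :
    HomologyIso n (TopCat.toSSet.map (SSet.toTop.map F)) := by
  obtain ⟨K, hK⟩ := hp'.exists_map hp hg
  refine homologyIso_toSSet_map _ (SSet.toTop.map K) ?_ ?_ n
  · rw [← Functor.map_comp, ← CategoryTheory.Functor.map_id]
    refine hp.homotopic hp (f₀ := g ∘ f) (f₁ := fun z => z) (fun h z => ?_) (fun _ _ => rfl) ?_ rfl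
    · rw [Function.comp_apply, hf, hg, Function.comp_apply]
    · rw [reassoc_of% hF, hK]
      rfl
  · rw [← Functor.map_comp, ← CategoryTheory.Functor.map_id]
    refine hp'.homotopic hp' (f₀ := f ∘ g) (f₁ := fun z => z) (fun h z => ?_) (fun _ _ => rfl)
      ?_ rfl
    · rw [Function.comp_apply, hg, hf, Function.comp_apply]
    · rw [reassoc_of% hK, hF]
      rfl

/-- A free `H`-set maps equivariantly to `H`. -/
lemma exists_equivariant (H : Type*) [Group H] (Z : Type*) [MulAction H Z] [IsCancelSMul H Z] :
    ∃ g : Z → H, ∀ (h : H) z, g (h • z) = h * g z := by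
  let rep : Z → Z := fun z => (Quotient.mk'' z : MulAction.orbitRel.Quotient H Z).out
  have hrep : ∀ z, ∃ h : H, h • rep z = z := fun z =>
    (MulAction.orbitRel_apply.1 (Quotient.exact (s := MulAction.orbitRel H Z)
      (Quotient.out_eq (s := MulAction.orbitRel H Z) _).symm))
  choose g hg using hrep
  refine ⟨g, fun h z => ?_⟩
  have hr : rep (h • z) = rep z :=
    congrArg Quotient.out (Quotient.sound (s := MulAction.orbitRel H Z) ⟨h, rfl⟩)
  refine IsCancelSMul.right_cancel _ _ (rep z) ?_
  rw [mul_smul, hg, ← hr, hg]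

/-! ### Free actions of free products -/

section FreeProduct

variable (G₁ G₂ : Type u) [Group G₁] [Group G₂]

/-- A derivation on a free product which vanishes on the first factor and which is `g ↦ g - 1` on
the second factor. -/
lemma exists_derivation : ∃ D : G₁ ∗ G₂ → MonoidAlgebra ℤ (G₁ ∗ G₂),
    (∀ g h, D (g * h) = D g * MonoidAlgebra.of ℤ _ h + D h) ∧
    (∀ g, D (Monoid.Coprod.inl g) = 0) ∧
    ∀ g, D (Monoid.Coprod.inr g) = MonoidAlgebra.of ℤ _ (Monoid.Coprod.inr g) - 1 := by
  -- the derivation is the off-diagonal entry of a representation by upper triangular matrices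
  let o : G₁ ∗ G₂ →* MonoidAlgebra ℤ (G₁ ∗ G₂) := MonoidAlgebra.of ℤ (G₁ ∗ G₂)
  let ρ : G₁ ∗ G₂ →* Matrix (Fin 2) (Fin 2) (MonoidAlgebra ℤ (G₁ ∗ G₂)) :=
    Monoid.Coprod.lift
      { toFun := fun g => !![1, 0; 0, o (Monoid.Coprod.inl g)]
        map_one' := by rw [map_one, map_one, Matrix.one_fin_two]
        map_mul' := fun g h => by
          rw [Matrix.mul_fin_two, map_mul, map_mul]
          simp only [mul_zero, zero_mul, add_zero, zero_add, mul_one] }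
      { toFun := fun g => !![1, o (Monoid.Coprod.inr g) - 1; 0, o (Monoid.Coprod.inr g)]
        map_one' := by rw [map_one, map_one, sub_self, Matrix.one_fin_two]
        map_mul' := fun g h => by
          rw [Matrix.mul_fin_two, map_mul, map_mul]
          simp only [mul_zero, zero_mul, add_zero, zero_add, mul_one, one_mul, sub_mul,
            sub_add_sub_cancel'] }
  have hρ : ∀ g, ρ g 0 0 = 1 ∧ ρ g 1 0 = 0 ∧ ρ g 1 1 = o g := by
    intro g
    induction g using Monoid.Coprod.induction_on with
    | inl g => exact ⟨rfl, rfl, rfl⟩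
    | inr g => exact ⟨rfl, rfl, rfl⟩
    | mul g h hg hh =>
      rw [map_mul]
      simp only [Matrix.mul_apply, Fin.sum_univ_two, hg, hh, map_mul, mul_zero, zero_mul, add_zero,
        zero_add, mul_one, and_self]
  refine ⟨fun g => ρ g 0 1, fun g h => ?_, fun g => rfl, fun g => rfl⟩
  change ρ (g * h) 0 1 = ρ g 0 1 * o h + ρ h 0 1
  rw [map_mul]
  simp only [Matrix.mul_apply, Fin.sum_univ_two, hρ, one_mul]
  rw [add_comm]

/-- For a free action of a free product, each generator of the free abelian group is the difference
of two functions which are invariant under the two factors. -/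
lemma exists_invariant_sub_invariant (S : Type*) [MulAction (G₁ ∗ G₂) S]
    [IsCancelSMul (G₁ ∗ G₂) S] :
    ∃ φ₁ φ₂ : S → (S →₀ ℤ),
      (∀ (g : G₁) s, φ₁ ((Monoid.Coprod.inl g : G₁ ∗ G₂) • s) = φ₁ s) ∧
      (∀ (g : G₂) s, φ₂ ((Monoid.Coprod.inr g : G₁ ∗ G₂) • s) = φ₂ s) ∧
      ∀ s, φ₁ s - φ₂ s = Finsupp.single s 1 := by
  obtain ⟨D, hmul, hl, hr⟩ := exists_derivation G₁ G₂
  obtain ⟨γ, hγ⟩ := exists_equivariant (G₁ ∗ G₂) S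
  -- the two functions for the regular action, where invariance is under left multiplication
  let D₁ : G₁ ∗ G₂ → MonoidAlgebra ℤ (G₁ ∗ G₂) := fun g => D g + 1
  let D₂ : G₁ ∗ G₂ → MonoidAlgebra ℤ (G₁ ∗ G₂) := fun g => D g - (MonoidAlgebra.of ℤ _ g - 1)
  have h₁ : ∀ g h, D₁ (Monoid.Coprod.inl g * h) = D₁ h := by
    intro g h
    simp only [D₁, hmul, hl, zero_mul, zero_add]
  have h₂ : ∀ g h, D₂ (Monoid.Coprod.inr g * h) = D₂ h := by
    intro g h
    simp only [D₂, hmul, hr, map_mul, sub_mul, one_mul]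
    abel
  have h₁₂ : ∀ g, D₁ g - D₂ g = MonoidAlgebra.of ℤ _ g := by
    intro g
    simp only [D₁, D₂]
    abel
  -- a representative of the orbit of `s`, which is related to `s` by `γ s`
  let rep : S → S := fun s => (γ s)⁻¹ • s
  have hrep : ∀ (g : G₁ ∗ G₂) s, rep (g • s) = rep s := by
    intro g s
    simp only [rep, hγ, mul_inv_rev, mul_smul, inv_smul_smul]
  let ψ : S → MonoidAlgebra ℤ (G₁ ∗ G₂) →+ (S →₀ ℤ) := fun s =>
    (Finsupp.mapDomain.addMonoidHom (M := ℤ) fun g : G₁ ∗ G₂ => g • rep s).comp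
      (MonoidAlgebra.coeffAddEquiv (R := ℤ) (M := G₁ ∗ G₂)).toAddMonoidHom
  refine ⟨fun s => ψ s (D₁ (γ s)), fun s => ψ s (D₂ (γ s)), fun g s => ?_, fun g s => ?_,
    fun s => ?_⟩
  · simp only [ψ, hrep, hγ, h₁]
  · simp only [ψ, hrep, hγ, h₂]
  · change ψ s (D₁ (γ s)) - ψ s (D₂ (γ s)) = _
    rw [← map_sub, h₁₂]
    refine (Finsupp.mapDomain_single).trans ?_
    change Finsupp.single (γ s • (γ s)⁻¹ • s) 1 = _
    rw [smul_inv_smul]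

end FreeProduct

/-- The orbits under the two factors present the orbits of a free action of a free product: the
graph with vertices the orbits of the factors and edges the elements of the set acted on is a
forest (the Bass–Serre tree in each orbit). -/
lemma isForestPresentation_of_coprod {G₁ G₂ : Type u} [Group G₁] [Group G₂]
    {E B₁ B₂ B : SSet.{u}} [∀ k, MulAction (G₁ ∗ G₂) (E.obj k)]
    (hfree : ∀ k, IsCancelSMul (G₁ ∗ G₂) (E.obj k))
    (c₁ : E ⟶ B₁) (c₂ : E ⟶ B₂) (j₁ : B₁ ⟶ B) (j₂ : B₂ ⟶ B) (c : E ⟶ B)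
    (w₁ : c₁ ≫ j₁ = c) (w₂ : c₂ ≫ j₂ = c)
    (s₁ : ∀ k, Function.Surjective (c₁.app k)) (s₂ : ∀ k, Function.Surjective (c₂.app k))
    (s : ∀ k, Function.Surjective (c.app k))
    (iff₁ : ∀ k x y, c₁.app k x = c₁.app k y ↔ ∃ g : G₁, (Monoid.Coprod.inl g : G₁ ∗ G₂) • x = y)
    (iff₂ : ∀ k x y, c₂.app k x = c₂.app k y ↔ ∃ g : G₂, (Monoid.Coprod.inr g : G₁ ∗ G₂) • x = y)
    (iff : ∀ k x y, c.app k x = c.app k y ↔ ∃ g : G₁ ∗ G₂, g • x = y) :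
    IsForestPresentation (c₁ ≫ sumInl B₁ B₂) (c₂ ≫ sumInr B₁ B₂) (sumDesc j₁ j₂) where
  w := by
    rw [Category.assoc, Category.assoc, sumInl_desc, sumInr_desc, w₁, w₂]
  injective n := by
    -- the invariant functions define a left inverse
    have := hfree (.op ⦋n⦌)
    obtain ⟨φ₁, φ₂, h₁, h₂, h₁₂⟩ := exists_invariant_sub_invariant G₁ G₂ (E _⦋n⦌)
    let r₁ : chains B₁ n →ₗ[ℤ] chains E n := Finsupp.linearCombination ℤ
      fun b => φ₁ (Function.surjInv (s₁ (.op ⦋n⦌)) b)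
    let r₂ : chains B₂ n →ₗ[ℤ] chains E n := Finsupp.linearCombination ℤ
      fun b => φ₂ (Function.surjInv (s₂ (.op ⦋n⦌)) b)
    have hr₁ : ∀ x : E _⦋n⦌, r₁ (chainsMap c₁ n (Finsupp.single x 1)) = φ₁ x := by
      intro x
      obtain ⟨g, hg⟩ := (iff₁ _ _ _).1 (Function.surjInv_eq (s₁ (.op ⦋n⦌)) (c₁.app _ x)).symm
      rw [chainsMap_single]
      refine (Finsupp.linearCombination_single _ _ _).trans ?_
      rw [one_smul, ← hg, h₁]
    have hr₂ : ∀ x : E _⦋n⦌, r₂ (chainsMap c₂ n (Finsupp.single x 1)) = φ₂ x := by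
      intro x
      obtain ⟨g, hg⟩ := (iff₂ _ _ _).1 (Function.surjInv_eq (s₂ (.op ⦋n⦌)) (c₂.app _ x)).symm
      rw [chainsMap_single]
      refine (Finsupp.linearCombination_single _ _ _).trans ?_
      rw [one_smul, ← hg, h₂]
    let r : chains (sumSSet B₁ B₂) n →ₗ[ℤ] chains E n :=
      r₁ ∘ₗ sumFstChains B₁ B₂ n + r₂ ∘ₗ sumSndChains B₁ B₂ n
    have hr : r ∘ₗ (chainsMap (c₁ ≫ sumInl B₁ B₂) n - chainsMap (c₂ ≫ sumInr B₁ B₂) n) =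
        LinearMap.id := by
      refine Finsupp.lhom_ext' fun x => LinearMap.ext_ring ?_
      have h : r ((chainsMap (c₁ ≫ sumInl B₁ B₂) n - chainsMap (c₂ ≫ sumInr B₁ B₂) n)
          (Finsupp.single x 1)) = φ₁ x - φ₂ x := by
        rw [LinearMap.sub_apply, map_sub, Subdivision.chainsMap_comp, Subdivision.chainsMap_comp]
        simp only [r, LinearMap.add_apply, LinearMap.comp_apply, sumFstChains_inl,
          sumFstChains_inr, sumSndChains_inl, sumSndChains_inr, map_zero, add_zero, zero_add,
          hr₁, hr₂]
      exact h.trans (h₁₂ x)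
    exact Function.LeftInverse.injective (g := r) fun z => congrArg (fun f => f z) hr
  surjective n z := by
    obtain ⟨x, rfl⟩ := s _ z
    exact ⟨(sumInl B₁ B₂).app _ (c₁.app _ x), congrArg (fun f => f.app (.op ⦋n⦌) x) w₁⟩
  connected n := by
    let R := LinearMap.range (chainsMap (c₁ ≫ sumInl B₁ B₂) n - chainsMap (c₂ ≫ sumInr B₁ B₂) n)
    let v (x : (sumSSet B₁ B₂) _⦋n⦌) : chains (sumSSet B₁ B₂) n := Finsupp.single x 1
    let a (x : E _⦋n⦌) : chains (sumSSet B₁ B₂) n := v ((sumInl B₁ B₂).app _ (c₁.app _ x))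
    let b (x : E _⦋n⦌) : chains (sumSSet B₁ B₂) n := v ((sumInr B₁ B₂).app _ (c₂.app _ x))
    have hab : ∀ x, a x - b x ∈ R := fun x =>
      ⟨Finsupp.single x 1, by
        rw [LinearMap.sub_apply, chainsMap_single, chainsMap_single]
        rfl⟩
    have ha : ∀ (g : G₁) x, a ((Monoid.Coprod.inl g : G₁ ∗ G₂) • x) = a x := fun g x =>
      congrArg (fun y => v ((sumInl B₁ B₂).app _ y)) ((iff₁ _ _ _).2 ⟨g, rfl⟩).symm
    have hb : ∀ (g : G₂) x, b ((Monoid.Coprod.inr g : G₁ ∗ G₂) • x) = b x := fun g x =>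
      congrArg (fun y => v ((sumInr B₁ B₂).app _ y)) ((iff₂ _ _ _).2 ⟨g, rfl⟩).symm
    have hg : ∀ (g : G₁ ∗ G₂) x, a (g • x) - a x ∈ R := by
      intro g
      induction g using Monoid.Coprod.induction_on with
      | inl g =>
        intro x
        rw [ha, sub_self]
        exact zero_mem _
      | inr g =>
        intro x
        have := sub_mem (hab ((Monoid.Coprod.inr g : G₁ ∗ G₂) • x)) (hab x)
        rwa [hb, sub_sub_sub_cancel_right] at this
      | mul g h hg hh =>
        intro x
        have := add_mem (hg (h • x)) (hh x)
        rwa [sub_add_sub_cancel, ← mul_smul] at this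
    -- each vertex is connected with the first vertex of an edge
    have hv : ∀ y : (sumSSet B₁ B₂) _⦋n⦌, ∃ x : E _⦋n⦌, v y - a x ∈ R ∧
        (sumDesc j₁ j₂).app _ y = c.app _ x := by
      intro y
      rcases sumSSet_cases y with ⟨y, rfl⟩ | ⟨y, rfl⟩
      · obtain ⟨x, rfl⟩ := s₁ _ y
        refine ⟨x, ?_, congrArg (fun f => f.app (.op ⦋n⦌) x) w₁⟩
        rw [show v ((sumInl B₁ B₂).app _ (c₁.app _ x)) = a x from rfl, sub_self]
        exact zero_mem _
      · obtain ⟨x, rfl⟩ := s₂ _ y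
        refine ⟨x, ?_, congrArg (fun f => f.app (.op ⦋n⦌) x) w₂⟩
        have := neg_mem (hab x)
        rwa [neg_sub] at this
    intro x y hxy
    obtain ⟨x', hx, hx'⟩ := hv x
    obtain ⟨y', hy, hy'⟩ := hv y
    obtain ⟨g, rfl⟩ := (iff _ _ _).1 (hx'.symm.trans (hxy.trans hy'))
    have := sub_mem hx (add_mem hy (hg g x'))
    have h : v x - a x' - (v y - a (g • x') + (a (g • x') - a x')) = v x - v y := by abel
    rwa [h] at this

/-! ### Eilenberg–MacLane spaces of free products -/

/-- The realization of the orbits of tuples under a subgroup is another model of the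
Eilenberg–MacLane space of the subgroup. -/
lemma exists_subgroup_model {H G : Type u} [Group H] [Group G] (φ : H →* G)
    (hφ : Function.Injective φ) :
    ∃ (B : SSet.{u}) (p : tuples G ⟶ B) (j : B ⟶ nerve (SingleObj G))
      (f : nerve (SingleObj H) ⟶ B),
      p ≫ j = tuplesToNerve G ∧ f ≫ j = nerveMap φ.toFunctor ∧
      (∀ n, HomologyIso n (TopCat.toSSet.map (SSet.toTop.map f))) ∧
      (∀ k, Function.Surjective ((TopCat.toSSet.map (SSet.toTop.map p)).app k)) ∧
      ∀ k σ τ, (TopCat.toSSet.map (SSet.toTop.map p)).app k σ =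
        (TopCat.toSSet.map (SSet.toTop.map p)).app k τ ↔ ∃ h : H, φ h • σ = τ := by
  let _ : MulAction H G := MulAction.compHom G φ
  have hfree : IsCancelSMul H G := ⟨fun g h x hx => hφ (mul_right_cancel hx)⟩
  have hp := isOrbitMap_tuplesToOrbits H G
  have hH := isOrbitMap_tuplesToNerve H
  have hG := isOrbitMap_tuplesToNerve G
  obtain ⟨g, hg⟩ := exists_equivariant H G
  have hφ' : ∀ (h z : H), φ (h • z) = h • φ z := fun h z => map_mul φ h z
  obtain ⟨f, hf⟩ := hH.exists_map hp hφ'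
  let j : orbits H G ⟶ nerve (SingleObj G) := descend (tuplesToOrbits H G) hp.surjective
    (tuplesToNerve G) fun k v w hvw => by
      obtain ⟨h, hh⟩ := (hp.eq_iff k v w).1 hvw
      exact (hG.eq_iff k v w).2 ⟨φ h, hh⟩
  have hj : tuplesToOrbits H G ≫ j = tuplesToNerve G := comp_descend _ _ _ _
  refine ⟨orbits H G, tuplesToOrbits H G, j, f, hj, ?_, ?_, hp.toSSet_surjective, fun k σ τ => ?_⟩
  · refine comp_hom_ext hH.surjective ?_
    rw [← Category.assoc, hf, Category.assoc, hj, tuplesToNerve_comp_nerveMap]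
  · exact hH.homologyIso hp hφ' hg hf
  · exact hp.toSSet_eq_iff σ τ

/-- In degrees at least two, the homology of a free product is the direct sum of the homology of
the factors. -/
theorem homologyIso_eilenbergMacLane_coprod (G₁ G₂ : Type u) [Group G₁] [Group G₂] {n : ℕ}
    (hn : 2 ≤ n) :
    HomologyIso n (sumDesc
      (TopCat.toSSet.map (eilenbergMacLaneMap (Monoid.Coprod.inl : G₁ →* G₁ ∗ G₂)))
      (TopCat.toSSet.map (eilenbergMacLaneMap (Monoid.Coprod.inr : G₂ →* G₁ ∗ G₂)))) := by
  obtain ⟨B₁, p₁, j₁, f₁, hj₁, hf₁, h₁, s₁, iff₁⟩ := exists_subgroup_model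
    (Monoid.Coprod.inl : G₁ →* G₁ ∗ G₂) Monoid.Coprod.inl_injective
  obtain ⟨B₂, p₂, j₂, f₂, hj₂, hf₂, h₂, s₂, iff₂⟩ := exists_subgroup_model
    (Monoid.Coprod.inr : G₂ →* G₁ ∗ G₂) Monoid.Coprod.inr_injective
  have hG := isOrbitMap_tuplesToNerve (G₁ ∗ G₂)
  have hforest := isForestPresentation_of_coprod (G₁ := G₁) (G₂ := G₂)
    (fun k => hG.isCancelSMul_singular k)
    (TopCat.toSSet.map (SSet.toTop.map p₁)) (TopCat.toSSet.map (SSet.toTop.map p₂))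
    (TopCat.toSSet.map (SSet.toTop.map j₁)) (TopCat.toSSet.map (SSet.toTop.map j₂))
    (TopCat.toSSet.map (SSet.toTop.map (tuplesToNerve (G₁ ∗ G₂))))
    (by rw [← hj₁, Functor.map_comp, Functor.map_comp])
    (by rw [← hj₂, Functor.map_comp, Functor.map_comp])
    s₁ s₂ hG.toSSet_surjective iff₁ iff₂ (fun k σ τ => hG.toSSet_eq_iff σ τ)
  obtain ⟨m, rfl⟩ : ∃ m, n = m + 1 := ⟨n - 1, by omega⟩
  have hiso := hforest.homologyIso (n := m) (isZero_homology_tuples _ (by omega))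
    (isZero_homology_tuples _ (by omega))
  have h := ((h₁ (m + 1)).sum (h₂ (m + 1))).comp hiso
  rw [sumMap_desc, ← Functor.map_comp, ← Functor.map_comp, ← Functor.map_comp, ← Functor.map_comp,
    hf₁, hf₂] at h
  exact h

/-! ### Quotients of free products and the Schur multiplier of a pair -/

lemma eilenbergMacLaneMap_comp {G H K : Type u} [Group G] [Group H] [Group K] (φ : G →* H)
    (ψ : H →* K) :
    eilenbergMacLaneMap φ ≫ eilenbergMacLaneMap ψ = eilenbergMacLaneMap (ψ.comp φ) :=
  (SSet.toTop.map_comp _ _).symm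

lemma eilenbergMacLaneMap_id (G : Type u) [Group G] :
    eilenbergMacLaneMap (MonoidHom.id G) = 𝟙 (eilenbergMacLane G) :=
  SSet.toTop.map_id _

lemma isIso_eilenbergMacLaneMap {G H : Type u} [Group G] [Group H] (e : G ≃* H) :
    IsIso (eilenbergMacLaneMap e.toMonoidHom) := by
  refine ⟨eilenbergMacLaneMap e.symm.toMonoidHom, ?_, ?_⟩
  · rw [eilenbergMacLaneMap_comp, ← eilenbergMacLaneMap_id]
    exact congrArg eilenbergMacLaneMap (MonoidHom.ext e.symm_apply_apply)
  · rw [eilenbergMacLaneMap_comp, ← eilenbergMacLaneMap_id]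
    exact congrArg eilenbergMacLaneMap (MonoidHom.ext e.apply_symm_apply)

/-- In positive degrees the homology of a point vanishes, so that any such map is a homology
isomorphism. -/
lemma homologyIso_point_sum {n : ℕ} (hn : n ≠ 0) {X Y Z : TopCat.{u}} [Subsingleton X]
    [Subsingleton Y] [Subsingleton Z] (f : X ⟶ Z) (g : Y ⟶ Z) :
    HomologyIso n (sumDesc (TopCat.toSSet.map f) (TopCat.toSSet.map g)) := by
  have hX := ModuleCat.subsingleton_of_isZero (isZero_homology_of_subsingleton X hn)
  have hY := ModuleCat.subsingleton_of_isZero (isZero_homology_of_subsingleton Y hn)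
  have := (sumHomologyEquiv n (TopCat.toSSet.obj X) (TopCat.toSSet.obj Y)).toEquiv.subsingleton
  exact HomologyIso.of_isZero (ModuleCat.isZero_of_subsingleton _)
    (isZero_homology_of_subsingleton Z hn)

section Quotient

variable {G₁ G₂ : Type u} [Group G₁] [Group G₂] (N₁ : Subgroup G₁) (N₂ : Subgroup G₂)

/-- The normal closure of `N₁ ∗ N₂` in the free product `G₁ ∗ G₂`. -/
abbrev coprodNormalClosure : Subgroup (G₁ ∗ G₂) :=
  Subgroup.normalClosure ((Monoid.Coprod.map N₁.subtype N₂.subtype).range : Set (G₁ ∗ G₂))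

variable [N₁.Normal] [N₂.Normal]

/-- The map from the first quotient to the quotient of the free product. -/
def quotientInl : G₁ ⧸ N₁ →* (G₁ ∗ G₂) ⧸ coprodNormalClosure N₁ N₂ :=
  QuotientGroup.map N₁ _ Monoid.Coprod.inl fun x hx =>
    Subgroup.subset_normalClosure ⟨Monoid.Coprod.inl ⟨x, hx⟩, Monoid.Coprod.map_apply_inl _ _ _⟩

/-- The map from the second quotient to the quotient of the free product. -/
def quotientInr : G₂ ⧸ N₂ →* (G₁ ∗ G₂) ⧸ coprodNormalClosure N₁ N₂ :=
  QuotientGroup.map N₂ _ Monoid.Coprod.inr fun x hx =>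
    Subgroup.subset_normalClosure ⟨Monoid.Coprod.inr ⟨x, hx⟩, Monoid.Coprod.map_apply_inr _ _ _⟩

lemma coprodNormalClosure_le_ker :
    coprodNormalClosure N₁ N₂ ≤
      (Monoid.Coprod.map (QuotientGroup.mk' N₁) (QuotientGroup.mk' N₂)).ker := by
  refine Subgroup.normalClosure_le_normal ?_
  rintro _ ⟨x, rfl⟩
  have h : (Monoid.Coprod.map (QuotientGroup.mk' N₁) (QuotientGroup.mk' N₂)).comp
      (Monoid.Coprod.map N₁.subtype N₂.subtype) = 1 := by
    refine Monoid.Coprod.hom_ext (MonoidHom.ext fun a => ?_) (MonoidHom.ext fun a => ?_)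
    · exact (congrArg Monoid.Coprod.inl ((QuotientGroup.eq_one_iff (a : G₁)).2 a.2)).trans
        (map_one _)
    · exact (congrArg Monoid.Coprod.inr ((QuotientGroup.eq_one_iff (a : G₂)).2 a.2)).trans
        (map_one _)
  exact DFunLike.congr_fun h x

/-- The quotient of a free product by the normal closure of `N₁ ∗ N₂` is the free product of the
quotients. -/
def coprodQuotientEquiv :
    (G₁ ⧸ N₁) ∗ (G₂ ⧸ N₂) ≃* (G₁ ∗ G₂) ⧸ coprodNormalClosure N₁ N₂ :=
  MonoidHom.toMulEquiv (Monoid.Coprod.lift (quotientInl N₁ N₂) (quotientInr N₁ N₂))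
    (QuotientGroup.lift _ _ (coprodNormalClosure_le_ker N₁ N₂))
    (by
      refine Monoid.Coprod.hom_ext ?_ ?_ <;>
      exact QuotientGroup.monoidHom_ext _ (MonoidHom.ext fun a => rfl))
    (by
      refine QuotientGroup.monoidHom_ext _ (Monoid.Coprod.hom_ext ?_ ?_) <;>
      exact MonoidHom.ext fun a => rfl)

/-- In degrees at least two, the homology of the quotient of the free product is the direct sum of
the homology of the quotients. -/
lemma homologyIso_eilenbergMacLane_quotient {n : ℕ} (hn : 2 ≤ n) :
    HomologyIso n (sumDesc (TopCat.toSSet.map (eilenbergMacLaneMap (quotientInl N₁ N₂)))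
      (TopCat.toSSet.map (eilenbergMacLaneMap (quotientInr N₁ N₂)))) := by
  have := isIso_eilenbergMacLaneMap (coprodQuotientEquiv N₁ N₂)
  have h := (homologyIso_eilenbergMacLane_coprod (G₁ ⧸ N₁) (G₂ ⧸ N₂) hn).comp
    (HomologyIso.of_isIso
      (TopCat.toSSet.map (eilenbergMacLaneMap (coprodQuotientEquiv N₁ N₂).toMonoidHom)))
  have e : sumDesc (TopCat.toSSet.map (eilenbergMacLaneMap (Monoid.Coprod.inl)))
      (TopCat.toSSet.map (eilenbergMacLaneMap (Monoid.Coprod.inr))) ≫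
      TopCat.toSSet.map (eilenbergMacLaneMap (coprodQuotientEquiv N₁ N₂).toMonoidHom) =
      sumDesc (TopCat.toSSet.map (eilenbergMacLaneMap (quotientInl N₁ N₂)))
      (TopCat.toSSet.map (eilenbergMacLaneMap (quotientInr N₁ N₂))) := by
    refine sum_hom_ext ?_ ?_
    · change TopCat.toSSet.map _ ≫ TopCat.toSSet.map _ = TopCat.toSSet.map _
      rw [← Functor.map_comp, eilenbergMacLaneMap_comp]
      rfl
    · change TopCat.toSSet.map _ ≫ TopCat.toSSet.map _ = TopCat.toSSet.map _
      rw [← Functor.map_comp, eilenbergMacLaneMap_comp]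
      rfl
  rwa [e] at h

end Quotient

theorem theorem2p3 (G₁ G₂ : Type u) [Group G₁] [Group G₂]
    (N₁ : Subgroup G₁) (N₂ : Subgroup G₂) [N₁.Normal] [N₂.Normal] :
    Nonempty
      (pairSchurMultiplier (G₁ ∗ G₂)
          (Subgroup.normalClosure
            ((Monoid.Coprod.map N₁.subtype N₂.subtype).range : Set (G₁ ∗ G₂))) ≃+
        pairSchurMultiplier G₁ N₁ × pairSchurMultiplier G₂ N₂) := by
  have key := DoubleCylinder.homologyIso_map (n := 2)
    (f := eilenbergMacLaneMap (QuotientGroup.mk' (coprodNormalClosure N₁ N₂)))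
    (g := (TopCat.ofHom (ContinuousMap.const _ PUnit.unit) :
      eilenbergMacLane (G₁ ∗ G₂) ⟶ TopCat.of PUnit.{u + 1}))
    (f₁ := eilenbergMacLaneMap (QuotientGroup.mk' N₁))
    (g₁ := (TopCat.ofHom (ContinuousMap.const _ PUnit.unit) :
      eilenbergMacLane G₁ ⟶ TopCat.of PUnit.{u + 1}))
    (f₂ := eilenbergMacLaneMap (QuotientGroup.mk' N₂))
    (g₂ := (TopCat.ofHom (ContinuousMap.const _ PUnit.unit) :
      eilenbergMacLane G₂ ⟶ TopCat.of PUnit.{u + 1}))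
    (eilenbergMacLaneMap Monoid.Coprod.inl) (eilenbergMacLaneMap (quotientInl N₁ N₂)) (𝟙 _)
    (by rw [eilenbergMacLaneMap_comp, eilenbergMacLaneMap_comp]; rfl) rfl
    (eilenbergMacLaneMap Monoid.Coprod.inr) (eilenbergMacLaneMap (quotientInr N₁ N₂)) (𝟙 _)
    (by rw [eilenbergMacLaneMap_comp, eilenbergMacLaneMap_comp]; rfl) rfl
    (fun m hm => homologyIso_eilenbergMacLane_coprod G₁ G₂ (by omega))
    (fun m hm => homologyIso_eilenbergMacLane_quotient N₁ N₂ (by omega))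
    (fun m hm =>
      have : Subsingleton (TopCat.of PUnit.{u + 1}) := inferInstanceAs (Subsingleton PUnit)
      homologyIso_point_sum (by omega) _ _)
  -- `key` is about the map of the disjoint union of the two pair spaces to the pair space
  unfold HomologyIso at key
  exact ⟨(integralHomologyIso 3 _).toLinearEquiv.toAddEquiv.trans
    ((@asIso _ _ _ _ _ key).symm.toLinearEquiv.toAddEquiv.trans
      ((sumHomologyEquiv 3 _ _).trans
        (AddEquiv.prodCongr (integralHomologyIso 3 _).symm.toLinearEquiv.toAddEquiv
          (integralHomologyIso 3 _).symm.toLinearEquiv.toAddEquiv)))⟩
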